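/- Let $d\ge 1$ be an integer and $m>0$. On $\mathbb R^{1,d-1}=\mathbb R\times\mathbb R^{d-1}$ write $x=(x^0,\vec x)$, $xy=-x^0y^0+\vec x\cdot\vec y$ and $x^2=xx$. **Special functions.** $U_\alpha$ is the principal branch on $\mathbb C\setminus(-\infty,0]$ of the analytic continuation of $U_\alpha(z)=\frac1{\sqrt\pi}\int_0^\infty e^{-t-z/t}\,t^{-\alpha-1}\,dt$ ($\operatorname{Re}z>0$), and $\mathbf F_\alpha(z)=\sum_{j\ge0}\frac{z^j}{\Gamma(\alpha+1+j)\,j!}$. **Hyperboloids.** Let $dS_m=\{p:\ p^2=m^2\}$ and $\mathbb H_{\pm,m}=\{p:\ p^2=-m^2,\ \pm p^0>0\}$, and let $d\Omega_m$ denote on each of them the volume measure induced by the Minkowski metric (density $\sqrt{|\det g|}$). All identities below are identities between distributions in $x\in\mathbb R^{1,d-1}$; the Fourier transform of a measure $\mu$ is the tempered distribution $\phi\mapsto\int\big(\int e^{ipx}\phi(x)\,dx\big)d\mu(p)$, and an expression containing $\pm i0$ denotes the limit, as $\varepsilon\searrow0$, of the same expression with $\pm i\varepsilon$ in the sense of tempered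 distributions. All these limits exist. **Notation.** Put $w=-\tfrac{m^2x^2}{4}$. The symbol $w_-^{1-\frac d2}\mathbf F_{1-\frac d2}(w)$ denotes the following distribution. * If $d$ is odd, it is the product of the smooth function $\mathbf F_{1-\frac d2}(w)$ and of the distribution $w_-^{\lambda}=\frac{(w+i0)^\lambda-(w-i0)^\lambda}{2i\sin\pi\lambda}$, $\lambda=1-\frac d2$ (the standard regularization of $\theta(-w)|w|^\lambda$). * If $d$ is even, it is, with $a=\frac d2-1$, $$(-1)^{a+1}\sum_{j=0}^{a-1}\frac{\delta^{(a-1-j)}(w)}{j!}+(-1)^a\,\mathbf F_a(w)\,\theta(-w),\qquad \delta^{(k)}(w)=\frac{(-1)^k k!}{2\pi i}\Big((w-i0)^{-k-1}-(w+i0)^{-k-1}\Big).$$ **Theorem.** (i) The Fourier transform of the natural measure on the one-sheeted hyperboloid (de Sitter space) is $$\int_{dS_m}e^{ipx}\,d\Omega_m(p)=-m^{d-1}\pi^{\frac{d-1}2}\Big(i^d\,U_{\frac d2-1}\big(\tfrac{m^2(-x^2+i0)}4\big)+(-i)^d\,U_{\frac d2-1}\big(\tfrac{m^2(-x^2-i0)}4\big)\Big).$$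 If $d$ is even, then, for both choices of the sign, $$\int_{dS_m}e^{ipx}\,d\Omega_m(p)=(-1)^{\frac d2+1}\,2\,m^{d-1}\pi^{\frac{d-1}2}\Big(U_{\frac d2-1}\big(\tfrac{m^2(-x^2\pm i0)}4\big)\pm i\sqrt\pi\;w_-^{1-\frac d2}\mathbf F_{1-\frac d2}(w)\Big).$$ If $d$ is odd, then $$\int_{dS_m}e^{ipx}\,d\Omega_m(p)=-2\,i^{d-1}m^{d-1}\pi^{\frac d2}\;w_-^{1-\frac d2}\mathbf F_{1-\frac d2}(w).$$ (ii) For each of the two sheets of the two-sheeted hyperboloid, $$\int_{\mathbb H_{\pm,m}}e^{ipx}\,d\Omega_m(p)=m^{d-1}\pi^{\frac{d-1}2}\,U_{\frac d2-1}\Big(\tfrac{m^2(x^2\pm i\,\mathrm{sgn}(x^0)\,0)}4\Big).$$ -/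

import Mathlib

open MeasureTheory Filter Topology
open scoped SchwartzMap ContDiff

noncomputable section

namespace DeSitter

/-! ### Special functions -/

/-- The Olver-normalised `₀F₁` function `𝐅_α(z) = ∑ⱼ zʲ / (Γ(α + 1 + j) j!)`. -/
def boldF (α z : ℂ) : ℂ := Complex.regularizedHGFun 0 {α + 1} z

/-- The principal branch, on `ℂ ∖ (-∞, 0]`, of the function `U_α` given for `Re z > 0` by
`U_α(z) = π^(-1/2) ∫₀^∞ exp(-t - z/t) t^(-α-1) dt`.
The analytic continuation to the whole slit plane is obtained by rotating the path of integration
to the half-line `t = √z s`, `s > 0`, on which the integral converges because `Re √z > 0`.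
See `besselU_ofReal` and `differentiableOn_besselU`. -/
def besselU (α z : ℂ) : ℂ :=
  ((Real.sqrt Real.pi : ℝ) : ℂ)⁻¹ * z ^ (-α / 2) *
    ∫ s in Set.Ioi (0 : ℝ),
      Complex.exp (-(z ^ (1 / 2 : ℂ)) * ((s : ℂ) + (s : ℂ)⁻¹)) * (s : ℂ) ^ (-α - 1)

/-! ### Minkowski space -/

/-- `d`-dimensional Minkowski space `ℝ^{1,d-1}` (for `d ≥ 1`), with points `x = (x⁰, x⃗)`. -/
abbrev Mink (d : ℕ) : Type := ℝ × EuclideanSpace ℝ (Fin (d - 1))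

/-- The Minkowski product `x y = -x⁰ y⁰ + x⃗ · y⃗`. -/
def mdot {d : ℕ} (x y : Mink d) : ℝ := -(x.1 * y.1) + inner ℝ x.2 y.2

/-- `x² = -(x⁰)² + |x⃗|²`. -/
def msq {d : ℕ} (x : Mink d) : ℝ := mdot x x

/-! ### Volume measures induced by the Minkowski metric -/

/-- The `i`-th coordinate tangent vector, at the point over `q`, of the graph `p⁰ = h(p⃗)`. -/
def graphTangent {d : ℕ} (h : EuclideanSpace ℝ (Fin (d - 1)) → ℝ)
    (q : EuclideanSpace ℝ (Fin (d - 1))) (i : Fin (d - 1)) : Mink d :=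
  (fderiv ℝ h q (EuclideanSpace.single i 1), EuclideanSpace.single i 1)

/-- The metric induced on the graph `p⁰ = h(p⃗)` by the Minkowski product, in the coordinates `p⃗`. -/
def graphMetric {d : ℕ} (h : EuclideanSpace ℝ (Fin (d - 1)) → ℝ)
    (q : EuclideanSpace ℝ (Fin (d - 1))) : Matrix (Fin (d - 1)) (Fin (d - 1)) ℝ :=
  Matrix.of fun i j => mdot (graphTangent h q i) (graphTangent h q j)

/-- The (pseudo-)Riemannian volume `√|det g| dp⃗` of the graph `p⁰ = h(p⃗)`, `p⃗ ∈ D`, regarded as a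
measure on Minkowski space. -/
def graphVolume {d : ℕ} (h : EuclideanSpace ℝ (Fin (d - 1)) → ℝ)
    (D : Set (EuclideanSpace ℝ (Fin (d - 1)))) : Measure (Mink d) :=
  ((volume.restrict D).withDensity
    fun q => ENNReal.ofReal (Real.sqrt |(graphMetric h q).det|)).map fun q => (h q, q)

/-- The natural measure on the one-sheeted hyperboloid `p² = m²`: the hyperboloid is the union of
the graphs `p⁰ = ±√(|p⃗|² - m²)`, `|p⃗| > m`, and of the sphere `p⁰ = 0`, `|p⃗| = m`, which has lower
dimension and is a null set. -/
def deSitterMeasure (d : ℕ) (m : ℝ) : Measure (Mink d) :=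
  graphVolume (fun q => Real.sqrt (‖q‖ ^ 2 - m ^ 2)) {q | m < ‖q‖} +
    graphVolume (fun q => -Real.sqrt (‖q‖ ^ 2 - m ^ 2)) {q | m < ‖q‖}

/-- The natural measure on the sheet `p² = -m²`, `σ p⁰ > 0` (`σ = ±1`) of the two-sheeted
hyperboloid, which is the graph `p⁰ = σ √(|p⃗|² + m²)`. -/
def hyperbolicMeasure (d : ℕ) (m σ : ℝ) : Measure (Mink d) :=
  graphVolume (fun q => σ * Real.sqrt (‖q‖ ^ 2 + m ^ 2)) Set.univ

/-! ### Distributions -/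

/-- The tempered distribution `T` is the Fourier transform `x ↦ ∫ e^{i p x} dμ(p)` of `μ`. -/
def IsFourierTransform {d : ℕ} (μ : Measure (Mink d)) (T : 𝓢'(Mink d, ℂ)) : Prop :=
  ∀ φ : 𝓢(Mink d, ℂ),
    Integrable (fun p => ∫ x, Complex.exp (Complex.I * (mdot p x : ℝ)) * φ x) μ ∧
      T φ = ∫ p, (∫ x, Complex.exp (Complex.I * (mdot p x : ℝ)) * φ x) ∂μ

/-- `T` is the limit, as `ε ↘ 0`, of the regular tempered distributions `f ε`. -/
def IsBoundaryValue {d : ℕ} (f : ℝ → Mink d → ℂ) (T : 𝓢'(Mink d, ℂ)) : Prop :=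
  (∀ ε, 0 < ε → ∀ φ : 𝓢(Mink d, ℂ), Integrable fun x => f ε x * φ x) ∧
    ∀ φ : 𝓢(Mink d, ℂ), Tendsto (fun ε => ∫ x, f ε x * φ x) (𝓝[>] 0) (𝓝 (T φ))

/-- The limit of `f ε` as `ε ↘ 0` exists in the sense of tempered distributions. -/
def HasBoundaryValue {d : ℕ} (f : ℝ → Mink d → ℂ) : Prop := ∃ T, IsBoundaryValue f T

open Classical in
/-- The limit of `f ε` as `ε ↘ 0` in the sense of tempered distributions, if it exists. -/
def boundaryValue {d : ℕ} (f : ℝ → Mink d → ℂ) : 𝓢'(Mink d, ℂ) :=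
  if h : HasBoundaryValue f then h.choose else 0

/-- The family whose boundary value is `U_{d/2-1}(m² (-x² + i σ 0) / 4)`, `σ = ±1`. -/
def deSitterU (d : ℕ) (m σ ε : ℝ) (x : Mink d) : ℂ :=
  besselU ((d : ℂ) / 2 - 1) ((m : ℂ) ^ 2 * (-(msq x : ℝ) + Complex.I * (σ * ε : ℝ)) / 4)

/-- The family whose boundary value is `U_{d/2-1}(m² (x² + i σ sgn(x⁰) 0) / 4)`, `σ = ±1`. -/
def hyperbolicU (d : ℕ) (m σ ε : ℝ) (x : Mink d) : ℂ :=
  besselU ((d : ℂ) / 2 - 1)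
    ((m : ℂ) ^ 2 * ((msq x : ℝ) + Complex.I * (σ * Real.sign x.1 * ε : ℝ)) / 4)

/-- The function `w = -m² x² / 4` on Minkowski space. -/
def warg {d : ℕ} (m : ℝ) (x : Mink d) : ℝ := -(m ^ 2 * msq x) / 4

/-- The family whose boundary value is `(w + i σ 0)^l`, `σ = ±1`, with `w = -m² x² / 4`. -/
def wPow (d : ℕ) (m σ : ℝ) (l : ℂ) (ε : ℝ) (x : Mink d) : ℂ :=
  ((warg m x : ℝ) + Complex.I * (σ * ε : ℝ)) ^ l

/-- For `l ∉ ℤ`, the distribution `w₋^l = ((w + i0)^l - (w - i0)^l) / (2 i sin(π l))`, the standard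
regularisation of `θ(-w) |w|^l`; here `w = -m² x² / 4`. -/
def wMinusPow (d : ℕ) (m : ℝ) (l : ℂ) : 𝓢'(Mink d, ℂ) :=
  (2 * Complex.I * Complex.sin (Real.pi * l))⁻¹ •
    (boundaryValue (wPow d m 1 l) - boundaryValue (wPow d m (-1) l))

/-- For `l ∉ {0, 1, 2, …}`, the distribution
`ρ₋^l(w) = Γ(-l) / (2 π i) ((w - i0)^l - (w + i0)^l)`, where `w = -m² x² / 4`.
It equals `w₋^l / Γ(l + 1)` for `l ∉ ℤ`, and `(-1)^n δ^{(n)}(w)` for `l = -n - 1`. -/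
def rhoMinus (d : ℕ) (m : ℝ) (l : ℂ) : 𝓢'(Mink d, ℂ) :=
  (Complex.Gamma (-l) / (2 * Real.pi * Complex.I)) •
    (boundaryValue (wPow d m (-1) l) - boundaryValue (wPow d m 1 l))

/-! ### Helper facts -/

/-- On the positive half-line, `besselU` is given by the defining integral of `U_α`. -/
theorem besselU_ofReal (α : ℂ) {x : ℝ} (hx : 0 < x) :
    besselU α x = ((Real.sqrt Real.pi : ℝ) : ℂ)⁻¹ *
      ∫ t in Set.Ioi (0 : ℝ), Complex.exp (-(t : ℂ) - (x : ℂ) / t) * (t : ℂ) ^ (-α - 1) := by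
  have hb : 0 < Real.sqrt x := Real.sqrt_pos.2 hx
  have hbc : ((Real.sqrt x : ℝ) : ℂ) ≠ 0 := by exact_mod_cast hb.ne'
  have hsq : ((x : ℝ) : ℂ) ^ (1 / 2 : ℂ) = ((Real.sqrt x : ℝ) : ℂ) := by
    rw [Real.sqrt_eq_rpow, Complex.ofReal_cpow hx.le]; norm_num
  have hxx : ((x : ℝ) : ℂ) = ((Real.sqrt x : ℝ) : ℂ) * ((Real.sqrt x : ℝ) : ℂ) := by
    exact_mod_cast (Real.mul_self_sqrt hx.le).symm
  have hpow : ((x : ℝ) : ℂ) ^ (-α / 2) = ((Real.sqrt x : ℝ) : ℂ) ^ (-α) := by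
    conv_lhs => rw [hxx]
    rw [Complex.mul_cpow_ofReal_nonneg hb.le hb.le, ← Complex.cpow_add _ _ hbc]
    ring_nf
  have key := integral_comp_mul_left_Ioi
    (fun t : ℝ => Complex.exp (-(t : ℂ) - (x : ℂ) / t) * (t : ℂ) ^ (-α - 1)) 0 hb
  rw [mul_zero] at key
  have hI : (∫ t in Set.Ioi (0 : ℝ), Complex.exp (-(t : ℂ) - (x : ℂ) / t) * (t : ℂ) ^ (-α - 1)) =
      ((Real.sqrt x : ℝ) : ℂ) * ∫ s in Set.Ioi (0 : ℝ),
        (fun t : ℝ => Complex.exp (-(t : ℂ) - (x : ℂ) / t) * (t : ℂ) ^ (-α - 1))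
          (Real.sqrt x * s) := by
    rw [key, Complex.real_smul, Complex.ofReal_inv, mul_inv_cancel_left₀ hbc]
  rw [besselU, hI, hsq, hpow, mul_assoc]
  congr 1
  rw [← integral_const_mul, ← integral_const_mul]
  refine setIntegral_congr_fun measurableSet_Ioi fun s hs => ?_
  have hs' : (0 : ℝ) < s := hs
  have hs0 : (s : ℂ) ≠ 0 := by exact_mod_cast hs'.ne'
  simp only
  rw [Complex.ofReal_mul, Complex.mul_cpow_ofReal_nonneg hb.le hs'.le,
    Complex.cpow_sub _ _ hbc, Complex.cpow_one]
  have : -(((Real.sqrt x : ℝ) : ℂ) * s) - (x : ℂ) / (((Real.sqrt x : ℝ) : ℂ) * s) =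
      -((Real.sqrt x : ℝ) : ℂ) * ((s : ℂ) + (s : ℂ)⁻¹) := by
    rw [hxx]; field_simp; ring
  rw [this]
  field_simp

theorem integrableOn_exp_add_inv (r : ℝ) {δ : ℝ} (hδ : 0 < δ) :
    IntegrableOn (fun s : ℝ => Real.exp (-δ * (s + s⁻¹)) * s ^ r) (Set.Ioi 0) := by
  obtain ⟨N, hN⟩ := exists_nat_gt (-1 - r)
  have h1 := (integrableOn_rpow_mul_exp_neg_mul_rpow (s := r + N) (p := 1) (by linarith)
    one_pos hδ).const_mul ((N.factorial : ℝ) / δ ^ N)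
  refine Integrable.mono' h1 ?_ ?_
  · refine ContinuousOn.aestronglyMeasurable ?_ measurableSet_Ioi
    intro s hs
    have hs' : s ≠ 0 := ne_of_gt hs
    refine ContinuousAt.continuousWithinAt ?_
    refine ContinuousAt.mul ?_ (Real.continuousAt_rpow_const _ _ (Or.inl hs'))
    fun_prop (disch := assumption)
  · filter_upwards [ae_restrict_mem measurableSet_Ioi] with s hs
    have hs' : 0 < s := hs
    rw [Real.norm_of_nonneg (by positivity), Real.rpow_one, Real.rpow_add hs', Real.rpow_natCast]
    have h2 := Real.pow_div_factorial_le_exp (δ * s⁻¹) (by positivity) N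
    have h3 : Real.exp (-δ * (s + s⁻¹)) = Real.exp (-δ * s) * (Real.exp (δ * s⁻¹))⁻¹ := by
      rw [← Real.exp_neg, ← Real.exp_add]; ring_nf
    have h4 : (Real.exp (δ * s⁻¹))⁻¹ ≤ (N.factorial : ℝ) / δ ^ N * s ^ N := by
      rw [inv_le_comm₀ (Real.exp_pos _) (by positivity)]
      refine le_trans (le_of_eq ?_) h2
      rw [mul_pow, inv_pow]
      field_simp
    rw [h3]
    calc _ ≤ Real.exp (-δ * s) * ((N.factorial : ℝ) / δ ^ N * s ^ N) * s ^ r := by gcongr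
      _ = _ := by ring

/-- `besselU α` is analytic on the slit plane. -/
theorem differentiableOn_besselU (α : ℂ) : DifferentiableOn ℂ (besselU α) Complex.slitPlane := by
  have main : ∀ w : ℂ, 0 < w.re → DifferentiableAt ℂ (fun w : ℂ => ∫ s in Set.Ioi (0 : ℝ),
      Complex.exp (-w * ((s : ℂ) + (s : ℂ)⁻¹)) * (s : ℂ) ^ (-α - 1)) w := by
    intro w hw
    have hcont : ∀ v : ℂ, ContinuousOn (fun s : ℝ =>
        Complex.exp (-v * ((s : ℂ) + (s : ℂ)⁻¹)) * (s : ℂ) ^ (-α - 1)) (Set.Ioi 0) := by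
      intro v s hs
      have hs0 : (s : ℂ) ≠ 0 := by exact_mod_cast (ne_of_gt hs)
      refine ContinuousAt.continuousWithinAt ?_
      refine ContinuousAt.mul (by fun_prop (disch := assumption)) ?_
      exact Complex.continuousAt_ofReal_cpow_const _ _ (Or.inr (ne_of_gt hs))
    have hnorm : ∀ v : ℂ, ∀ s : ℝ, 0 < s →
        ‖Complex.exp (-v * ((s : ℂ) + (s : ℂ)⁻¹)) * (s : ℂ) ^ (-α - 1)‖ =
          Real.exp (-v.re * (s + s⁻¹)) * s ^ (-α.re - 1) := by
      intro v s hs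
      rw [norm_mul, Complex.norm_exp, Complex.norm_cpow_eq_rpow_re_of_pos hs]
      have : (s : ℂ) + (s : ℂ)⁻¹ = ((s + s⁻¹ : ℝ) : ℂ) := by push_cast; rfl
      rw [this, Complex.re_mul_ofReal]
      simp
    have hder := hasDerivAt_integral_of_dominated_loc_of_deriv_le
      (μ := volume.restrict (Set.Ioi (0 : ℝ)))
      (F := fun (v : ℂ) (s : ℝ) => Complex.exp (-v * ((s : ℂ) + (s : ℂ)⁻¹)) * (s : ℂ) ^ (-α - 1))
      (F' := fun (v : ℂ) (s : ℝ) => -((s : ℂ) + (s : ℂ)⁻¹) *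
        (Complex.exp (-v * ((s : ℂ) + (s : ℂ)⁻¹)) * (s : ℂ) ^ (-α - 1)))
      (x₀ := w) (s := {v : ℂ | w.re / 2 < v.re})
      (bound := fun s : ℝ => Real.exp (-(w.re / 2) * (s + s⁻¹)) * s ^ (-α.re) +
        Real.exp (-(w.re / 2) * (s + s⁻¹)) * s ^ (-α.re - 2))
      ((isOpen_lt continuous_const Complex.continuous_re).mem_nhds (by simp; linarith))
      (Eventually.of_forall fun v => (hcont v).aestronglyMeasurable measurableSet_Ioi)
      ?_ ?_ ?_ ?_ ?_
    · exact hder.2.differentiableAt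
    · refine Integrable.mono' (integrableOn_exp_add_inv (-α.re - 1) hw)
        ((hcont w).aestronglyMeasurable measurableSet_Ioi) ?_
      filter_upwards [ae_restrict_mem measurableSet_Ioi] with s hs
      exact (hnorm w s hs).le
    · refine ContinuousOn.aestronglyMeasurable ?_ measurableSet_Ioi
      refine ContinuousOn.mul ?_ (hcont w)
      intro s hs
      have hs0 : (s : ℂ) ≠ 0 := by exact_mod_cast (ne_of_gt hs)
      exact ContinuousAt.continuousWithinAt (by fun_prop (disch := assumption))
    · filter_upwards [ae_restrict_mem measurableSet_Ioi] with s hs v hv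
      have hs' : 0 < s := hs
      have hv' : w.re / 2 < v.re := hv
      rw [norm_mul, hnorm v s hs, norm_neg]
      have : (s : ℂ) + (s : ℂ)⁻¹ = ((s + s⁻¹ : ℝ) : ℂ) := by push_cast; rfl
      rw [this, Complex.norm_real, Real.norm_of_nonneg (by positivity)]
      have e1 : s ^ (-α.re) = s * s ^ (-α.re - 1) := by
        rw [Real.rpow_sub_one hs'.ne']; field_simp
      have e2 : s ^ (-α.re - 2) = s⁻¹ * s ^ (-α.re - 1) := by
        rw [show -α.re - 2 = (-α.re - 1) - 1 by ring, Real.rpow_sub_one hs'.ne']; field_simp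
      have e3 : Real.exp (-v.re * (s + s⁻¹)) ≤ Real.exp (-(w.re / 2) * (s + s⁻¹)) := by
        apply Real.exp_le_exp.2
        have : 0 < s + s⁻¹ := by positivity
        nlinarith
      rw [e1, e2]
      calc _ ≤ (s + s⁻¹) * (Real.exp (-(w.re / 2) * (s + s⁻¹)) * s ^ (-α.re - 1)) := by gcongr
        _ = _ := by ring
    · exact (integrableOn_exp_add_inv _ (by linarith)).add (integrableOn_exp_add_inv _ (by linarith))
    · filter_upwards with s v _
      have h := ((((hasDerivAt_id v).neg).mul_const ((s : ℂ) + (s : ℂ)⁻¹)).cexp).mul_const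
        ((s : ℂ) ^ (-α - 1))
      exact h.congr_deriv (by simp only [Pi.neg_apply, id]; ring)
  intro z hz
  refine DifferentiableAt.differentiableWithinAt ?_
  have hz0 : z ≠ 0 := Complex.slitPlane_ne_zero hz
  have h1 : DifferentiableAt ℂ (fun z : ℂ => z ^ (1 / 2 : ℂ)) z :=
    differentiableAt_id.cpow_const hz
  have hre : 0 < (z ^ (1 / 2 : ℂ)).re := by
    rw [Complex.cpow_def_of_ne_zero hz0, Complex.exp_re]
    refine mul_pos (Real.exp_pos _) (Real.cos_pos_of_mem_Ioo ?_)
    have him : (Complex.log z * (1 / 2)).im = z.arg / 2 := by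
      rw [show (1 / 2 : ℂ) = ((1 / 2 : ℝ) : ℂ) by norm_num, Complex.im_mul_ofReal,
        Complex.log_im]
      ring
    rw [him]
    have h2 := Complex.neg_pi_lt_arg z
    have h3 := lt_of_le_of_ne (Complex.arg_le_pi z) (Complex.mem_slitPlane_iff_arg.1 hz).1
    constructor <;> linarith
  have h2 : DifferentiableAt ℂ (fun z : ℂ => z ^ (-α / 2)) z := differentiableAt_id.cpow_const hz
  exact (h2.const_mul _).mul (DifferentiableAt.comp (𝕜 := ℂ)
    (g := fun w : ℂ => ∫ s in Set.Ioi (0 : ℝ),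
      Complex.exp (-w * ((s : ℂ) + (s : ℂ)⁻¹)) * (s : ℂ) ^ (-α - 1))
    (f := fun z : ℂ => z ^ (1 / 2 : ℂ)) z (main _ hre) h1)
theorem differentiable_boldF (α : ℂ) : Differentiable ℂ (boldF α) := by
  have hr : (Complex.regularizedHGFunSeries 0 {α + 1}).radius = ⊤ :=
    Complex.radius_regularizedHGFunSeries_eq_top (by simp)
  have h := (Complex.regularizedHGFunSeries 0 {α + 1}).hasFPowerSeriesOnBall (by rw [hr]; simp)
  intro z
  exact (h.analyticAt_of_mem (by rw [hr]; simp)).differentiableAt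

theorem boldF_eq_tsum (α z : ℂ) :
    boldF α z = ∑' j : ℕ, z ^ j / (Complex.Gamma (α + 1 + j) * (j.factorial : ℂ)) := by
  rw [boldF, Complex.regularizedHGFun, FormalMultilinearSeries.sum]
  refine tsum_congr fun j => ?_
  simp [Complex.regularizedHGFunCoeff, Complex.regularizedHGFunSeries]
  ring

theorem contDiff_boldF_warg (d : ℕ) (m : ℝ) (α : ℂ) :
    ContDiff ℝ ∞ fun x : Mink d => boldF α (warg m x : ℝ) := by
  have h1 : ContDiff ℝ ∞ (boldF α) :=
    ((differentiable_boldF α).contDiff (n := ∞)).restrict_scalars ℝ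
  have h2 : ContDiff ℝ ∞ fun x : Mink d => ((warg m x : ℝ) : ℂ) := by
    refine Complex.ofRealCLM.contDiff.comp ?_
    have h3 : ContDiff ℝ ∞ fun x : Mink d => -(m ^ 2 * (-(x.1 * x.1) + inner ℝ x.2 x.2)) / 4 := by
      have h4 : ContDiff ℝ ∞ fun x : Mink d => inner ℝ x.2 x.2 := contDiff_snd.inner ℝ contDiff_snd
      fun_prop
    exact h3
  exact h1.comp h2

/-- The test function `x ↦ 𝐅_α(w(x)) φ(x)`, `w = -m² x² / 4`, for a test function `φ`. -/
def mulBoldF (d : ℕ) (m : ℝ) (α : ℂ) (φ : 𝓢(Mink d, ℂ)) (hφ : HasCompactSupport φ) :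
    𝓢(Mink d, ℂ) :=
  HasCompactSupport.toSchwartzMap (f := fun x => boldF α (warg m x : ℝ) * φ x)
    hφ.mul_left ((contDiff_boldF_warg d m α).mul (φ.smooth ⊤))

/-! ### The distribution `w₋^{1-d/2} 𝐅_{1-d/2}(w)`, where `w = -m² x² / 4` -/

/-- For odd `d`: the product of the distribution `w₋^{1-d/2}` and of the smooth function
`𝐅_{1-d/2}(w)`, evaluated on a test function. -/
def negPowFOdd (d : ℕ) (m : ℝ) (φ : 𝓢(Mink d, ℂ)) (hφ : HasCompactSupport φ) : ℂ :=
  wMinusPow d m (1 - (d : ℂ) / 2) (mulBoldF d m (1 - (d : ℂ) / 2) φ hφ)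

/-- For even `d`, with `a = d/2 - 1`: the distribution
`∑_{j < a} (-1)^j / j! ρ₋^{j-a}(w) + (-1)^a 𝐅_a(w) θ(-w)
  = (-1)^(a+1) ∑_{j < a} δ^{(a-1-j)}(w) / j! + (-1)^a 𝐅_a(w) θ(-w)`,
evaluated on a test function. -/
def negPowFEven (d : ℕ) (m : ℝ) (φ : 𝓢(Mink d, ℂ)) : ℂ :=
  (∑ j ∈ Finset.range (d / 2 - 1),
      ((-1 : ℂ) ^ j / (j.factorial : ℂ)) * rhoMinus d m ((j : ℂ) - ((d / 2 - 1 : ℕ) : ℂ)) φ) +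
    (-1 : ℂ) ^ (d / 2 - 1) *
      ∫ x in {x : Mink d | warg m x < 0}, boldF ((d / 2 - 1 : ℕ) : ℂ) (warg m x : ℝ) * φ x

end DeSitter

end

/-! The idea is to Fourier transform in the spatial variables only. For a measure carried by a graph
p⁰ = h(q), pairing with a test function φ gives an integral over (t, q) of the density times e^{-i
h(q) t} against the spatial Fourier transform of φ (`graphVolume_fourier`). On the hyperboloids the
density is m / √(|q|² + m²) or m / √(|q|² - m²) (`sqrt_abs_det_graphMetric`). It remains to compute
the spatial transform of the regularised function U_{d/2-1} at fixed t and to let ε tend to 0 under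
a dominating function (`tendsto_integral_of_kernel`).

That transform comes from the identity ∫₀^∞ exp(-Aτ - B/τ) τ^{-α-1} dτ = √π A^α U_α(AB) for Re A, Re
B > 0 (`laplaceIntegral_eq_besselU`). If B is affine in |y|², the integrand is Gaussian in y. In n =
d - 1 dimensions its transform contributes τ^{n/2}, and α = (n - 1)/2 = d/2 - 1 is exactly the order
for which τ^{-1/2} is left (`integral_laplaceIntegral_mul`). The remaining integral is elementary
because U_{-1/2}(z) = e^{-2√z} (`besselU_neg_half`).

For a sheet of the two-sheeted hyperboloid, A = √(-t² + iσ sgn(t) ε) has positive real part and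
tends to iσt; the kernel (m/E) e^{-EA}, E = √(|q|² + m²), becomes that of the graph p⁰ = σE. For de
Sitter space A has to be pushed to the imaginary point iσ, as a limit of admissible parameters
(`integral_mul_eq_of_tendsto`, `integral_besselU_slice`). The limiting kernel decays in |t| where
|q| < m and oscillates like e^{iσE|t|}, now with E = √(|q|² - m²), where |q| > m. The weights i^d
and (-i)^d cancel the decaying parts and turn the oscillating ones into the sum over the two graphs
(`deSitterKernel_combination`).

The remaining formulas of (i) follow from the jump of U_{d/2-1} across its cut. At integer order U
is a finite sum of negative powers, plus log z times 𝐅_a, plus an entire function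
(`exists_besselU_natCast_eq`); the powers produce the δ terms and the logarithm the step function.
At half-integer order U is a combination of z^{-α} 𝐅_{-α} and the entire 𝐅_α
(`besselU_half_integer`), so only the power jumps. The powers (w ± i0)^{1-d/2} have limits by the
same partial transform with A tending to 0 (`hasBoundaryValue_wPow_top`), and less singular integer
powers follow by multiplying with w. -/

noncomputable section

namespace DeSitter

/-! ### The Laplace integral and `U_α` along a ray -/

/-- The integral `∫₀^∞ exp(-Aτ - B/τ) τ^β dτ`. -/
def laplaceIntegral (β A B : ℂ) : ℂ :=
  ∫ τ in Set.Ioi (0 : ℝ), Complex.exp (-(A * τ) - B / τ) * (τ : ℂ) ^ β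

theorem integrableOn_exp_neg_mul_sub_div (r : ℝ) {a b : ℝ} (ha : 0 < a) (hb : 0 < b) :
    IntegrableOn (fun s : ℝ => Real.exp (-(a * s) - b / s) * s ^ r) (Set.Ioi 0) := by
  refine Integrable.mono' (integrableOn_exp_add_inv r (lt_min ha hb)) ?_ ?_
  · refine ContinuousOn.aestronglyMeasurable ?_ measurableSet_Ioi
    intro s hs
    have hs' : s ≠ 0 := ne_of_gt hs
    refine ContinuousAt.continuousWithinAt ?_
    refine ContinuousAt.mul ?_ (Real.continuousAt_rpow_const _ _ (Or.inl hs'))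
    fun_prop (disch := assumption)
  · filter_upwards [ae_restrict_mem measurableSet_Ioi] with s hs
    have hs' : 0 < s := hs
    rw [Real.norm_of_nonneg (by positivity)]
    have h1 : min a b * s ≤ a * s := by gcongr; exact min_le_left _ _
    have h2 : min a b * s⁻¹ ≤ b * s⁻¹ := by gcongr; exact min_le_right _ _
    gcongr
    rw [div_eq_mul_inv]; linarith

theorem norm_laplace_integrand (β A B : ℂ) {s : ℝ} (hs : 0 < s) :
    ‖Complex.exp (-(A * s) - B / s) * (s : ℂ) ^ β‖ =
      Real.exp (-(A.re * s) - B.re / s) * s ^ β.re := by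
  rw [norm_mul, Complex.norm_exp, Complex.norm_cpow_eq_rpow_re_of_pos hs]
  simp [Complex.div_ofReal_re]

theorem continuousOn_laplace_integrand (β A B : ℂ) :
    ContinuousOn (fun s : ℝ => Complex.exp (-(A * s) - B / s) * (s : ℂ) ^ β) (Set.Ioi 0) := by
  intro s hs
  have hs0 : (s : ℂ) ≠ 0 := by exact_mod_cast (ne_of_gt hs)
  refine ContinuousAt.continuousWithinAt ?_
  refine ContinuousAt.mul (by fun_prop (disch := assumption)) ?_
  exact Complex.continuousAt_ofReal_cpow_const _ _ (Or.inr (ne_of_gt hs))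

theorem integrableOn_laplace_integrand (β : ℂ) {A B : ℂ} (hA : 0 < A.re) (hB : 0 < B.re) :
    IntegrableOn (fun s : ℝ => Complex.exp (-(A * s) - B / s) * (s : ℂ) ^ β) (Set.Ioi 0) := by
  refine Integrable.mono' (integrableOn_exp_neg_mul_sub_div β.re hA hB)
    ((continuousOn_laplace_integrand β A B).aestronglyMeasurable measurableSet_Ioi) ?_
  filter_upwards [ae_restrict_mem measurableSet_Ioi] with s hs
  exact (norm_laplace_integrand β A B hs).le

/-- Differentiating under the integral produces the factor -A'τ - B'/τ, which moves the exponent by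
±1. Both parameters may vary because the rotation of the path moves along (u, z/u), while the
derivative of U_α moves B alone. -/
theorem hasDerivAt_laplaceIntegral (β : ℂ) {A B A' B' : ℂ → ℂ} {w₀ : ℂ}
    (hA : ∀ᶠ w in 𝓝 w₀, HasDerivAt A (A' w) w) (hB : ∀ᶠ w in 𝓝 w₀, HasDerivAt B (B' w) w)
    (hA' : ContinuousAt A' w₀) (hB' : ContinuousAt B' w₀)
    (hA0 : 0 < (A w₀).re) (hB0 : 0 < (B w₀).re) :
    HasDerivAt (fun w => laplaceIntegral β (A w) (B w))
      (-(A' w₀) * laplaceIntegral (β + 1) (A w₀) (B w₀) -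
        B' w₀ * laplaceIntegral (β - 1) (A w₀) (B w₀)) w₀ := by
  -- Half of each real part is still a lower bound near w₀, which gives a dominating function
  -- independent of w.
  set a := (A w₀).re / 2
  set b := (B w₀).re / 2
  have hcA : ∀ᶠ w in 𝓝 w₀, a < (A w).re :=
    (Complex.continuous_re.continuousAt.comp hA.self_of_nhds.continuousAt).eventually_const_lt
      (by simp only [a, Function.comp]; linarith)
  have hcB : ∀ᶠ w in 𝓝 w₀, b < (B w).re :=
    (Complex.continuous_re.continuousAt.comp hB.self_of_nhds.continuousAt).eventually_const_lt
      (by simp only [b, Function.comp]; linarith)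
  have hbA : ∀ᶠ w in 𝓝 w₀, ‖A' w‖ < ‖A' w₀‖ + 1 :=
    hA'.norm.eventually_lt_const (by linarith)
  have hbB : ∀ᶠ w in 𝓝 w₀, ‖B' w‖ < ‖B' w₀‖ + 1 :=
    hB'.norm.eventually_lt_const (by linarith)
  have hall := hA.and (hB.and (hcA.and (hcB.and (hbA.and hbB))))
  have hder := hasDerivAt_integral_of_dominated_loc_of_deriv_le
    (μ := volume.restrict (Set.Ioi (0 : ℝ)))
    (F := fun (w : ℂ) (s : ℝ) => Complex.exp (-(A w * s) - B w / s) * (s : ℂ) ^ β)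
    (F' := fun (w : ℂ) (s : ℝ) =>
      -(A' w) * (Complex.exp (-(A w * s) - B w / s) * (s : ℂ) ^ (β + 1)) -
        B' w * (Complex.exp (-(A w * s) - B w / s) * (s : ℂ) ^ (β - 1)))
    (x₀ := w₀) (s := {w | _}) hall
    (bound := fun s : ℝ =>
      (‖A' w₀‖ + 1) * (Real.exp (-(a * s) - b / s) * s ^ (β + 1).re) +
      (‖B' w₀‖ + 1) * (Real.exp (-(a * s) - b / s) * s ^ (β - 1).re))
    (Eventually.of_forall fun w =>
      (continuousOn_laplace_integrand β _ _).aestronglyMeasurable measurableSet_Ioi)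
    (integrableOn_laplace_integrand β hA0 hB0) ?_ ?_ ?_ ?_
  · refine hder.2.congr_deriv ?_
    rw [integral_sub, integral_const_mul, integral_const_mul]
    · rfl
    · exact (integrableOn_laplace_integrand _ hA0 hB0).const_mul _
    · exact (integrableOn_laplace_integrand _ hA0 hB0).const_mul _
  · exact (((continuousOn_laplace_integrand _ _ _).aestronglyMeasurable
      measurableSet_Ioi).const_mul _).sub (((continuousOn_laplace_integrand _ _ _).aestronglyMeasurable
      measurableSet_Ioi).const_mul _)
  · filter_upwards [ae_restrict_mem measurableSet_Ioi] with s hs w hw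
    obtain ⟨-, -, h3, h4, h5, h6⟩ := hw
    have hs' : 0 < s := hs
    have key : ∀ r : ℝ, Real.exp (-((A w).re * s) - (B w).re / s) * s ^ r ≤
        Real.exp (-(a * s) - b / s) * s ^ r := fun r => by gcongr
    refine (norm_sub_le _ _).trans ?_
    rw [norm_mul (-(A' w)), norm_mul (B' w), norm_neg, norm_laplace_integrand _ _ _ hs',
      norm_laplace_integrand _ _ _ hs']
    gcongr
  · have h0 : 0 < a := by simp only [a]; linarith
    have h0' : 0 < b := by simp only [b]; linarith
    exact ((integrableOn_exp_neg_mul_sub_div _ h0 h0').const_mul _).add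
      ((integrableOn_exp_neg_mul_sub_div _ h0 h0').const_mul _)
  · filter_upwards [ae_restrict_mem measurableSet_Ioi] with s hs w hw
    have hs0 : (s : ℂ) ≠ 0 := by exact_mod_cast (ne_of_gt hs)
    have h := ((((hw.1.mul_const (s : ℂ)).neg).sub (hw.2.1.div_const (s : ℂ))).cexp).mul_const
      ((s : ℂ) ^ β)
    refine h.congr_deriv ?_
    rw [Complex.cpow_add _ _ hs0, Complex.cpow_sub _ _ hs0, Complex.cpow_one]
    simp only [Pi.sub_apply, Pi.neg_apply]
    field_simp

/-- The substitution τ ↦ cτ. It makes the function G used in `laplaceIntegral_eq_besselU`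
homogeneous of degree zero. -/
theorem laplaceIntegral_scale (β A B : ℂ) {c : ℝ} (hc : 0 < c) :
    laplaceIntegral β (c * A) (B / c) = (c : ℂ) ^ (-β - 1) * laplaceIntegral β A B := by
  have hc0 : (c : ℂ) ≠ 0 := by exact_mod_cast hc.ne'
  have key := integral_comp_mul_left_Ioi
    (fun t : ℝ => Complex.exp (-(A * t) - B / t) * (t : ℂ) ^ β) 0 hc
  rw [mul_zero, Complex.real_smul] at key
  have h2 : laplaceIntegral β A B = c * ∫ x in Set.Ioi (0 : ℝ),
      Complex.exp (-(A * (c * x : ℝ)) - B / (c * x : ℝ)) * ((c * x : ℝ) : ℂ) ^ β := by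
    rw [key, Complex.ofReal_inv, mul_inv_cancel_left₀ hc0]; rfl
  rw [h2, laplaceIntegral, ← integral_const_mul, ← integral_const_mul]
  refine setIntegral_congr_fun measurableSet_Ioi fun s hs => ?_
  have hs' : (0 : ℝ) < s := hs
  have hs0 : (s : ℂ) ≠ 0 := by exact_mod_cast hs'.ne'
  rw [Complex.ofReal_mul, Complex.mul_cpow_ofReal_nonneg hc.le hs'.le,
    Complex.cpow_sub _ _ hc0, Complex.cpow_neg, Complex.cpow_one]
  have hcb : (c : ℂ) ^ β ≠ 0 := by simp [Complex.cpow_eq_zero_iff, hc0]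
  have e : -(A * (c * s)) - B / ((c : ℂ) * s) = -(c * A * s) - B / c / s := by
    field_simp
  rw [e]
  field_simp

theorem ofReal_mul_cpow {c : ℝ} (hc : 0 < c) {u : ℂ} (hu : u ≠ 0) (γ : ℂ) :
    ((c : ℂ) * u) ^ γ = (c : ℂ) ^ γ * u ^ γ := by
  have hc0 : (c : ℂ) ≠ 0 := by exact_mod_cast hc.ne'
  rw [Complex.cpow_def_of_ne_zero (mul_ne_zero hc0 hu), Complex.cpow_def_of_ne_zero hc0,
    Complex.cpow_def_of_ne_zero hu, Complex.log_ofReal_mul hc hu, ← Complex.exp_add,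
    Complex.ofReal_log hc.le]
  ring_nf

theorem re_cpow_half_pos {z : ℂ} (hz : z ∈ Complex.slitPlane) : 0 < (z ^ (1 / 2 : ℂ)).re := by
  rw [Complex.cpow_def_of_ne_zero (Complex.slitPlane_ne_zero hz), Complex.exp_re]
  refine mul_pos (Real.exp_pos _) (Real.cos_pos_of_mem_Ioo ?_)
  have him : (Complex.log z * (1 / 2)).im = z.arg / 2 := by
    rw [show (1 / 2 : ℂ) = ((1 / 2 : ℝ) : ℂ) by norm_num, Complex.im_mul_ofReal,
      Complex.log_im]
    ring
  rw [him]
  have h2 := Complex.neg_pi_lt_arg z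
  have h3 := lt_of_le_of_ne (Complex.arg_le_pi z) (Complex.mem_slitPlane_iff_arg.1 hz).1
  constructor <;> linarith

theorem cpow_half_mul_self {z : ℂ} : z ^ (1 / 2 : ℂ) * z ^ (1 / 2 : ℂ) = z := by
  rcases eq_or_ne z 0 with rfl | hz
  · simp
  rw [← Complex.cpow_add _ _ hz]; norm_num

theorem cpow_half_cpow {z : ℂ} (γ : ℂ) : (z ^ (1 / 2 : ℂ)) ^ γ = z ^ (γ / 2) := by
  rcases eq_or_ne z 0 with rfl | hz
  · rcases eq_or_ne γ 0 with rfl | hγ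
    · simp
    · simp [hγ]
  have h1 := Complex.neg_pi_lt_arg z
  have h2 := Complex.arg_le_pi z
  have him : (Complex.log z * (1 / 2)).im = z.arg / 2 := by
    rw [show (1 / 2 : ℂ) = ((1 / 2 : ℝ) : ℂ) by norm_num, Complex.im_mul_ofReal,
      Complex.log_im]
    ring
  rw [← Complex.cpow_mul]
  · congr 1; ring
  · rw [him]; linarith [Real.pi_pos]
  · rw [him]; linarith [Real.pi_pos]

theorem sqrt_pi_ne_zero : ((Real.sqrt Real.pi : ℝ) : ℂ) ≠ 0 := by
  exact_mod_cast (Real.sqrt_pos.2 Real.pi_pos).ne'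

/-- Two arguments in (-π/2, π/2) add up to one in (-π, π). Hence the principal branch of U_α is the
one met by every convergent Laplace integral. -/
theorem mul_mem_slitPlane_of_re_pos {A B : ℂ} (hA : 0 < A.re) (hB : 0 < B.re) :
    A * B ∈ Complex.slitPlane := by
  rw [Complex.mem_slitPlane_iff]
  by_contra! h
  obtain ⟨h1, h2⟩ := h
  rw [Complex.mul_re] at h1
  rw [Complex.mul_im] at h2
  -- Multiplying Re(AB) ≤ 0 by Re A and Im(AB) = 0 by Im A and adding eliminates Im B; what remains
  -- says |A|² Re B ≤ 0.
  have h3 : A.re * (A.re * B.re) + A.im ^ 2 * B.re ≤ 0 := by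
    have : A.re * (A.re * B.re - A.im * B.im) ≤ 0 := mul_nonpos_of_nonneg_of_nonpos hA.le h1
    have h' : A.im * (A.re * B.im + A.im * B.re) = 0 := by rw [h2, mul_zero]
    linarith
  have h4 : 0 < A.re * (A.re * B.re) := by positivity
  have h5 : 0 ≤ A.im ^ 2 * B.re := by positivity
  linarith

/-- Rotation of the path of integration in the definition of `U_α`. -/
theorem laplaceIntegral_eq_besselU (α : ℂ) {A B : ℂ} (hA : 0 < A.re) (hB : 0 < B.re) :
    laplaceIntegral (-α - 1) A B = (Real.sqrt Real.pi : ℝ) * A ^ α * besselU α (A * B) := by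
  have hA0 : A ≠ 0 := by rintro rfl; simp at hA
  set z := A * B with hz
  have hzs : z ∈ Complex.slitPlane := mul_mem_slitPlane_of_re_pos hA hB
  have hz0 : z ≠ 0 := Complex.slitPlane_ne_zero hzs
  -- S is where both u and z/u have positive real part: an intersection of two open half-planes,
  -- hence convex. It contains both u = A and u = √z, and the function G below is shown to be
  -- constant on it.
  set S : Set ℂ := {u | 0 < u.re ∧ 0 < u.re * z.re + u.im * z.im} with hS
  have hSre : ∀ u ∈ S, 0 < u.re ∧ 0 < (z / u).re := by
    rintro u ⟨h1, h2⟩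
    refine ⟨h1, ?_⟩
    have hn : 0 < Complex.normSq u := Complex.normSq_pos.2 (by rintro rfl; simp at h1)
    rw [Complex.div_re, ← add_div]
    apply div_pos _ hn
    linarith
  have hreS : ∀ u : ℂ, 0 < u.re → 0 < (z / u).re → u ∈ S := by
    intro u h1 h2
    have hn : 0 < Complex.normSq u := Complex.normSq_pos.2 (by rintro rfl; simp at h1)
    rw [Complex.div_re, ← add_div, div_pos_iff_of_pos_right hn] at h2
    exact ⟨h1, by linarith⟩
  have hopen : IsOpen S := by
    have h1 : IsOpen {u : ℂ | 0 < u.re} := isOpen_lt continuous_const Complex.continuous_re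
    have h2 : IsOpen {u : ℂ | 0 < u.re * z.re + u.im * z.im} :=
      isOpen_lt continuous_const (by fun_prop)
    exact h1.inter h2
  have hconv : Convex ℝ S := by
    intro u hu v hv s t hs ht hst
    obtain ⟨h1, h2⟩ := hu
    obtain ⟨h3, h4⟩ := hv
    rcases hs.eq_or_lt with rfl | hs'
    · obtain rfl : t = 1 := by linarith
      simpa using ⟨h3, h4⟩
    · simp only [hS, Set.mem_ofPred_eq, Complex.add_re, Complex.add_im, Complex.real_smul,
        Complex.re_ofReal_mul, Complex.im_ofReal_mul]
      constructor <;> nlinarith [mul_pos hs' h1, mul_pos hs' h2, mul_nonneg ht h3.le,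
        mul_nonneg ht h4.le]
  set G : ℂ → ℂ := fun u => u ^ (-α) * laplaceIntegral (-α - 1) u (z / u) with hG
  have hdiff : DifferentiableOn ℂ G S := by
    intro u hu
    obtain ⟨h1, h2⟩ := hSre u hu
    have hu0 : u ≠ 0 := by rintro rfl; simp at h1
    refine DifferentiableAt.differentiableWithinAt ?_
    refine DifferentiableAt.mul
      (differentiableAt_id.cpow_const (Or.inl h1)) ?_
    refine (hasDerivAt_laplaceIntegral (-α - 1) (A := fun u => u) (B := fun u => z / u)
      (A' := fun _ => 1) (B' := fun u => -z / u ^ 2) (w₀ := u) ?_ ?_ ?_ ?_ h1 h2).differentiableAt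
    · exact Eventually.of_forall fun w => hasDerivAt_id w
    · filter_upwards [isOpen_ne.mem_nhds hu0] with w hw
      have := (hasDerivAt_const w z).div (hasDerivAt_id w) hw
      exact this.congr_deriv (by simp)
    · exact continuousAt_const
    · exact continuousAt_const.div (continuousAt_id.pow 2) (by simpa using hu0)
  have hhom : ∀ u ∈ S, ∀ c : ℝ, 0 < c → G (c * u) = G u := by
    intro u hu c hc
    have hc0 : (c : ℂ) ≠ 0 := by exact_mod_cast hc.ne'
    have h1 : u ≠ 0 := by rintro rfl; exact absurd (hSre 0 hu).1 (by simp)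
    simp only [hG]
    rw [show z / (c * u) = z / u / c by field_simp, laplaceIntegral_scale _ _ _ hc,
      ofReal_mul_cpow hc h1]
    rw [show -(-α - 1) - 1 = α by ring, Complex.cpow_neg (c : ℂ)]
    have hcb : (c : ℂ) ^ α ≠ 0 := by simp [Complex.cpow_eq_zero_iff, hc0]
    field_simp
  -- Euler's relation: a holomorphic function that is positively homogeneous of degree zero
  -- satisfies u G'(u) = 0.
  have hder : Set.EqOn (deriv G) 0 S := by
    intro u hu
    have hu0 : u ≠ 0 := by rintro rfl; exact absurd (hSre 0 hu).1 (by simp)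
    have hGu : HasDerivAt G (deriv G u) u := (hdiff.differentiableAt (hopen.mem_nhds hu)).hasDerivAt
    have h1 : HasDerivAt (fun c : ℝ => (c : ℂ) * u) u 1 := by
      simpa using (Complex.ofRealCLM.hasDerivAt (x := (1 : ℝ))).mul_const u
    have h2 : HasDerivAt (fun c : ℝ => G (c * u)) (deriv G u * u) 1 :=
      HasDerivAt.comp (h₂ := G) 1 (by simpa using hGu) h1
    have h3 : HasDerivAt (fun c : ℝ => G (c * u)) 0 1 := by
      refine (hasDerivAt_const (1 : ℝ) (G u)).congr_of_eventuallyEq ?_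
      filter_upwards [lt_mem_nhds (zero_lt_one' ℝ)] with c hc
      exact hhom u hu c hc
    have := h2.unique h3
    simpa [hu0] using this
  set r := z ^ (1 / 2 : ℂ) with hr
  have hr0 : 0 < r.re := re_cpow_half_pos hzs
  have hrr : r * r = z := cpow_half_mul_self
  have hrne : r ≠ 0 := by rintro h; simp [h] at hr0
  have hzr : z / r = r := by rw [← hrr]; field_simp
  have heq : G A = G r := hopen.is_const_of_deriv_eq_zero hconv.isPreconnected hdiff hder
    (hreS A hA (by rw [hz, mul_div_cancel_left₀ _ hA0]; exact hB)) (hreS r hr0 (by rw [hzr]; exact hr0))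
  have hAa : A ^ α ≠ 0 := by simp [Complex.cpow_eq_zero_iff, hA0]
  have hGr : G r = (Real.sqrt Real.pi : ℝ) * besselU α z := by
    simp only [hG]
    rw [hzr, besselU, ← hr, cpow_half_cpow, laplaceIntegral, mul_assoc,
      mul_inv_cancel_left₀ sqrt_pi_ne_zero]
    congr 1
    refine integral_congr_ae (Eventually.of_forall fun s => ?_)
    simp only
    congr 2
    rw [div_eq_mul_inv]; ring
  rw [hGr] at heq
  simp only [hG] at heq
  rw [hz, mul_div_cancel_left₀ _ hA0, Complex.cpow_neg] at heq
  rw [← hz] at heq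
  rw [mul_right_comm, ← heq]
  field_simp

/-- Keep A equal to the fixed number √z and move only B = w/A. The derivative then brings down 1/τ,
which raises the order by one. -/
theorem hasDerivAt_besselU (α : ℂ) {z : ℂ} (hz : z ∈ Complex.slitPlane) :
    HasDerivAt (besselU α) (-besselU (α + 1) z) z := by
  set r := z ^ (1 / 2 : ℂ) with hr
  have hr0 : 0 < r.re := re_cpow_half_pos hz
  have hrr : r * r = z := cpow_half_mul_self
  have hrne : r ≠ 0 := by rintro h; simp [h] at hr0
  have hzr : z / r = r := by rw [← hrr]; field_simp
  have h1 := hasDerivAt_laplaceIntegral (-α - 1) (A := fun _ => r) (B := fun w => w / r)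
    (A' := fun _ => 0) (B' := fun _ => 1 / r) (w₀ := z)
    (Eventually.of_forall fun w => hasDerivAt_const w r)
    (Eventually.of_forall fun w => (hasDerivAt_id w).div_const r)
    continuousAt_const continuousAt_const hr0 (by rw [hzr]; exact hr0)
  have hra : r ^ α ≠ 0 := by simp [Complex.cpow_eq_zero_iff, hrne]
  have h2 := h1.const_mul (((Real.sqrt Real.pi : ℝ) : ℂ)⁻¹ * (r ^ α)⁻¹)
  refine (h2.congr_of_eventuallyEq ?_).congr_deriv ?_
  · have : ContinuousAt (fun w : ℂ => (w / r).re) z := by fun_prop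
    filter_upwards [this.eventually_const_lt (show 0 < (z / r).re by rw [hzr]; exact hr0)] with w hw
    rw [laplaceIntegral_eq_besselU α hr0 hw, mul_div_cancel₀ _ hrne]
    have := sqrt_pi_ne_zero
    field_simp
  · rw [show -α - 1 - 1 = -(α + 1) - 1 by ring,
      laplaceIntegral_eq_besselU (α + 1) hr0 (by rw [hzr]; exact hr0), mul_div_cancel₀ _ hrne,
      Complex.cpow_add _ _ hrne, Complex.cpow_one]
    have := sqrt_pi_ne_zero
    field_simp
    ring

/-! ### Growth of `U_α` and half-integer values -/

theorem norm_mul_self_cpow_half (z : ℂ) : ‖z ^ (1 / 2 : ℂ)‖ ^ 2 = ‖z‖ := by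
  rw [← norm_pow, sq, cpow_half_mul_self]

/-- With r = √z one has Im z = 2 Re r Im r. The inequality bounds Re √z from below near the cut, and
Re √z governs the decay of the integral defining U_α. -/
theorem abs_im_le_re_cpow_half_mul_norm {z : ℂ} (hz : z ∈ Complex.slitPlane) :
    |z.im| ≤ 2 * (z ^ (1 / 2 : ℂ)).re * ‖z ^ (1 / 2 : ℂ)‖ := by
  have h0 := re_cpow_half_pos hz
  set r := z ^ (1 / 2 : ℂ) with hr
  have h1 : z.im = 2 * r.re * r.im := by
    have : r * r = z := cpow_half_mul_self
    rw [← this, Complex.mul_im]; ring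
  rw [h1, abs_mul, abs_of_pos (by positivity)]
  gcongr
  exact Complex.abs_im_le_norm r

theorem integrableOn_add_inv_pow_inv_mul_rpow (r : ℝ) {N : ℕ} (hN : |r| + 1 < N) :
    IntegrableOn (fun s : ℝ => ((s + s⁻¹) ^ N)⁻¹ * s ^ r) (Set.Ioi 0) := by
  have hr := abs_lt.1 (show |r| < N - 1 by linarith)
  have hmeas : AEStronglyMeasurable (fun s : ℝ => ((s + s⁻¹) ^ N)⁻¹ * s ^ r)
      (volume.restrict (Set.Ioi 0)) := by
    refine ContinuousOn.aestronglyMeasurable ?_ measurableSet_Ioi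
    intro s hs
    have hs' : s ≠ 0 := ne_of_gt hs
    have hs0 : 0 < s := hs
    refine ContinuousAt.continuousWithinAt ?_
    refine ContinuousAt.mul ?_ (Real.continuousAt_rpow_const _ _ (Or.inl hs'))
    refine ContinuousAt.inv₀ (by fun_prop (disch := assumption)) (by positivity)
  rw [← Set.Ioc_union_Ioi_eq_Ioi (zero_le_one (α := ℝ))]
  refine IntegrableOn.union ?_ ?_
  · have h1 : IntegrableOn (fun s : ℝ => s ^ (N + r)) (Set.Ioc 0 1) :=
      (intervalIntegral.intervalIntegrable_rpow' (by linarith)).1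
    refine Integrable.mono' h1 (hmeas.mono_measure (Measure.restrict_mono
      Set.Ioc_subset_Ioi_self le_rfl)) ?_
    filter_upwards [ae_restrict_mem measurableSet_Ioc] with s hs
    have hs0 : 0 < s := hs.1
    rw [Real.norm_of_nonneg (by positivity), Real.rpow_add hs0, Real.rpow_natCast]
    gcongr
    rw [← inv_pow]
    gcongr
    rw [inv_le_comm₀ (by positivity) hs0]
    linarith
  · have h1 : IntegrableOn (fun s : ℝ => s ^ (-(N : ℝ) + r)) (Set.Ioi 1) :=
      integrableOn_Ioi_rpow_of_lt (by linarith) one_pos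
    refine Integrable.mono' h1 (hmeas.mono_measure (Measure.restrict_mono
      (Set.Ioi_subset_Ioi zero_le_one) le_rfl)) ?_
    filter_upwards [ae_restrict_mem measurableSet_Ioi] with s hs
    have hs0 : 0 < s := lt_trans one_pos hs
    rw [Real.norm_of_nonneg (by positivity), Real.rpow_add hs0, Real.rpow_neg hs0.le,
      Real.rpow_natCast]
    gcongr
    have : 0 < s⁻¹ := by positivity
    linarith

/-- Near the cut and at infinity, `U_α` has at most polynomial growth in `|z|` and `1 / |Im z|`. -/
theorem exists_norm_besselU_le (α : ℝ) : ∃ N : ℕ, ∃ C : ℝ, 0 ≤ C ∧ ∀ z : ℂ, z.im ≠ 0 →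
    ‖besselU α z‖ ≤ C * (1 + ‖z‖) ^ N / |z.im| ^ N := by
  -- This N serves two purposes: the integral I below converges, and |α| < N, so that N - α lies in
  -- (0, 2N).
  obtain ⟨N, hN⟩ := exists_nat_gt (|(-α - 1)| + 1)
  have hNα : |α| < N := by
    have := abs_add_le (-α - 1) 1
    have h2 : |(-α - 1) + 1| = |α| := by rw [show (-α - 1) + 1 = -α by ring, abs_neg]
    rw [h2, abs_one] at this
    linarith
  set I := ∫ s in Set.Ioi (0 : ℝ), ((s + s⁻¹) ^ N)⁻¹ * s ^ (-α - 1) with hI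
  have hI0 : 0 ≤ I := setIntegral_nonneg measurableSet_Ioi fun s hs => by
    have : (0 : ℝ) < s := hs
    positivity
  refine ⟨N, (Real.sqrt Real.pi)⁻¹ * (N.factorial * I) * 2 ^ N, by positivity, fun z hz => ?_⟩
  have hzs : z ∈ Complex.slitPlane := Or.inr hz
  have hz0 : z ≠ 0 := Complex.slitPlane_ne_zero hzs
  set r := z ^ (1 / 2 : ℂ) with hr
  have hr0 : 0 < r.re := re_cpow_half_pos hzs
  have hrn : 0 < ‖r‖ := norm_pos_iff.2 (by rintro h; simp [h] at hr0)
  have h1 : ‖z ^ (-(α : ℂ) / 2)‖ = ‖r‖ ^ (-α) := by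
    rw [show (-(α : ℂ) / 2) = ((-α / 2 : ℝ) : ℂ) by push_cast; rfl, Complex.norm_cpow_real,
      ← norm_mul_self_cpow_half, ← hr, ← Real.rpow_natCast, ← Real.rpow_mul hrn.le]
    congr 1
    push_cast; ring
  have h2 : ‖∫ s in Set.Ioi (0 : ℝ), Complex.exp (-r * ((s : ℂ) + (s : ℂ)⁻¹)) *
      (s : ℂ) ^ (-(α : ℂ) - 1)‖ ≤ N.factorial * I / r.re ^ N := by
    rw [mul_div_right_comm, hI, ← integral_const_mul]
    refine norm_integral_le_of_norm_le
      ((integrableOn_add_inv_pow_inv_mul_rpow _ hN).const_mul _) ?_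
    filter_upwards [ae_restrict_mem measurableSet_Ioi] with s hs
    have hs0 : 0 < s := hs
    rw [norm_mul, Complex.norm_exp, Complex.norm_cpow_eq_rpow_re_of_pos hs0,
      show (s : ℂ) + (s : ℂ)⁻¹ = ((s + s⁻¹ : ℝ) : ℂ) by push_cast; rfl, Complex.re_mul_ofReal]
    have e1 : (-(α : ℂ) - 1).re = -α - 1 := by simp
    rw [e1, ← mul_assoc]
    gcongr
    have h3 := Real.pow_div_factorial_le_exp (r.re * (s + s⁻¹)) (by positivity) N
    rw [Complex.neg_re, neg_mul, Real.exp_neg, inv_le_comm₀ (Real.exp_pos _) (by positivity)]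
    refine le_trans (le_of_eq ?_) h3
    rw [mul_pow]
    field_simp
  rw [besselU, ← hr, norm_mul, norm_mul, h1, norm_inv, Complex.norm_real,
    Real.norm_of_nonneg (Real.sqrt_nonneg _)]
  have h3 : |z.im| ≤ 2 * r.re * ‖r‖ := abs_im_le_re_cpow_half_mul_norm hzs
  have hz' : 0 < |z.im| := abs_pos.2 hz
  have h4 : (r.re ^ N)⁻¹ ≤ 2 ^ N * ‖r‖ ^ N / |z.im| ^ N := by
    rw [← mul_pow, ← div_pow, ← inv_pow]
    gcongr
    rw [inv_le_comm₀ hr0 (by positivity), inv_div, div_le_iff₀ (by positivity)]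
    linarith
  -- Since 0 < N - α < 2N, the power of |r| is at most 1 when |r| ≤ 1 and at most (|r|²)^N = |z|^N
  -- otherwise.
  have h5 : ‖r‖ ^ (-α) * ‖r‖ ^ N ≤ (1 + ‖z‖) ^ N := by
    rw [← norm_mul_self_cpow_half z, ← hr, ← Real.rpow_natCast ‖r‖ N, ← Real.rpow_add hrn]
    have hα := abs_lt.1 hNα
    rcases le_total ‖r‖ 1 with h | h
    · refine (Real.rpow_le_one hrn.le h (by linarith)).trans ?_
      exact one_le_pow₀ (by nlinarith)
    · calc ‖r‖ ^ (-α + N) ≤ ‖r‖ ^ ((2 * N : ℕ) : ℝ) :=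
            Real.rpow_le_rpow_of_exponent_le h (by push_cast; linarith)
        _ = (‖r‖ ^ 2) ^ N := by rw [Real.rpow_natCast, pow_mul]
        _ ≤ _ := by gcongr; linarith
  calc _ ≤ (Real.sqrt Real.pi)⁻¹ * ‖r‖ ^ (-α) *
        (N.factorial * I * (2 ^ N * ‖r‖ ^ N / |z.im| ^ N)) := by
        gcongr
        refine h2.trans ?_
        rw [div_eq_mul_inv]
        gcongr
    _ = (Real.sqrt Real.pi)⁻¹ * (N.factorial * I) * 2 ^ N * (‖r‖ ^ (-α) * ‖r‖ ^ N) /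
        |z.im| ^ N := by ring
    _ ≤ _ := by gcongr

theorem isPreconnected_slitPlane : IsPreconnected Complex.slitPlane :=
  (Complex.starConvex_one_slitPlane.isPathConnected Complex.one_mem_slitPlane
    ).isConnected.isPreconnected

/-- The factor s + 1/s is invariant under s ↦ 1/s, which exchanges s^{-α-1} ds with s^{α-1} ds; the
powers of z in front account for the factor z^α. -/
theorem besselU_neg (α : ℂ) {z : ℂ} (hz : z ≠ 0) : besselU (-α) z = z ^ α * besselU α z := by
  have key := integral_comp_rpow_Ioi
    (fun s : ℝ => Complex.exp (-(z ^ (1 / 2 : ℂ)) * ((s : ℂ) + (s : ℂ)⁻¹)) * (s : ℂ) ^ (-α - 1))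
    (p := -1) (by norm_num)
  have h1 : (∫ s in Set.Ioi (0 : ℝ),
      Complex.exp (-(z ^ (1 / 2 : ℂ)) * ((s : ℂ) + (s : ℂ)⁻¹)) * (s : ℂ) ^ (-(-α) - 1)) =
      ∫ s in Set.Ioi (0 : ℝ),
      Complex.exp (-(z ^ (1 / 2 : ℂ)) * ((s : ℂ) + (s : ℂ)⁻¹)) * (s : ℂ) ^ (-α - 1) := by
    rw [← key]
    refine setIntegral_congr_fun measurableSet_Ioi fun s hs => ?_
    have hs' : (0 : ℝ) < s := hs
    have hs0 : (s : ℂ) ≠ 0 := by exact_mod_cast hs'.ne'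
    have e1 : s ^ (-1 - 1 : ℝ) = (s ^ 2)⁻¹ := by
      rw [show (-1 - 1 : ℝ) = -((2 : ℕ) : ℝ) by norm_num, Real.rpow_neg hs'.le, Real.rpow_natCast]
    simp only [abs_neg, abs_one, one_mul, Real.rpow_neg_one, e1, Complex.real_smul,
      Complex.ofReal_inv, inv_inv, Complex.ofReal_pow]
    rw [← Complex.ofReal_inv, Complex.ofReal_inv, Complex.inv_cpow _ _
      (by rw [Complex.arg_ofReal_of_nonneg hs'.le]; exact Real.pi_pos.ne), Complex.cpow_sub _ _ hs0,
      Complex.cpow_sub _ _ hs0, Complex.cpow_neg (s : ℂ) α, neg_neg, Complex.cpow_one]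
    have : (s : ℂ) ^ α ≠ 0 := by simp [Complex.cpow_eq_zero_iff, hs0]
    rw [add_comm (s : ℂ)]
    field_simp
  rw [besselU, besselU, h1]
  have : z ^ (-(-α) / 2) = z ^ α * z ^ (-α / 2) := by
    rw [← Complex.cpow_add _ _ hz]; congr 1; ring
  rw [this]
  ring

/-- `U_{-1/2}(z) = exp(-2 √z)`. -/
theorem besselU_neg_half {z : ℂ} (hz : z ∈ Complex.slitPlane) :
    besselU (-(1 / 2)) z = Complex.exp (-2 * z ^ (1 / 2 : ℂ)) := by
  -- The derivative of U_{-1/2} is -U_{1/2}, and U_{-1/2} = √z U_{1/2} by reflection. So U_{-1/2}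
  -- solves a first-order equation and f is constant; the constant is read off as z decreases to 0,
  -- where the integral becomes Γ(1/2) = √π.
  set f : ℂ → ℂ := fun z => besselU (-(1 / 2)) z * Complex.exp (2 * z ^ (1 / 2 : ℂ)) with hf
  have hder : ∀ z ∈ Complex.slitPlane, HasDerivAt f 0 z := by
    intro z hz
    have hz0 := Complex.slitPlane_ne_zero hz
    have h1 := hasDerivAt_besselU (-(1 / 2)) hz
    have h2 : HasDerivAt (fun z : ℂ => z ^ (1 / 2 : ℂ)) ((1 / 2 : ℂ) * z ^ ((1 / 2 : ℂ) - 1)) z := by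
      simpa using (hasDerivAt_id z).cpow_const (c := (1 / 2 : ℂ)) hz
    refine (h1.mul (h2.const_mul 2).cexp).congr_deriv ?_
    rw [show (-(1 / 2) + 1 : ℂ) = 1 / 2 by norm_num, besselU_neg _ hz0,
      Complex.cpow_sub _ _ hz0, Complex.cpow_one]
    have h3 : z ^ (1 / 2 : ℂ) * z ^ (1 / 2 : ℂ) = z := cpow_half_mul_self
    have h4 : z ^ (1 / 2 : ℂ) / z * z ^ (1 / 2 : ℂ) = 1 := by
      rw [div_mul_eq_mul_div, h3, div_self hz0]
    linear_combination (Complex.exp (2 * z ^ (1 / 2 : ℂ)) * besselU (1 / 2) z) * h4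
  have hpre : IsPreconnected Complex.slitPlane := isPreconnected_slitPlane
  have hconst : ∀ x : ℝ, 0 < x → f x = f z := fun x hx =>
    Complex.isOpen_slitPlane.is_const_of_deriv_eq_zero hpre
      (fun w hw => (hder w hw).differentiableAt.differentiableWithinAt)
      (fun w hw => (hder w hw).deriv) (Complex.ofReal_mem_slitPlane.2 hx) hz
  have hlim1 : Tendsto (fun x : ℝ => ∫ t in Set.Ioi (0 : ℝ),
      Complex.exp (-(t : ℂ) - (x : ℂ) / t) * (t : ℂ) ^ (-(-(1 / 2) : ℂ) - 1)) (𝓝[>] 0)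
      (𝓝 (∫ t in Set.Ioi (0 : ℝ), Complex.exp (-(t : ℂ)) * (t : ℂ) ^ (-(-(1 / 2) : ℂ) - 1))) := by
    refine tendsto_integral_filter_of_dominated_convergence
      (fun t => Real.exp (-t) * t ^ ((1 / 2 : ℝ) - 1)) ?_ ?_
      (Real.GammaIntegral_convergent (by norm_num)) ?_
    · refine Eventually.of_forall fun x => ?_
      have := (continuousOn_laplace_integrand (-(-(1 / 2) : ℂ) - 1) 1 x).aestronglyMeasurable
        (μ := volume) measurableSet_Ioi
      simpa using this
    · filter_upwards [self_mem_nhdsWithin] with x hx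
      filter_upwards [ae_restrict_mem measurableSet_Ioi] with t ht
      have ht0 : 0 < t := ht
      have hx0 : 0 < x := hx
      have := norm_laplace_integrand (-(-(1 / 2) : ℂ) - 1) 1 x ht0
      rw [one_mul] at this
      rw [this]
      have e : (-(-(1 / 2) : ℂ) - 1).re = (1 / 2 : ℝ) - 1 := by norm_num
      rw [e]
      gcongr
      have : 0 < x / t := by positivity
      simp; linarith
    · refine Eventually.of_forall fun t => ?_
      have h : ContinuousAt (fun x : ℝ =>
          Complex.exp (-(t : ℂ) - (x : ℂ) / t) * (t : ℂ) ^ (-(-(1 / 2) : ℂ) - 1)) 0 := by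
        fun_prop
      have := h.tendsto.mono_left (nhdsWithin_le_nhds (s := Set.Ioi 0))
      simpa using this
  have hΓ : (∫ t in Set.Ioi (0 : ℝ), Complex.exp (-(t : ℂ)) * (t : ℂ) ^ (-(-(1 / 2) : ℂ) - 1)) =
      (Real.sqrt Real.pi : ℝ) := by
    have h1 := Complex.Gamma_eq_integral (s := 1 / 2) (by norm_num)
    rw [Complex.Gamma_one_half_eq, Complex.GammaIntegral] at h1
    rw [Real.sqrt_eq_rpow, Complex.ofReal_cpow Real.pi_pos.le]
    push_cast
    rw [h1]
    refine integral_congr_ae (Eventually.of_forall fun t => ?_)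
    simp
  have hlim2 : Tendsto (fun x : ℝ => f x) (𝓝[>] 0) (𝓝 1) := by
    have h1 : Tendsto (fun x : ℝ => ((Real.sqrt Real.pi : ℝ) : ℂ)⁻¹ * (∫ t in Set.Ioi (0 : ℝ),
      Complex.exp (-(t : ℂ) - (x : ℂ) / t) * (t : ℂ) ^ (-(-(1 / 2) : ℂ) - 1)) *
      Complex.exp (2 * (x : ℂ) ^ (1 / 2 : ℂ))) (𝓝[>] 0) (𝓝 1) := by
      have h2 : Tendsto (fun x : ℝ => Complex.exp (2 * (x : ℂ) ^ (1 / 2 : ℂ))) (𝓝[>] 0) (𝓝 1) := by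
        have h3 : ContinuousAt (fun x : ℝ => Complex.exp (2 * (x : ℂ) ^ (1 / 2 : ℂ))) 0 :=
          ((Complex.continuousAt_ofReal_cpow_const 0 (1 / 2 : ℂ)
            (Or.inl (by norm_num))).const_mul 2).cexp
        have := h3.tendsto.mono_left (nhdsWithin_le_nhds (s := Set.Ioi 0))
        simpa using this
      have h4 := (hlim1.const_mul (((Real.sqrt Real.pi : ℝ) : ℂ)⁻¹)).mul h2
      rwa [hΓ, inv_mul_cancel₀ sqrt_pi_ne_zero, mul_one] at h4
    refine h1.congr' ?_
    filter_upwards [self_mem_nhdsWithin] with x hx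
    rw [hf]
    simp only
    rw [besselU_ofReal _ hx]
  have hfz : f z = 1 := by
    refine tendsto_nhds_unique (Tendsto.congr' ?_ tendsto_const_nhds) hlim2
    filter_upwards [self_mem_nhdsWithin] with x hx
    exact (hconst x hx).symm
  rw [neg_mul, Complex.exp_neg]
  exact eq_inv_of_mul_eq_one_left hfz

/-- A Gaussian-type integral: `∫₀^∞ exp(-Aτ - B/τ) τ^(-1/2) dτ = √π A^(-1/2) exp(-2 √(AB))`. -/
theorem laplaceIntegral_neg_half {A B : ℂ} (hA : 0 < A.re) (hB : 0 < B.re) :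
    laplaceIntegral (-(1 / 2)) A B = (Real.sqrt Real.pi : ℝ) * A ^ (-(1 / 2) : ℂ) *
      Complex.exp (-2 * (A * B) ^ (1 / 2 : ℂ)) := by
  rw [← besselU_neg_half (mul_mem_slitPlane_of_re_pos hA hB), ← laplaceIntegral_eq_besselU _ hA hB]
  norm_num

/-! ### The functions `𝐅_α`; the connection formula at half-integer order -/

theorem summable_norm_boldF (α z : ℂ) :
    Summable fun j : ℕ => ‖z ^ j / (Complex.Gamma (α + 1 + j) * (j.factorial : ℂ))‖ := by
  have hr : (Complex.regularizedHGFunSeries 0 {α + 1}).radius = ⊤ :=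
    Complex.radius_regularizedHGFunSeries_eq_top (by simp)
  have h := (Complex.regularizedHGFunSeries 0 {α + 1}).summable_norm_apply
    (x := z) (by rw [hr]; simp)
  refine h.congr fun j => ?_
  congr 1
  simp [Complex.regularizedHGFunCoeff, Complex.regularizedHGFunSeries]
  ring

theorem hasSum_boldF (α z : ℂ) :
    HasSum (fun j : ℕ => z ^ j / (Complex.Gamma (α + 1 + j) * (j.factorial : ℂ))) (boldF α z) := by
  rw [boldF_eq_tsum]
  exact (summable_norm_boldF α z).of_norm.hasSum

theorem hasDerivAt_boldF (α z : ℂ) : HasDerivAt (boldF α) (boldF (α + 1) z) z := by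
  set R := ‖z‖ + 1
  have hR : 0 < R := by positivity
  have hterm : ∀ (j : ℕ) (w : ℂ),
      ((j + 1 : ℕ) : ℂ) * w ^ j / (Complex.Gamma (α + 1 + (j + 1 : ℕ)) * ((j + 1).factorial : ℂ)) =
      w ^ j / (Complex.Gamma (α + 1 + 1 + j) * (j.factorial : ℂ)) := by
    intro j w
    have h1 : ((j + 1 : ℕ) : ℂ) ≠ 0 := by exact_mod_cast Nat.succ_ne_zero j
    rw [Nat.factorial_succ, show α + 1 + ((j + 1 : ℕ) : ℂ) = α + 1 + 1 + j by push_cast; ring]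
    rw [Nat.cast_mul, mul_left_comm, mul_div_mul_left _ _ h1]
  have h := hasDerivAt_tsum_of_isPreconnected (𝕜 := ℂ)
    (g := fun (j : ℕ) (w : ℂ) => w ^ j / (Complex.Gamma (α + 1 + j) * (j.factorial : ℂ)))
    (g' := fun (j : ℕ) (w : ℂ) => j * w ^ (j - 1) / (Complex.Gamma (α + 1 + j) * (j.factorial : ℂ)))
    (u := fun j : ℕ => ‖(j : ℂ) * (R : ℂ) ^ (j - 1) /
      (Complex.Gamma (α + 1 + j) * (j.factorial : ℂ))‖)
    (t := Metric.ball 0 R) (y₀ := z) (y := z) ?_ Metric.isOpen_ball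
    (convex_ball _ _).isPreconnected ?_ ?_ (by simp [R]) (summable_norm_boldF α z).of_norm
    (by simp [R])
  · have e : boldF α = fun w => ∑' j : ℕ, w ^ j / (Complex.Gamma (α + 1 + j) * (j.factorial : ℂ)) :=
      funext fun w => boldF_eq_tsum α w
    rw [e]
    refine h.congr_deriv ?_
    have h2 : HasSum (fun j : ℕ => (j : ℂ) * z ^ (j - 1) /
        (Complex.Gamma (α + 1 + j) * (j.factorial : ℂ))) (boldF (α + 1) z + ∑ i ∈ Finset.range 1,
        (i : ℂ) * z ^ (i - 1) / (Complex.Gamma (α + 1 + i) * (i.factorial : ℂ))) := by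
      rw [← hasSum_nat_add_iff]
      refine (hasSum_boldF (α + 1) z).congr_fun fun j => ?_
      rw [Nat.add_sub_cancel, hterm]
    simpa using h2.tsum_eq
  · refine (summable_nat_add_iff 1).1 ?_
    refine (summable_norm_boldF (α + 1) R).congr fun j => ?_
    rw [Nat.add_sub_cancel, hterm]
  · intro j w _
    exact (hasDerivAt_pow j w).div_const _
  · intro j w hw
    have hw' : ‖w‖ < R := by simpa using hw
    rw [norm_div, norm_div, norm_mul, norm_mul (j : ℂ) ((R : ℂ) ^ (j - 1)), norm_pow, norm_pow,
      Complex.norm_real,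
      Real.norm_of_nonneg hR.le]
    gcongr

/-- Coefficientwise this is (β + j)/Γ(β + j + 1) = 1/Γ(β + j). It holds for every β because 1/Γ is
entire. -/
theorem mul_boldF_add_mul_boldF (β z : ℂ) :
    z * boldF (β + 1) z + β * boldF β z = boldF (β - 1) z := by
  have h1 := (hasSum_boldF β z).mul_left β
  have h2 : HasSum (fun j : ℕ => (j : ℂ) * (z ^ j / (Complex.Gamma (β + 1 + j) *
      (j.factorial : ℂ)))) (z * boldF (β + 1) z + ∑ i ∈ Finset.range 1,
      (i : ℂ) * (z ^ i / (Complex.Gamma (β + 1 + i) * (i.factorial : ℂ)))) := by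
    rw [← hasSum_nat_add_iff]
    refine ((hasSum_boldF (β + 1) z).mul_left z).congr_fun fun j => ?_
    have h1 : ((j + 1 : ℕ) : ℂ) ≠ 0 := by exact_mod_cast Nat.succ_ne_zero j
    rw [Nat.factorial_succ, show β + 1 + ((j + 1 : ℕ) : ℂ) = β + 1 + 1 + j by push_cast; ring,
      Nat.cast_mul, mul_left_comm (Complex.Gamma _), ← mul_div_assoc, mul_div_mul_left _ _ h1,
      pow_succ]
    ring
  have h3 := h2.add h1
  simp only [Finset.range_one, Finset.sum_singleton, Nat.cast_zero, zero_mul, add_zero] at h3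
  refine h3.unique ((hasSum_boldF (β - 1) z).congr_fun fun j => ?_)
  have h4 := Complex.one_div_Gamma_eq_self_mul_one_div_Gamma_add_one (β + j)
  rw [show β - 1 + 1 + (j : ℂ) = β + j by ring, ← add_mul, div_mul_eq_div_div, div_mul_eq_div_div,
    div_eq_mul_inv _ (Complex.Gamma (β + j)), h4, show β + j + 1 = β + 1 + j by ring]
  ring

/-- The values needed to identify the series of 𝐅_{∓1/2} with those of cosh and sinh. -/
theorem Gamma_half_add_nat (j : ℕ) :
    Complex.Gamma (1 / 2 + j) * (4 ^ j * j.factorial) =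
      (2 * j).factorial * (Real.sqrt Real.pi : ℝ) := by
  induction j with
  | zero =>
    rw [Real.sqrt_eq_rpow, Complex.ofReal_cpow Real.pi_pos.le]
    have := Complex.Gamma_one_half_eq
    simpa using this
  | succ j ih =>
    have h1 : Complex.Gamma (1 / 2 + ((j + 1 : ℕ) : ℂ)) =
        (1 / 2 + j) * Complex.Gamma (1 / 2 + j) := by
      rw [← Complex.Gamma_add_one]
      · congr 1; push_cast; ring
      · intro h
        have := congrArg Complex.re h
        simp at this
        have h2 : (0 : ℝ) ≤ j := Nat.cast_nonneg j
        linarith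
    rw [h1, Nat.factorial_succ, show 2 * (j + 1) = 2 * j + 1 + 1 by ring, Nat.factorial_succ,
      Nat.factorial_succ]
    push_cast
    linear_combination ((1 / 2 + j : ℂ) * 4 * (j + 1)) * ih

/-- Together with the sinh formula for 𝐅_{1/2}, this turns e^{-2√z} = cosh(2√z) - sinh(2√z) into the
connection formula for U_{-1/2}. -/
theorem sqrt_pi_mul_boldF_neg_half (w : ℂ) :
    (Real.sqrt Real.pi : ℝ) * boldF (-(1 / 2)) (w ^ 2) = Complex.cosh (2 * w) := by
  refine ((hasSum_boldF (-(1 / 2)) (w ^ 2)).mul_left _).unique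
    ((Complex.hasSum_cosh (2 * w)).congr_fun fun j => ?_)
  have h := Gamma_half_add_nat j
  have h0 : ((2 * j).factorial : ℂ) ≠ 0 := by exact_mod_cast (Nat.factorial_ne_zero _)
  have h1 : (j.factorial : ℂ) ≠ 0 := by exact_mod_cast (Nat.factorial_ne_zero _)
  have h2 : Complex.Gamma (1 / 2 + j) ≠ 0 := by
    intro h3
    rw [h3, zero_mul] at h
    exact mul_ne_zero h0 sqrt_pi_ne_zero h.symm
  rw [show (-(1 / 2) + 1 + j : ℂ) = 1 / 2 + j by ring, mul_pow, pow_mul (2 : ℂ), pow_mul w]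
  norm_num only
  generalize Complex.Gamma (1 / 2 + j) = g at *
  field_simp
  linear_combination (-(w ^ 2) ^ j) * h

theorem sqrt_pi_mul_boldF_half (w : ℂ) :
    (Real.sqrt Real.pi : ℝ) * (w * boldF (1 / 2) (w ^ 2)) = Complex.sinh (2 * w) := by
  refine (((hasSum_boldF (1 / 2) (w ^ 2)).mul_left w).mul_left _).unique
    ((Complex.hasSum_sinh (2 * w)).congr_fun fun j => ?_)
  have h := Gamma_half_add_nat j
  have h0 : ((2 * j).factorial : ℂ) ≠ 0 := by exact_mod_cast (Nat.factorial_ne_zero _)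
  have h1 : (j.factorial : ℂ) ≠ 0 := by exact_mod_cast (Nat.factorial_ne_zero _)
  have h2 : Complex.Gamma (1 / 2 + j) ≠ 0 := by
    intro h3
    rw [h3, zero_mul] at h
    exact mul_ne_zero h0 sqrt_pi_ne_zero h.symm
  have h5 : (1 / 2 + j : ℂ) ≠ 0 := by
    intro h
    have := congrArg Complex.re h
    simp at this
    have h2 : (0 : ℝ) ≤ j := Nat.cast_nonneg j
    linarith
  have h6 : (1 + 2 * j : ℂ) ≠ 0 := by
    intro h7; apply h5; linear_combination h7 / 2
  have h6' : (2 * j + 1 : ℂ) ≠ 0 := by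
    intro h7; apply h5; linear_combination h7 / 2
  rw [show (1 / 2 + 1 + j : ℂ) = 1 / 2 + j + 1 by ring, Complex.Gamma_add_one _ h5, mul_pow,
    pow_succ (2 : ℂ) (2 * j), pow_succ w (2 * j), pow_mul (2 : ℂ), pow_mul w, Nat.factorial_succ]
  norm_num only
  push_cast
  generalize Complex.Gamma (1 / 2 + j) = g at *
  field_simp
  linear_combination (-(w * (w ^ 2) ^ j * (2 * j + 1))) * h

/-- The connection formula for half-integer order. -/
theorem besselU_half_integer (k : ℕ) {z : ℂ} (hz : z ∈ Complex.slitPlane) :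
    besselU ((k : ℂ) - 1 / 2) z = (-1) ^ (k + 1) * (Real.sqrt Real.pi : ℝ) *
      (z ^ (-((k : ℂ) - 1 / 2)) * boldF (-((k : ℂ) - 1 / 2)) z - boldF ((k : ℂ) - 1 / 2) z) := by
  induction k generalizing z with
  | zero =>
    have h1 := sqrt_pi_mul_boldF_neg_half (z ^ (1 / 2 : ℂ))
    have h2 := sqrt_pi_mul_boldF_half (z ^ (1 / 2 : ℂ))
    rw [sq, cpow_half_mul_self] at h1 h2
    rw [Nat.cast_zero, zero_sub, neg_neg, besselU_neg_half hz, neg_mul, ← Complex.cosh_sub_sinh,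
      ← h1, ← h2]
    ring
  | succ k ih =>
    -- The induction step differentiates the formula: the left side becomes -U_{α+1}, while the
    -- three-term relation combines the derivatives of z^{-α} and 𝐅_{-α} into z^{-α-1} 𝐅_{-α-1}.
    have h1 := hasDerivAt_besselU ((k : ℂ) - 1 / 2) hz
    set α := (k : ℂ) - 1 / 2 with hα
    have hz0 := Complex.slitPlane_ne_zero hz
    have h2 : HasDerivAt (fun z : ℂ => z ^ (-α)) (-α * z ^ (-α - 1)) z := by
      simpa using (hasDerivAt_id z).cpow_const (c := -α) hz
    have h3 := ((h2.mul (hasDerivAt_boldF (-α) z)).sub (hasDerivAt_boldF α z)).const_mul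
      ((-1) ^ (k + 1) * ((Real.sqrt Real.pi : ℝ) : ℂ))
    have h4 := h1.unique (h3.congr_of_eventuallyEq (by
      filter_upwards [Complex.isOpen_slitPlane.mem_nhds hz] with w hw
      exact ih hw))
    have h5 := mul_boldF_add_mul_boldF (-α) z
    have e : ((k + 1 : ℕ) : ℂ) - 1 / 2 = α + 1 := by rw [hα]; push_cast; ring
    have e2 : z ^ (-α) = z ^ (-α - 1) * z := by
      rw [Complex.cpow_sub _ _ hz0, Complex.cpow_one]; field_simp
    rw [e, ← neg_neg (besselU (α + 1) z), h4, e2, show -(α + 1) = -α - 1 by ring, ← h5]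
    ring

/-! ### The logarithmic connection formula at integer order -/

/-- The substitution t ↦ x/t exchanges (0, x) and (1, ∞) and leaves both dt/t and t + x/t unchanged.
The part of the integral near 0 is thereby traded for one that is entire in x. -/
theorem integral_Ioc_exp_neg_sub_div {x : ℝ} (hx : 0 < x) :
    ∫ t in Set.Ioo 0 x, Real.exp (-t - x / t) / t = ∫ t in Set.Ioi 1, Real.exp (-t - x / t) / t := by
  have himg : (fun s : ℝ => x / s) '' Set.Ioi 1 = Set.Ioo 0 x := by
    ext t
    constructor
    · rintro ⟨s, hs, rfl⟩
      have hs1 : 1 < s := hs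
      exact ⟨by positivity, div_lt_self hx hs1⟩
    · rintro ⟨h0, h1⟩
      exact ⟨x / t, by rwa [Set.mem_Ioi, lt_div_iff₀ h0, one_mul], by field_simp⟩
  have hder : ∀ s ∈ Set.Ioi (1 : ℝ), HasDerivWithinAt (fun s : ℝ => x / s) (-x / s ^ 2)
      (Set.Ioi 1) s := by
    intro s hs
    have hs0 : s ≠ 0 := (lt_trans one_pos hs).ne'
    have := (hasDerivAt_const s x).div (hasDerivAt_id s) hs0
    exact (this.congr_deriv (by simp)).hasDerivWithinAt
  have hinj : Set.InjOn (fun s : ℝ => x / s) (Set.Ioi 1) := by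
    intro s hs t ht h
    have hs0 : s ≠ 0 := (lt_trans one_pos hs).ne'
    have ht0 : t ≠ 0 := (lt_trans one_pos ht).ne'
    simp only at h
    field_simp at h
    exact h.symm
  rw [← himg, integral_image_eq_integral_abs_deriv_smul measurableSet_Ioi hder hinj]
  refine setIntegral_congr_fun measurableSet_Ioi fun s hs => ?_
  have hs0 : 0 < s := lt_trans one_pos hs
  simp only [smul_eq_mul]
  rw [abs_div, abs_neg, abs_of_pos hx, abs_of_pos (by positivity)]
  have : -(x / s) - x / (x / s) = -s - x / s := by field_simp; ring
  rw [this]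
  field_simp

theorem summable_inv_factorial_mul_pow (R : ℝ) :
    Summable fun p : ℕ × ℕ => (R ^ p.1 / p.1.factorial) * (R ^ p.2 / p.2.factorial) := by
  have h := (Real.summable_pow_div_factorial |R|)
  have h2 : Summable fun p : ℕ × ℕ => (|R| ^ p.1 / p.1.factorial) * (|R| ^ p.2 / p.2.factorial) :=
    h.mul_of_nonneg h (fun _ => by positivity) (fun _ => by positivity)
  refine Summable.of_norm (h2.congr fun p => ?_)
  rw [norm_mul, norm_div, norm_div, norm_pow, norm_pow, Real.norm_eq_abs]
  simp

theorem integral_zpow_sub_one {x : ℝ} (hx : 0 < x) (n : ℤ) :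
    ∫ t in x..1, t ^ (n - 1) = if n = 0 then -Real.log x else (1 - x ^ n) / n := by
  have h0 : (0 : ℝ) ∉ Set.uIcc x 1 := by
    intro h
    rcases Set.mem_uIcc.1 h with h | h <;> linarith [h.1, h.2]
  split_ifs with hn
  · subst hn
    simp only [zero_sub, zpow_neg_one]
    rw [integral_inv h0, one_div, Real.log_inv]
  · rw [integral_zpow (Or.inr ⟨by omega, h0⟩), sub_add_cancel, one_zpow]
    push_cast
    rw [sub_add_cancel]

/-- The off-diagonal part of the double series of `∫ₓ¹ exp(-t - x/t) dt/t`. -/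
def offDiag (z : ℂ) (p : ℕ × ℕ) : ℂ :=
  if p.1 = p.2 then 0 else (-1) ^ (p.1 + p.2) * (z ^ p.2 - z ^ p.1) /
    (p.1.factorial * p.2.factorial * ((p.1 : ℂ) - p.2))

/-- Distinct natural numbers differ by at least one, so the denominators are harmless. The bound is
uniform on discs and makes the double sum entire. -/
theorem norm_offDiag_le {z : ℂ} {R : ℝ} (hR : 1 ≤ R) (hz : ‖z‖ ≤ R) (p : ℕ × ℕ) :
    ‖offDiag z p‖ ≤ 2 * ((R ^ p.1 / p.1.factorial) * (R ^ p.2 / p.2.factorial)) := by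
  unfold offDiag
  split_ifs with h
  · simp; positivity
  · have h1 : (1 : ℝ) ≤ ‖(p.1 : ℂ) - p.2‖ := by
      have : ((p.1 : ℂ) - p.2) = (((p.1 : ℤ) - p.2 : ℤ) : ℂ) := by push_cast; rfl
      rw [this, Complex.norm_intCast]
      have h2 : ((p.1 : ℤ) - p.2) ≠ 0 := by omega
      exact_mod_cast Int.one_le_abs h2
    have h2 : ‖z ^ p.2 - z ^ p.1‖ ≤ 2 * (R ^ p.1 * R ^ p.2) := by
      refine (norm_sub_le _ _).trans ?_
      rw [norm_pow, norm_pow]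
      have a1 : ‖z‖ ^ p.2 ≤ R ^ p.1 * R ^ p.2 := by
        refine (pow_le_pow_left₀ (norm_nonneg _) hz _).trans ?_
        exact le_mul_of_one_le_left (by positivity) (one_le_pow₀ hR)
      have a2 : ‖z‖ ^ p.1 ≤ R ^ p.1 * R ^ p.2 := by
        refine (pow_le_pow_left₀ (norm_nonneg _) hz _).trans ?_
        exact le_mul_of_one_le_right (by positivity) (one_le_pow₀ hR)
      linarith
    rw [norm_div, norm_mul, norm_pow, norm_neg, norm_one, one_pow, one_mul, norm_mul, norm_mul,
      Complex.norm_natCast, Complex.norm_natCast, div_mul_div_comm, ← mul_div_assoc]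
    refine div_le_div₀ (by positivity) h2 (by positivity) ?_
    exact le_mul_of_one_le_right (by positivity) h1

theorem differentiable_tsum_offDiag : Differentiable ℂ fun z => ∑' p, offDiag z p := by
  intro z
  have h := Complex.differentiableOn_tsum_of_summable_norm (F := fun p z => offDiag z p)
    (U := Metric.ball 0 (‖z‖ + 1)) ((summable_inv_factorial_mul_pow (‖z‖ + 1)).mul_left 2) ?_
    Metric.isOpen_ball ?_
  · exact h.differentiableAt (Metric.isOpen_ball.mem_nhds (by simp))
  · intro p
    unfold offDiag
    split_ifs
    · exact differentiableOn_const _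
    · fun_prop
  · intro p w hw
    exact norm_offDiag_le (by linarith [norm_nonneg z]) (by simpa using (le_of_lt (by simpa using hw)))
      p

/-- Both exponentials are expanded. On (x, 1] one has x/t ≤ 1 and t ≤ 1, so the (j, k) term is at
most 1/(x j! k!), which justifies integrating term by term. -/
theorem hasSum_integral_exp_neg_sub_div {x : ℝ} (hx : 0 < x) (hx1 : x < 1) :
    HasSum (fun p : ℕ × ℕ => (-1 : ℝ) ^ (p.1 + p.2) / (p.1.factorial * p.2.factorial) * x ^ p.2 *
      ∫ t in x..1, t ^ ((p.1 : ℤ) - p.2 - 1)) (∫ t in x..1, Real.exp (-t - x / t) / t) := by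
  simp_rw [intervalIntegral.integral_of_le hx1.le]
  simp_rw [← integral_const_mul]
  have hint : ∀ p : ℕ × ℕ, IntegrableOn (fun t : ℝ => (-1 : ℝ) ^ (p.1 + p.2) /
      (p.1.factorial * p.2.factorial) * x ^ p.2 * t ^ ((p.1 : ℤ) - p.2 - 1)) (Set.Ioc x 1) := by
    intro p
    refine (ContinuousOn.integrableOn_Icc ?_).mono_set Set.Ioc_subset_Icc_self
    refine ContinuousOn.mul continuousOn_const fun t ht => ?_
    exact (continuousAt_zpow₀ t _ (Or.inl (hx.trans_le ht.1).ne')).continuousWithinAt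
  have hle : ∀ p : ℕ × ℕ, ∀ t ∈ Set.Ioc x 1, ‖(-1 : ℝ) ^ (p.1 + p.2) /
      (p.1.factorial * p.2.factorial) * x ^ p.2 * t ^ ((p.1 : ℤ) - p.2 - 1)‖ ≤
      x⁻¹ * (1 ^ p.1 / p.1.factorial * (1 ^ p.2 / p.2.factorial)) := by
    intro p t ht
    have ht0 : 0 < t := hx.trans ht.1
    have h1 : x ^ p.2 * t ^ ((p.1 : ℤ) - p.2 - 1) ≤ x⁻¹ := by
      rw [zpow_sub₀ ht0.ne', zpow_sub₀ ht0.ne', zpow_natCast, zpow_natCast, zpow_one]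
      calc x ^ p.2 * (t ^ p.1 / t ^ p.2 / t) = (x / t) ^ p.2 * t ^ p.1 * t⁻¹ := by
            rw [div_pow]; ring
        _ ≤ 1 * 1 * x⁻¹ := by
            gcongr
            · exact pow_le_one₀ (by positivity) ((div_le_one ht0).2 ht.1.le)
            · exact pow_le_one₀ ht0.le ht.2
            · exact ht.1.le
        _ = _ := by ring
    rw [mul_assoc, norm_mul, Real.norm_of_nonneg (by positivity : 0 ≤ x ^ p.2 * _), norm_div,
      norm_pow, norm_neg, norm_one, one_pow, one_pow, one_pow, Real.norm_of_nonneg (by positivity)]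
    calc _ ≤ 1 / ((p.1.factorial : ℝ) * p.2.factorial) * x⁻¹ := by gcongr
      _ = _ := by field_simp
  have hsum := hasSum_integral_of_summable_integral_norm hint ?_
  · suffices h : (∫ t in Set.Ioc x 1, Real.exp (-t - x / t) / t) = ∫ t in Set.Ioc x 1,
        ∑' p : ℕ × ℕ, (-1 : ℝ) ^ (p.1 + p.2) / (p.1.factorial * p.2.factorial) * x ^ p.2 *
          t ^ ((p.1 : ℤ) - p.2 - 1) by rwa [h]
    refine setIntegral_congr_fun measurableSet_Ioc fun t ht => ?_
    have ht0 : 0 < t := hx.trans ht.1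
    have e1 := NormedSpace.expSeries_div_hasSum_exp (𝔸 := ℝ) (-t)
    have e2 := NormedSpace.expSeries_div_hasSum_exp (𝔸 := ℝ) (-(x / t))
    rw [← Real.exp_eq_exp_ℝ] at e1 e2
    have e3 := (e1.mul e2 ((Real.summable_pow_div_factorial (-t)).norm.mul_norm
      (Real.summable_pow_div_factorial (-(x / t))).norm).of_norm).div_const t
    rw [← Real.exp_add, ← sub_eq_add_neg] at e3
    rw [← e3.tsum_eq]
    refine tsum_congr fun p => ?_
    rw [zpow_sub₀ ht0.ne', zpow_sub₀ ht0.ne', zpow_natCast, zpow_natCast, zpow_one, neg_pow t,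
      neg_pow (x / t), div_pow, pow_add]
    field_simp
  · refine Summable.of_nonneg_of_le (fun p => integral_nonneg fun t => norm_nonneg _) (fun p => ?_)
      ((summable_inv_factorial_mul_pow 1).mul_left (x⁻¹ * volume.real (Set.Ioc x 1)))
    have := norm_setIntegral_le_of_norm_le_const (μ := volume) (s := Set.Ioc x 1)
      (f := fun t : ℝ => ‖(-1 : ℝ) ^ (p.1 + p.2) /
      (p.1.factorial * p.2.factorial) * x ^ p.2 * t ^ ((p.1 : ℤ) - p.2 - 1)‖)
      (measure_Ioc_lt_top (μ := volume) (a := x) (b := 1)) (fun t ht => by rw [norm_norm]; exact hle p t ht)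
    refine (le_abs_self _).trans (this.trans (le_of_eq (by ring)))

/-- Only the diagonal terms contain ∫ dt/t = -log x, and they sum to -log x ∑ x^j/(j!)² = -log x
𝐅₀(x). Every other term is a polynomial in x. -/
theorem integral_exp_neg_sub_div_eq {x : ℝ} (hx : 0 < x) (hx1 : x < 1) :
    ((∫ t in x..1, Real.exp (-t - x / t) / t : ℝ) : ℂ) =
      -Complex.log x * boldF 0 x + ∑' p, offDiag x p := by
  have h1 := Complex.hasSum_ofReal.2 (hasSum_integral_exp_neg_sub_div hx hx1)
  have hdiag : HasSum (fun p : ℕ × ℕ => if p.1 = p.2 then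
      -Complex.log x * ((x : ℂ) ^ p.1 / (Complex.Gamma (0 + 1 + p.1) * (p.1.factorial : ℂ))) else 0)
      (-Complex.log x * boldF 0 x) := by
    have hinj : Function.Injective fun j : ℕ => (j, j) := fun a b h => (Prod.mk.inj h).1
    rw [← hinj.hasSum_iff]
    · simpa [Function.comp_def] using (hasSum_boldF 0 x).mul_left (-Complex.log x)
    · rintro ⟨j, k⟩ hjk
      refine if_neg fun h : j = k => ?_
      subst h
      exact hjk ⟨j, rfl⟩
  have h2 := h1.sub hdiag
  rw [← sub_eq_iff_eq_add', ← h2.tsum_eq]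
  refine tsum_congr fun p => ?_
  have h3 := integral_zpow_sub_one hx ((p.1 : ℤ) - p.2)
  rw [h3]
  unfold offDiag
  rcases eq_or_ne p.1 p.2 with h | h
  · rw [if_pos h, if_pos h, if_pos (by omega), h, zero_add, add_comm (1 : ℂ),
      Complex.Gamma_nat_eq_factorial, ← Complex.ofReal_log hx.le]
    push_cast
    rw [← two_mul, pow_mul]
    norm_num
    ring
  · rw [if_neg h, if_neg h, if_neg (by omega), sub_zero, zpow_sub₀ hx.ne', zpow_natCast,
      zpow_natCast]
    have h5 : (x : ℂ) ≠ 0 := by exact_mod_cast hx.ne'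
    have h6 : (p.1 : ℂ) - p.2 ≠ 0 := sub_ne_zero.2 (by exact_mod_cast h)
    push_cast
    field_simp

theorem differentiable_integral_Ioi_one :
    Differentiable ℂ fun z : ℂ => ∫ t in Set.Ioi (1 : ℝ), Complex.exp (-(t : ℂ) - z / t) / t := by
  intro z
  have hnorm : ∀ (w : ℂ) (t : ℝ), 1 < t → ‖w‖ ≤ ‖z‖ + 1 → 
      ‖Complex.exp (-(t : ℂ) - w / t)‖ ≤ Real.exp (‖z‖ + 1) * Real.exp (-t) := by
    intro w t ht hw
    have ht0 : 0 < t := lt_trans one_pos ht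
    rw [Complex.norm_exp, ← Real.exp_add]
    gcongr
    simp only [Complex.sub_re, Complex.neg_re, Complex.ofReal_re, Complex.div_ofReal_re]
    have h1 : -(w.re / t) ≤ ‖z‖ + 1 := by
      rw [← neg_div, div_le_iff₀ ht0]
      have := (abs_le.1 (Complex.abs_re_le_norm w)).1
      nlinarith [norm_nonneg z]
    linarith
  have hcont : ∀ (w : ℂ) (n : ℕ), ContinuousOn (fun t : ℝ => Complex.exp (-(t : ℂ) - w / t) / (t : ℂ) ^ n)
      (Set.Ioi 1) := by
    intro w n t ht
    have ht0 : (t : ℂ) ≠ 0 := by exact_mod_cast (lt_trans one_pos ht).ne'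
    refine ContinuousAt.continuousWithinAt ?_
    exact ContinuousAt.div (by fun_prop (disch := assumption)) (by fun_prop) (pow_ne_zero n ht0)
  have hexp : IntegrableOn (fun t : ℝ => Real.exp (‖z‖ + 1) * Real.exp (-t)) (Set.Ioi 1) :=
    (integrableOn_exp_neg_Ioi 1).const_mul _
  have hle1 : ∀ (w : ℂ) (t : ℝ) (n : ℕ), 1 < t → ‖w‖ ≤ ‖z‖ + 1 →
      ‖Complex.exp (-(t : ℂ) - w / t) / (t : ℂ) ^ n‖ ≤ Real.exp (‖z‖ + 1) * Real.exp (-t) := by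
    intro w t n ht hw
    rw [norm_div, norm_pow, Complex.norm_real, Real.norm_of_nonneg (by linarith)]
    exact (div_le_self (norm_nonneg _) (one_le_pow₀ ht.le)).trans (hnorm w t ht hw)
  have hder := hasDerivAt_integral_of_dominated_loc_of_deriv_le
    (μ := volume.restrict (Set.Ioi (1 : ℝ)))
    (F := fun (w : ℂ) (t : ℝ) => Complex.exp (-(t : ℂ) - w / t) / t)
    (F' := fun (w : ℂ) (t : ℝ) => -(Complex.exp (-(t : ℂ) - w / t) / (t : ℂ) ^ 2))
    (x₀ := z) (s := Metric.ball z 1) (bound := fun t => Real.exp (‖z‖ + 1) * Real.exp (-t))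
    (Metric.ball_mem_nhds z one_pos) ?_ ?_ ?_ ?_ hexp ?_
  · exact hder.2.differentiableAt
  · refine Eventually.of_forall fun w => ?_
    simpa using (hcont w 1).aestronglyMeasurable (μ := volume) measurableSet_Ioi
  · refine Integrable.mono' hexp (by
      simpa using (hcont z 1).aestronglyMeasurable (μ := volume) measurableSet_Ioi) ?_
    filter_upwards [ae_restrict_mem measurableSet_Ioi] with t ht
    simpa using hle1 z t 1 ht (by linarith)
  · exact ((hcont z 2).aestronglyMeasurable measurableSet_Ioi).neg
  · filter_upwards [ae_restrict_mem measurableSet_Ioi] with t ht w hw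
    rw [norm_neg]
    refine hle1 w t 2 ht ?_
    have := norm_sub_norm_le w z
    have h2 : ‖w - z‖ < 1 := by simpa [dist_eq_norm] using hw
    linarith
  · filter_upwards [ae_restrict_mem measurableSet_Ioi] with t ht w hw
    have ht0 : (t : ℂ) ≠ 0 := by exact_mod_cast (lt_trans one_pos ht).ne'
    have h := (((hasDerivAt_id w).div_const (t : ℂ)).const_sub (-(t : ℂ))).cexp.div_const (t : ℂ)
    refine h.congr_deriv ?_
    simp only [id]
    field_simp

/-- The half-line is split at x and 1. The outer pieces are equal, which explains the factor 2, and
the middle piece carries the logarithm. -/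
theorem besselU_zero_ofReal {x : ℝ} (hx : 0 < x) (hx1 : x < 1) :
    (Real.sqrt Real.pi : ℝ) * besselU 0 x = -Complex.log x * boldF 0 x +
      (∑' p, offDiag x p +
        2 * ∫ t in Set.Ioi (1 : ℝ), Complex.exp (-(t : ℂ) - x / t) / t) := by
  have hint : IntegrableOn (fun t : ℝ => Real.exp (-t - x / t) / t) (Set.Ioi 0) := by
    refine (integrableOn_exp_neg_mul_sub_div (-1) one_pos hx).congr_fun (fun t ht => ?_)
      measurableSet_Ioi
    have ht0 : 0 < t := ht
    simp only
    rw [Real.rpow_neg_one, one_mul, div_eq_mul_inv (Real.exp _)]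
  have h1 : (∫ t in Set.Ioi (0 : ℝ), Real.exp (-t - x / t) / t) =
      (∫ t in x..1, Real.exp (-t - x / t) / t) + 2 * ∫ t in Set.Ioi 1, Real.exp (-t - x / t) / t := by
    rw [← Set.Ioc_union_Ioi_eq_Ioi zero_le_one, ← Set.Ioc_union_Ioc_eq_Ioc hx.le hx1.le,
      setIntegral_union, setIntegral_union, integral_Ioc_eq_integral_Ioo,
      integral_Ioc_exp_neg_sub_div hx, intervalIntegral.integral_of_le hx1.le]
    · ring
    · exact Set.disjoint_left.2 fun t h1 h2 => by linarith [h1.2, h2.1]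
    · exact measurableSet_Ioc
    · exact hint.mono_set Set.Ioc_subset_Ioi_self
    · exact hint.mono_set fun t ht => lt_trans hx ht.1
    · exact Set.disjoint_left.2 fun t h1 h2 => by
        rcases h1 with h1 | h1 <;> linarith [h1.2, Set.mem_Ioi.1 h2]
    · exact measurableSet_Ioi
    · exact hint.mono_set fun t ht => by
        rcases ht with h1 | h1
        · exact h1.1
        · exact lt_trans hx h1.1
    · exact hint.mono_set fun t ht => Set.mem_Ioi.2 (lt_trans one_pos (Set.mem_Ioi.1 ht))
  have h2 : (Real.sqrt Real.pi : ℝ) * besselU 0 x =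
      ((∫ t in Set.Ioi (0 : ℝ), Real.exp (-t - x / t) / t : ℝ) : ℂ) := by
    rw [besselU_ofReal 0 hx, mul_inv_cancel_left₀ sqrt_pi_ne_zero, ← integral_complex_ofReal]
    refine integral_congr_ae (Eventually.of_forall fun t => ?_)
    simp [Complex.cpow_neg_one, div_eq_mul_inv]
  rw [h2, h1, Complex.ofReal_add, integral_exp_neg_sub_div_eq hx hx1, add_assoc]
  congr 2
  rw [Complex.ofReal_mul, ← integral_complex_ofReal]
  simp

/-- Both sides are analytic on the connected slit plane and agree on (0, 1), so the identity theorem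
extends the formula. -/
theorem exists_besselU_zero_eq : ∃ E : ℂ → ℂ, Differentiable ℂ E ∧ ∀ z ∈ Complex.slitPlane,
    (Real.sqrt Real.pi : ℝ) * besselU 0 z = -Complex.log z * boldF 0 z + E z := by
  set E : ℂ → ℂ := fun z => ∑' p, offDiag z p +
    2 * ∫ t in Set.Ioi (1 : ℝ), Complex.exp (-(t : ℂ) - z / t) / t with hE
  have hEd : Differentiable ℂ E :=
    differentiable_tsum_offDiag.add (differentiable_integral_Ioi_one.const_mul 2)
  refine ⟨E, hEd, ?_⟩
  have hf : DifferentiableOn ℂ (fun z => (Real.sqrt Real.pi : ℝ) * besselU 0 z)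
      Complex.slitPlane := (differentiableOn_besselU 0).const_mul _
  have hg : DifferentiableOn ℂ (fun z => -Complex.log z * boldF 0 z + E z) Complex.slitPlane := by
    refine DifferentiableOn.add (DifferentiableOn.mul (fun z hz => ?_)
      (differentiable_boldF 0).differentiableOn) hEd.differentiableOn
    exact (Complex.differentiableAt_log hz).neg.differentiableWithinAt
  have h0 : ((1 / 2 : ℝ) : ℂ) ∈ Complex.slitPlane := Complex.ofReal_mem_slitPlane.2 (by norm_num)
  refine AnalyticOnNhd.eqOn_of_preconnected_of_frequently_eq
    (hf.analyticOnNhd Complex.isOpen_slitPlane) (hg.analyticOnNhd Complex.isOpen_slitPlane)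
    isPreconnected_slitPlane h0 ?_
  have hmap : Tendsto (fun x : ℝ => (x : ℂ)) (𝓝[≠] (1 / 2)) (𝓝[≠] ((1 / 2 : ℝ) : ℂ)) := by
    refine tendsto_nhdsWithin_of_tendsto_nhds_of_eventually_within _
      (Complex.continuous_ofReal.continuousAt.tendsto.mono_left nhdsWithin_le_nhds) ?_
    filter_upwards [self_mem_nhdsWithin] with x hx
    exact fun h => hx (Complex.ofReal_injective (Set.mem_singleton_iff.1 h))
  refine hmap.frequently (Eventually.frequently ?_)
  have : Set.Ioo (0 : ℝ) 1 ∈ 𝓝 (1 / 2 : ℝ) := Ioo_mem_nhds (by norm_num) (by norm_num)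
  filter_upwards [mem_nhdsWithin_of_mem_nhds this] with x hx
  exact besselU_zero_ofReal hx.1 hx.2

/-- The connection formula for integer order. -/
theorem exists_besselU_natCast_eq (a : ℕ) : ∃ E : ℂ → ℂ, Differentiable ℂ E ∧
    ∀ z ∈ Complex.slitPlane, (Real.sqrt Real.pi : ℝ) * besselU a z =
      ∑ k ∈ Finset.range a, (-1 : ℂ) ^ k * Complex.Gamma (a - k) / k.factorial *
        z ^ ((k : ℂ) - a) + (-1) ^ (a + 1) * (Complex.log z * boldF a z) + E z := by
  induction a with
  | zero =>
    obtain ⟨E, hE, h⟩ := exists_besselU_zero_eq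
    refine ⟨E, hE, fun z hz => ?_⟩
    rw [Nat.cast_zero, h z hz]
    simp
  | succ a ih =>
    obtain ⟨E, hE, h⟩ := ih
    -- Differentiating log z 𝐅_a(z) creates 𝐅_a(z)/z, whose principal part is 1/(a! z). That part is
    -- the new term k = a of the finite sum; the rest is the entire difference quotient, absorbed
    -- into E.
    have hds : Differentiable ℂ (dslope (boldF a) 0) := by
      have := (Complex.differentiableOn_dslope (f := boldF a) (c := 0) Filter.univ_mem).2
        (differentiable_boldF a).differentiableOn
      exact differentiableOn_univ.1 this
    have hF0 : boldF a 0 = 1 / a.factorial := by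
      have h1 := hasSum_boldF a 0
      have h2 := hasSum_single (f := fun j : ℕ => (0 : ℂ) ^ j /
        (Complex.Gamma (a + 1 + j) * (j.factorial : ℂ))) 0 (fun j hj => by simp [hj])
      rw [h1.unique h2]
      simp [Complex.Gamma_nat_eq_factorial]
    refine ⟨fun z => -deriv E z + (-1) ^ a * dslope (boldF a) 0 z, ?_, fun z hz => ?_⟩
    · refine Differentiable.add ?_ (hds.const_mul _)
      exact (hE.contDiff (n := 2)).differentiable_deriv_two.neg
    · have hz0 := Complex.slitPlane_ne_zero hz
      have h1 := (hasDerivAt_besselU (a : ℂ) hz).const_mul ((Real.sqrt Real.pi : ℝ) : ℂ)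
      have h2 : HasDerivAt (fun z : ℂ => ∑ k ∈ Finset.range a, (-1 : ℂ) ^ k *
          Complex.Gamma (a - k) / k.factorial * z ^ ((k : ℂ) - a))
          (∑ k ∈ Finset.range a, (-1 : ℂ) ^ k * Complex.Gamma (a - k) / k.factorial *
            (((k : ℂ) - a) * z ^ ((k : ℂ) - a - 1))) z := by
        refine HasDerivAt.fun_sum fun k _ => ?_
        have := (hasDerivAt_id z).cpow_const (c := (k : ℂ) - a) hz
        simp only [id, mul_one] at this
        exact this.const_mul _
      have h3 := (((Complex.hasDerivAt_log hz).mul (hasDerivAt_boldF a z)).const_mul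
        ((-1 : ℂ) ^ (a + 1)))
      have h4 := h1.unique (((h2.add h3).add (hE z).hasDerivAt).congr_of_eventuallyEq (by
        filter_upwards [Complex.isOpen_slitPlane.mem_nhds hz] with w hw
        exact h w hw))
      have h5 : boldF a z = 1 / a.factorial + z * dslope (boldF a) 0 z := by
        rw [← hF0, dslope_of_ne _ hz0, slope_def_field]
        field_simp
        ring
      have h6 : ∑ k ∈ Finset.range (a + 1), (-1 : ℂ) ^ k * Complex.Gamma ((a + 1 : ℕ) - k) /
          k.factorial * z ^ ((k : ℂ) - (a + 1 : ℕ)) = -(∑ k ∈ Finset.range a, (-1 : ℂ) ^ k *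
          Complex.Gamma (a - k) / k.factorial * (((k : ℂ) - a) * z ^ ((k : ℂ) - a - 1))) +
          (-1) ^ a / a.factorial * z⁻¹ := by
        rw [Finset.sum_range_succ, ← Finset.sum_neg_distrib]
        congr 1
        · refine Finset.sum_congr rfl fun k hk => ?_
          have hk' : (a : ℂ) - k ≠ 0 := by
            rw [sub_ne_zero]; exact_mod_cast (Finset.mem_range.1 hk).ne'
          rw [show (((a + 1 : ℕ) : ℂ) - k) = (a - k : ℂ) + 1 by push_cast; ring,
            Complex.Gamma_add_one _ hk', show ((k : ℂ) - (a + 1 : ℕ)) = (k : ℂ) - a - 1 by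
              push_cast; ring]
          ring
        · rw [show (((a + 1 : ℕ) : ℂ) - a) = 1 by push_cast; ring, Complex.Gamma_one,
            show ((a : ℂ) - (a + 1 : ℕ)) = -1 by push_cast; ring, Complex.cpow_neg_one]
          ring
      have h7 : (Real.sqrt Real.pi : ℝ) * besselU ((a + 1 : ℕ) : ℂ) z =
          -((Real.sqrt Real.pi : ℝ) * -besselU ((a : ℂ) + 1) z) := by push_cast; ring
      rw [h6, h7, h4, h5, show (((a + 1 : ℕ) : ℂ)) = (a : ℂ) + 1 by push_cast; ring]
      field_simp
      ring

/-! ### Partial Fourier transforms of Laplace integrals -/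

section PartialFourier

variable {V : Type*} [NormedAddCommGroup V] [InnerProductSpace ℝ V] [FiniteDimensional ℝ V]
  [MeasurableSpace V] [BorelSpace V]

/-- The integral `∫ e^{i q y} f(y) dy`. -/
def innerFourier (f : V → ℂ) (q : V) : ℂ :=
  ∫ y, Complex.exp (Complex.I * (inner ℝ q y : ℝ)) * f y

theorem norm_exp_I_mul_ofReal (t : ℝ) : ‖Complex.exp (Complex.I * t)‖ = 1 := by
  rw [mul_comm, Complex.norm_exp_ofReal_mul_I]

/-- The Gaussian in y is itself the Fourier transform of a Gaussian in q, so Fubini moves the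
transform onto f. Complex b is allowed because only Re b > 0 is needed for absolute convergence. -/
theorem integral_gaussian_mul {f : V → ℂ} (hf : Integrable f) {b : ℂ} (hb : 0 < b.re) :
    ∫ y, Complex.exp (-b * ‖y‖ ^ 2) * f y =
      ((4 * Real.pi * b) ^ (Module.finrank ℝ V / 2 : ℂ))⁻¹ *
        ∫ q, Complex.exp (-(1 / (4 * b)) * ‖q‖ ^ 2) * innerFourier f q := by
  have hb0 : b ≠ 0 := by rintro rfl; simp at hb
  have hb' : 0 < (1 / (4 * b)).re := by
    rw [show 1 / (4 * b) = ((4⁻¹ : ℝ) : ℂ) * b⁻¹ by push_cast; field_simp, Complex.re_ofReal_mul,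
      Complex.inv_re]
    have := Complex.normSq_pos.2 hb0
    positivity
  have hπ : (4 * Real.pi * b : ℂ) ≠ 0 := by
    simp [hb0, Real.pi_ne_zero]
  have hc : (4 * Real.pi * b : ℂ) ^ (Module.finrank ℝ V / 2 : ℂ) ≠ 0 := by
    simp [Complex.cpow_eq_zero_iff, hb0, Real.pi_ne_zero]
  have hg : Integrable fun q : V => Complex.exp (-(1 / (4 * b)) * ‖q‖ ^ 2) := by
    simpa using GaussianFourier.integrable_cexp_neg_mul_sq_norm_add hb' 0 (0 : V)
  have hint : Integrable (Function.uncurry fun (q y : V) =>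
      Complex.exp (-(1 / (4 * b)) * ‖q‖ ^ 2) *
        (Complex.exp (Complex.I * (inner ℝ q y : ℝ)) * f y)) (volume.prod volume) := by
    refine (hg.mul_prod hf).norm.mono' ?_ (Eventually.of_forall fun p => ?_)
    · refine hg.1.comp_fst.mul (AEStronglyMeasurable.mul ?_ hf.1.comp_snd)
      exact Continuous.aestronglyMeasurable (by fun_prop)
    · simp only [Function.uncurry, norm_mul, norm_exp_I_mul_ofReal, one_mul]
      exact le_rfl
  have h1 : ∫ q, Complex.exp (-(1 / (4 * b)) * ‖q‖ ^ 2) * innerFourier f q =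
      ∫ y, ∫ q, Complex.exp (-(1 / (4 * b)) * ‖q‖ ^ 2) *
        (Complex.exp (Complex.I * (inner ℝ q y : ℝ)) * f y) := by
    rw [← integral_integral_swap hint]
    simp_rw [integral_const_mul]
    rfl
  rw [h1, ← integral_const_mul]
  refine integral_congr_ae (Eventually.of_forall fun y => ?_)
  have h2 := GaussianFourier.integral_cexp_neg_mul_sq_norm_add hb' Complex.I y
  have h3 : ∀ q : V, Complex.exp (-(1 / (4 * b)) * ‖q‖ ^ 2) *
        (Complex.exp (Complex.I * (inner ℝ q y : ℝ)) * f y) =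
      Complex.exp (-(1 / (4 * b)) * ‖q‖ ^ 2 + Complex.I * (inner ℝ y q : ℝ)) * f y := by
    intro q
    rw [Complex.exp_add, real_inner_comm, mul_assoc]
  simp only
  simp_rw [h3]
  rw [integral_mul_const, h2]
  rw [show (Real.pi : ℂ) / (1 / (4 * b)) = 4 * Real.pi * b by field_simp,
    show Complex.I ^ 2 * (‖y‖ : ℂ) ^ 2 / (4 * (1 / (4 * b))) = -b * ‖y‖ ^ 2 by
      rw [Complex.I_sq]; field_simp]
  field_simp

/-- For each τ the factor exp(-b|y|²/τ) transforms into (4πb)^{-n/2} τ^{n/2} exp(-τ|q|²/(4b)). The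
exponential shifts a by |q|²/(4b), and the power τ^{n/2} reduces the exponent -(n + 1)/2 to -1/2,
where the Laplace integral is elementary. -/
theorem integral_laplaceIntegral_mul {f : V → ℂ} (hf : Integrable f)
    (hψ : Integrable (innerFourier f)) {a b B : ℂ} (ha : 0 < a.re) (hb : 0 < b.re)
    (hB : 0 < B.re) :
    ∫ y, laplaceIntegral (-((Module.finrank ℝ V + 1) / 2)) a (b * ‖y‖ ^ 2 + B) * f y =
      ((4 * Real.pi * b) ^ (Module.finrank ℝ V / 2 : ℂ))⁻¹ *
        ∫ q, laplaceIntegral (-(1 / 2)) (a + ‖q‖ ^ 2 / (4 * b)) B * innerFourier f q := by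
  have hb0 : b ≠ 0 := by rintro rfl; simp at hb
  have hbi : 0 < (b⁻¹).re := by
    rw [Complex.inv_re]
    exact div_pos hb (Complex.normSq_pos.2 hb0)
  set n : ℂ := (Module.finrank ℝ V : ℂ) with hn
  set g : ℂ → ℝ → ℂ := fun β τ => Complex.exp (-(a * τ) - B / τ) * (τ : ℂ) ^ β with hg
  have hgint : ∀ β, Integrable (g β) (volume.restrict (Set.Ioi 0)) :=
    fun β => integrableOn_laplace_integrand β ha hB
  have hint1 : Integrable (Function.uncurry fun (y : V) (τ : ℝ) =>
      g (-((n + 1) / 2)) τ * (Complex.exp (-(b / τ) * ‖y‖ ^ 2) * f y))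
      (volume.prod (volume.restrict (Set.Ioi 0))) := by
    refine (hf.mul_prod (hgint (-((n + 1) / 2)))).norm.mono' ?_ ?_
    · refine (hgint _).1.comp_snd.mul (AEStronglyMeasurable.mul ?_ hf.1.comp_fst)
      refine Measurable.aestronglyMeasurable ?_
      fun_prop
    · have : ∀ᵐ p : V × ℝ ∂(volume.prod (volume.restrict (Set.Ioi 0))), 0 < p.2 :=
        Measure.quasiMeasurePreserving_snd.ae (ae_restrict_mem measurableSet_Ioi)
      filter_upwards [this] with p hp
      simp only [Function.uncurry]
      rw [norm_mul (g _ p.2), norm_mul (Complex.exp (-(b / _) * _)), norm_mul (f p.1),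
        mul_comm ‖f p.1‖]
      refine mul_le_mul_of_nonneg_left ?_ (norm_nonneg _)
      refine mul_le_of_le_one_left (norm_nonneg _) ?_
      rw [Complex.norm_exp, Real.exp_le_one_iff]
      have : (-(b / p.2) * (‖p.1‖ : ℂ) ^ 2).re = -(b.re / p.2 * ‖p.1‖ ^ 2) := by
        rw [← Complex.ofReal_pow, Complex.re_mul_ofReal, Complex.neg_re, Complex.div_ofReal_re]
        ring
      rw [this]
      have : 0 ≤ b.re / p.2 * ‖p.1‖ ^ 2 := by positivity
      linarith
  have hint2 : Integrable (Function.uncurry fun (τ : ℝ) (q : V) =>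
      g (-(1 / 2)) τ * (Complex.exp (-(1 / (4 * (b / τ))) * ‖q‖ ^ 2) * innerFourier f q))
      ((volume.restrict (Set.Ioi 0)).prod volume) := by
    refine ((hgint (-(1 / 2))).mul_prod hψ).norm.mono' ?_ ?_
    · refine (hgint _).1.comp_fst.mul (AEStronglyMeasurable.mul ?_ hψ.1.comp_snd)
      refine Measurable.aestronglyMeasurable ?_
      fun_prop
    · have : ∀ᵐ p : ℝ × V ∂((volume.restrict (Set.Ioi 0)).prod volume), 0 < p.1 :=
        Measure.quasiMeasurePreserving_fst.ae (ae_restrict_mem measurableSet_Ioi)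
      filter_upwards [this] with p hp
      simp only [Function.uncurry]
      rw [norm_mul (g _ p.1), norm_mul (Complex.exp (-(1 / _) * _)), norm_mul (g _ p.1)]
      refine mul_le_mul_of_nonneg_left ?_ (norm_nonneg _)
      refine mul_le_of_le_one_left (norm_nonneg _) ?_
      rw [Complex.norm_exp, Real.exp_le_one_iff]
      have : (-(1 / (4 * (b / p.1))) * (‖p.2‖ : ℂ) ^ 2).re = -((b⁻¹).re * p.1 / 4 * ‖p.2‖ ^ 2) := by
        rw [show (-(1 / (4 * (b / p.1))) * (‖p.2‖ : ℂ) ^ 2) =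
          b⁻¹ * ((-(p.1 / 4 * ‖p.2‖ ^ 2) : ℝ) : ℂ) by push_cast; field_simp, Complex.re_mul_ofReal]
        ring
      rw [this]
      have : 0 ≤ (b⁻¹).re * p.1 / 4 * ‖p.2‖ ^ 2 := by positivity
      linarith
  have h1 : ∫ y, laplaceIntegral (-((n + 1) / 2)) a (b * ‖y‖ ^ 2 + B) * f y =
      ∫ y, ∫ τ in Set.Ioi (0 : ℝ),
        g (-((n + 1) / 2)) τ * (Complex.exp (-(b / τ) * ‖y‖ ^ 2) * f y) := by
    refine integral_congr_ae (Eventually.of_forall fun y => ?_)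
    simp only [laplaceIntegral]
    rw [← integral_mul_const]
    refine setIntegral_congr_fun measurableSet_Ioi fun τ hτ => ?_
    simp only [hg]
    rw [show -(a * τ) - (b * ‖y‖ ^ 2 + B) / (τ : ℂ) = -(a * τ) - B / τ + -(b / τ) * ‖y‖ ^ 2 by ring,
      Complex.exp_add]
    ring
  have h2 : ∀ τ ∈ Set.Ioi (0 : ℝ),
      ∫ y, g (-((n + 1) / 2)) τ * (Complex.exp (-(b / τ) * ‖y‖ ^ 2) * f y) =
      ((4 * Real.pi * b) ^ (n / 2))⁻¹ * ∫ q, g (-(1 / 2)) τ *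
        (Complex.exp (-(1 / (4 * (b / τ))) * ‖q‖ ^ 2) * innerFourier f q) := by
    intro τ hτ
    have hτ0 : 0 < τ := hτ
    have hτ' : (τ : ℂ) ≠ 0 := by exact_mod_cast hτ0.ne'
    have hbτ : 0 < (b / τ).re := by rw [Complex.div_ofReal_re]; positivity
    have h4 : (4 * Real.pi * b : ℂ) ≠ 0 := by simp [hb0, Real.pi_ne_zero]
    rw [integral_const_mul, integral_const_mul, integral_gaussian_mul hf hbτ,
      show (4 * Real.pi * (b / τ) : ℂ) = ((τ⁻¹ : ℝ) : ℂ) * (4 * Real.pi * b) by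
        push_cast; field_simp, ofReal_mul_cpow (by positivity) h4, mul_inv, Complex.ofReal_inv,
      Complex.inv_cpow _ _ (by rw [Complex.arg_ofReal_of_nonneg hτ0.le]; exact Real.pi_pos.ne),
      inv_inv]
    have h5 : g (-(1 / 2)) τ = g (-((n + 1) / 2)) τ * (τ : ℂ) ^ (n / 2) := by
      simp only [hg]
      rw [mul_assoc, ← Complex.cpow_add _ _ hτ']
      congr 2
      ring
    rw [h5]
    ring
  rw [h1, integral_integral_swap hint1, setIntegral_congr_fun measurableSet_Ioi h2,
    integral_const_mul, integral_integral_swap hint2]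
  congr 1
  refine integral_congr_ae (Eventually.of_forall fun q => ?_)
  simp only [laplaceIntegral]
  rw [← integral_mul_const]
  refine setIntegral_congr_fun measurableSet_Ioi fun τ hτ => ?_
  have hτ' : (τ : ℂ) ≠ 0 := by exact_mod_cast (ne_of_gt hτ)
  simp only [hg]
  rw [show -((a + (‖q‖ : ℂ) ^ 2 / (4 * b)) * τ) - B / (τ : ℂ) =
    -(a * τ) - B / τ + -(1 / (4 * (b / τ))) * ‖q‖ ^ 2 by field_simp; ring, Complex.exp_add]
  ring

end PartialFourier

/-! ### Kernel distributions and boundary values -/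

set_option linter.unusedSectionVars false

section Kernel

variable {V : Type*} [NormedAddCommGroup V] [InnerProductSpace ℝ V] [FiniteDimensional ℝ V]
  [MeasurableSpace V] [BorelSpace V]

/-- The Fourier transform of a test function in the spatial variables only. -/
def spatialFourier (φ : 𝓢(ℝ × V, ℂ)) (p : ℝ × V) : ℂ := innerFourier (fun y => φ (p.1, y)) p.2

/-- The decay of spatial Fourier transforms. -/
def decayWeight (N : ℕ) (p : ℝ × V) : ℝ := ((1 + |p.1|) ^ 2)⁻¹ * ((1 + ‖p.2‖) ^ N)⁻¹

theorem decayWeight_nonneg (N : ℕ) (p : ℝ × V) : 0 ≤ decayWeight N p := by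
  unfold decayWeight; positivity

theorem continuous_decayWeight (N : ℕ) : Continuous (decayWeight N : ℝ × V → ℝ) := by
  unfold decayWeight
  refine Continuous.mul (Continuous.inv₀ (by fun_prop) fun p => by positivity)
    (Continuous.inv₀ (by fun_prop) fun p => by positivity)

theorem integrable_one_add_norm_pow_inv {W : Type*} [NormedAddCommGroup W] [NormedSpace ℝ W]
    [FiniteDimensional ℝ W] [MeasurableSpace W] [BorelSpace W] (μ : Measure W)
    [μ.IsAddHaarMeasure] {N : ℕ} (hN : Module.finrank ℝ W < N) :
    Integrable (fun y : W => ((1 + ‖y‖) ^ N)⁻¹) μ := by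
  have h := integrable_one_add_norm (E := W) (μ := μ) (r := N) (by exact_mod_cast hN)
  refine h.congr (Eventually.of_forall fun y => ?_)
  simp only
  rw [Real.rpow_neg (by positivity), Real.rpow_natCast]

theorem integrable_time_decay : Integrable fun t : ℝ => ((1 + |t|) ^ 2)⁻¹ :=
  integrable_one_add_norm_pow_inv volume (by simp)

theorem norm_iteratedFDeriv_slice_le (φ : 𝓢(ℝ × V, ℂ)) (j : ℕ) (x0 : ℝ) (y : V) :
    ‖iteratedFDeriv ℝ j (fun y => φ (x0, y)) y‖ ≤ ‖iteratedFDeriv ℝ j φ (x0, y)‖ := by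
  set g : ℝ × V → ℂ := fun p => φ ((x0, 0) + p) with hg
  have hgs : ContDiff ℝ j g := (φ.smooth j).comp (contDiff_const.add contDiff_id)
  have e : (fun y => φ (x0, y)) = g ∘ ContinuousLinearMap.inr ℝ ℝ V := by
    ext y; simp [hg]
  rw [e, (ContinuousLinearMap.inr ℝ ℝ V).iteratedFDeriv_comp_right hgs y le_rfl]
  refine (ContinuousMultilinearMap.norm_compContinuousLinearMap_le _ _).trans ?_
  have h1 : iteratedFDeriv ℝ j g ((ContinuousLinearMap.inr ℝ ℝ V) y) =
      iteratedFDeriv ℝ j φ (x0, y) := by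
    rw [hg, iteratedFDeriv_comp_add_left]; simp
  rw [h1]
  refine mul_le_of_le_one_right (norm_nonneg _) (Finset.prod_le_one (fun _ _ => norm_nonneg _)
    fun _ _ => ContinuousLinearMap.norm_inr_le_one ℝ ℝ V)

theorem norm_iteratedFDeriv_le_decay (φ : 𝓢(ℝ × V, ℂ)) (M : ℕ) {j N : ℕ} (hj : j ≤ N)
    (x0 : ℝ) (y : V) :
    ‖iteratedFDeriv ℝ j φ (x0, y)‖ ≤ 2 ^ (2 + M) * (Finset.Iic (2 + M, N)).sup
      (schwartzSeminormFamily ℂ (ℝ × V) ℂ) φ * (((1 + |x0|) ^ 2)⁻¹ * ((1 + ‖y‖) ^ M)⁻¹) := by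
  have h := SchwartzMap.one_add_le_sup_seminorm_apply (𝕜 := ℂ) (m := (2 + M, N)) (k := 2 + M)
    (n := j) le_rfl hj φ (x0, y)
  have h1 : (1 + |x0|) ^ 2 * (1 + ‖y‖) ^ M ≤ (1 + ‖((x0, y) : ℝ × V)‖) ^ (2 + M) := by
    rw [pow_add]
    gcongr
    · exact norm_fst_le (x0, y)
    · exact norm_snd_le (x0, y)
  rw [← mul_inv, ← div_eq_mul_inv, le_div_iff₀ (by positivity), mul_comm]
  refine le_trans ?_ h
  gcongr

theorem integrable_norm_iteratedFDeriv_slice (φ : 𝓢(ℝ × V, ℂ)) (j : ℕ) (x0 : ℝ) :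
    Integrable fun y => ‖iteratedFDeriv ℝ j (fun y => φ (x0, y)) y‖ := by
  have hs : ContDiff ℝ j (fun y => φ (x0, y)) :=
    (φ.smooth j).comp (contDiff_const.prodMk contDiff_id)
  refine Integrable.mono' (((integrable_one_add_norm_pow_inv volume
    (Nat.lt_succ_self (Module.finrank ℝ V))).const_mul (((1 + |x0|) ^ 2)⁻¹)).const_mul
    (2 ^ (2 + (Module.finrank ℝ V + 1)) * (Finset.Iic (2 + (Module.finrank ℝ V + 1), j)).sup
      (schwartzSeminormFamily ℂ (ℝ × V) ℂ) φ))
    (hs.continuous_iteratedFDeriv le_rfl).norm.aestronglyMeasurable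
    (Eventually.of_forall fun y => ?_)
  rw [norm_norm]
  exact (norm_iteratedFDeriv_slice_le φ j x0 y).trans (norm_iteratedFDeriv_le_decay φ _ le_rfl x0 y)

theorem integrable_slice (φ : 𝓢(ℝ × V, ℂ)) (x0 : ℝ) : Integrable fun y => φ (x0, y) := by
  have h := integrable_norm_iteratedFDeriv_slice φ 0 x0
  simp only [norm_iteratedFDeriv_zero] at h
  exact (integrable_norm_iff
    (φ.continuous.comp (by fun_prop : Continuous fun y : V => (x0, y))).aestronglyMeasurable).1 h

/-- Derivatives in space give decay of order N in q, and Schwartz decay gives order 2 in time. The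
bound is by seminorms of φ, so that it yields the continuity of kernel distributions as well as
integrability. -/
theorem exists_norm_spatialFourier_le (N : ℕ) : ∃ C : ℝ, 0 ≤ C ∧ ∃ s : Finset (ℕ × ℕ),
    ∀ (φ : 𝓢(ℝ × V, ℂ)) (p : ℝ × V), ‖spatialFourier φ p‖ ≤
      C * s.sup (schwartzSeminormFamily ℂ (ℝ × V) ℂ) φ * decayWeight N p := by
  set M := Module.finrank ℝ V + 1 with hM
  set J := ∫ y : V, ((1 + ‖y‖) ^ M)⁻¹ with hJ
  have hJint : Integrable fun y : V => ((1 + ‖y‖) ^ M)⁻¹ :=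
    integrable_one_add_norm_pow_inv volume (Nat.lt_succ_self _)
  have hJ0 : 0 ≤ J := integral_nonneg fun y => by positivity
  refine ⟨2 ^ N * (1 + (2 * Real.pi) ^ N * 2 ^ N * (N + 1)) * (2 ^ (2 + M) * J), by positivity,
    Finset.Iic (2 + M, N), fun φ p => ?_⟩
  obtain ⟨x0, q⟩ := p
  set S := (Finset.Iic (2 + M, N)).sup (schwartzSeminormFamily ℂ (ℝ × V) ℂ) φ with hS
  have hS0 : 0 ≤ S := apply_nonneg _ _
  set f : V → ℂ := fun y => φ (x0, y) with hf
  have hfs : ContDiff ℝ N f := (φ.smooth N).comp (contDiff_const.prodMk contDiff_id)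
  set K := 2 ^ (2 + M) * S * ((1 + |x0|) ^ 2)⁻¹ * J with hK
  have hK0 : 0 ≤ K := by positivity
  have hder : ∀ j ≤ N, ∫ y, ‖iteratedFDeriv ℝ j f y‖ ≤ K := by
    intro j hj
    have : K = ∫ y : V, 2 ^ (2 + M) * S * (((1 + |x0|) ^ 2)⁻¹ * ((1 + ‖y‖) ^ M)⁻¹) := by
      rw [integral_const_mul, integral_const_mul, hK]; ring
    rw [this]
    refine integral_mono (integrable_norm_iteratedFDeriv_slice φ j x0)
      ((hJint.const_mul _).const_mul _) fun y => ?_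
    exact (norm_iteratedFDeriv_slice_le φ j x0 y).trans (norm_iteratedFDeriv_le_decay φ M hj x0 y)
  -- The Fourier transform of the library has phase -2πi⟨y, w⟩, so the phase +i⟨q, y⟩ corresponds to
  -- w = -q/(2π).
  set w : V := -((2 * Real.pi)⁻¹ : ℝ) • q with hw
  have hfour : spatialFourier φ (x0, q) = FourierTransform.fourier f w := by
    rw [Real.fourier_eq']
    refine integral_congr_ae (Eventually.of_forall fun y => ?_)
    simp only [smul_eq_mul]
    congr 2
    rw [hw, inner_smul_right, real_inner_comm]
    push_cast
    have : (Real.pi : ℂ) ≠ 0 := by exact_mod_cast Real.pi_ne_zero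
    field_simp
  have h0 : ‖spatialFourier φ (x0, q)‖ ≤ K := by
    refine (norm_integral_le_integral_norm _).trans (le_trans (le_of_eq ?_) (hder 0 (Nat.zero_le _)))
    refine integral_congr_ae (Eventually.of_forall fun y => ?_)
    simp only [norm_mul, norm_exp_I_mul_ofReal, one_mul, norm_iteratedFDeriv_zero]
    rfl
  have hN : ‖q‖ ^ N * ‖spatialFourier φ (x0, q)‖ ≤ (2 * Real.pi) ^ N * (2 ^ N * ((N + 1) * K)) := by
    have h1 := Real.pow_mul_norm_iteratedFDeriv_fourier_le (f := f) (K := 0) (N := N) hfs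
      (fun k n hk hn => by
        obtain rfl : k = 0 := by simpa using hk
        simpa using integrable_norm_iteratedFDeriv_slice φ n x0)
      (k := 0) (n := N) le_rfl le_rfl w
    rw [norm_iteratedFDeriv_zero, ← hfour] at h1
    have h2 : ∑ p ∈ Finset.range (0 + 1) ×ˢ Finset.range (N + 1),
        ∫ v, ‖v‖ ^ p.1 * ‖iteratedFDeriv ℝ p.2 f v‖ ≤ (N + 1) * K := by
      rw [Finset.sum_product]
      simp only [zero_add, Finset.range_one, Finset.sum_singleton, pow_zero, one_mul]
      refine (Finset.sum_le_card_nsmul _ _ K fun j hj => hder j ?_).trans ?_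
      · exact Nat.lt_succ_iff.1 (Finset.mem_range.1 hj)
      · simp
    have h3 : ‖q‖ = 2 * Real.pi * ‖w‖ := by
      rw [hw, norm_smul, norm_neg, Real.norm_of_nonneg (by positivity)]
      field_simp
    rw [h3, mul_pow, mul_assoc]
    refine mul_le_mul_of_nonneg_left (h1.trans ?_) (by positivity)
    simp only [pow_zero, one_mul, Nat.cast_zero, mul_zero, zero_add]
    gcongr
  have hbin : (1 + ‖q‖) ^ N ≤ 2 ^ N * (1 + ‖q‖ ^ N) := by
    rcases le_total ‖q‖ 1 with h | h
    · calc (1 + ‖q‖) ^ N ≤ 2 ^ N := by gcongr; linarith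
        _ ≤ _ := le_mul_of_one_le_right (by positivity) (by simp)
    · calc (1 + ‖q‖) ^ N ≤ (2 * ‖q‖) ^ N := by gcongr; linarith
        _ ≤ _ := by rw [mul_pow]; gcongr; linarith
  have hfin : (1 + ‖q‖) ^ N * ‖spatialFourier φ (x0, q)‖ ≤
      2 ^ N * (1 + (2 * Real.pi) ^ N * 2 ^ N * (N + 1)) * K := by
    calc _ ≤ 2 ^ N * (1 + ‖q‖ ^ N) * ‖spatialFourier φ (x0, q)‖ := by gcongr
      _ = 2 ^ N * (‖spatialFourier φ (x0, q)‖ + ‖q‖ ^ N * ‖spatialFourier φ (x0, q)‖) := by ring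
      _ ≤ 2 ^ N * (K + (2 * Real.pi) ^ N * (2 ^ N * ((N + 1) * K))) := by gcongr
      _ = _ := by ring
  rw [decayWeight, ← mul_assoc, ← div_eq_mul_inv, le_div_iff₀ (by positivity), mul_comm]
  refine hfin.trans (le_of_eq ?_)
  rw [hK]
  ring

theorem continuous_spatialFourier (φ : 𝓢(ℝ × V, ℂ)) : Continuous (spatialFourier φ) := by
  have hφ : Continuous φ := φ.continuous
  refine continuous_of_dominated (bound := fun y => 2 ^ (2 + (Module.finrank ℝ V + 1)) *
    (Finset.Iic (2 + (Module.finrank ℝ V + 1), 0)).sup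
      (schwartzSeminormFamily ℂ (ℝ × V) ℂ) φ * ((1 + ‖y‖) ^ (Module.finrank ℝ V + 1))⁻¹) ?_ ?_ ?_ ?_
  · intro p
    exact Continuous.aestronglyMeasurable (by fun_prop)
  · intro p
    refine Eventually.of_forall fun y => ?_
    rw [norm_mul, norm_exp_I_mul_ofReal, one_mul, ← norm_iteratedFDeriv_zero (𝕜 := ℝ)]
    refine (norm_iteratedFDeriv_le_decay φ (Module.finrank ℝ V + 1) le_rfl p.1 y).trans ?_
    refine mul_le_mul_of_nonneg_left (mul_le_of_le_one_left (by positivity) ?_)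
      (mul_nonneg (by positivity) (apply_nonneg _ _))
    exact inv_le_one_of_one_le₀ (one_le_pow₀ (by linarith [abs_nonneg p.1]))
  · exact (integrable_one_add_norm_pow_inv volume (Nat.lt_succ_self _)).const_mul _
  · refine Eventually.of_forall fun y => ?_
    fun_prop

theorem integrable_kernel_mul {K : ℝ × V → ℂ} (hK : AEStronglyMeasurable K) {N : ℕ}
    (hint : Integrable fun p => ‖K p‖ * decayWeight N p) (φ : 𝓢(ℝ × V, ℂ)) :
    Integrable fun p => K p * spatialFourier φ p := by
  obtain ⟨C, hC, s, h⟩ := exists_norm_spatialFourier_le (V := V) N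
  refine (hint.const_mul (C * s.sup (schwartzSeminormFamily ℂ (ℝ × V) ℂ) φ)).mono'
    (hK.mul (continuous_spatialFourier φ).aestronglyMeasurable) (Eventually.of_forall fun p => ?_)
  rw [norm_mul]
  calc _ ≤ ‖K p‖ * (C * s.sup (schwartzSeminormFamily ℂ (ℝ × V) ℂ) φ * decayWeight N p) := by
        gcongr; exact h φ p
    _ = _ := by ring

theorem spatialFourier_add (φ χ : 𝓢(ℝ × V, ℂ)) (p : ℝ × V) :
    spatialFourier (φ + χ) p = spatialFourier φ p + spatialFourier χ p := by
  have hi : ∀ φ : 𝓢(ℝ × V, ℂ), Integrable fun y =>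
      Complex.exp (Complex.I * (inner ℝ p.2 y : ℝ)) * φ (p.1, y) := fun φ => by
    refine (integrable_slice φ p.1).norm.mono' ?_ (Eventually.of_forall fun y => ?_)
    · exact (Continuous.aestronglyMeasurable (by fun_prop)).mul (integrable_slice φ p.1).1
    · rw [norm_mul, norm_exp_I_mul_ofReal, one_mul]
  unfold spatialFourier innerFourier
  rw [← integral_add (hi φ) (hi χ)]
  refine integral_congr_ae (Eventually.of_forall fun y => ?_)
  simp [mul_add]

theorem spatialFourier_smul (c : ℂ) (φ : 𝓢(ℝ × V, ℂ)) (p : ℝ × V) :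
    spatialFourier (c • φ) p = c * spatialFourier φ p := by
  unfold spatialFourier innerFourier
  rw [← integral_const_mul]
  refine integral_congr_ae (Eventually.of_forall fun y => ?_)
  simp [mul_left_comm]

/-- A kernel defines a tempered distribution through the spatial Fourier transform. -/
theorem exists_kernel_distribution {K : ℝ × V → ℂ} (hK : AEStronglyMeasurable K) {N : ℕ}
    (hint : Integrable fun p => ‖K p‖ * decayWeight N p) :
    ∃ T : 𝓢'(ℝ × V, ℂ), ∀ φ, T φ = ∫ p, K p * spatialFourier φ p := by
  obtain ⟨C, hC, s, h⟩ := exists_norm_spatialFourier_le (V := V) N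
  refine ⟨ContinuousLinearMap.toPointwiseConvergenceCLM _ _ _ _
    (SchwartzMap.mkCLMtoNormedSpace (𝕜 := ℂ) (σ := RingHom.id ℂ)
      (fun φ : 𝓢(ℝ × V, ℂ) => ∫ p, K p * spatialFourier φ p) ?_ ?_ ?_), fun φ => rfl⟩
  · intro φ χ
    rw [← integral_add (integrable_kernel_mul hK hint φ) (integrable_kernel_mul hK hint χ)]
    simp_rw [spatialFourier_add, mul_add]
  · intro c φ
    simp_rw [spatialFourier_smul, mul_left_comm, integral_const_mul]
    rfl
  · refine ⟨s, C * ∫ p : ℝ × V, ‖K p‖ * decayWeight N p, mul_nonneg hC (integral_nonneg fun p =>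
      mul_nonneg (norm_nonneg _) (decayWeight_nonneg N p)), fun φ => ?_⟩
    have h1 := norm_integral_le_of_norm_le
      (hint.const_mul (C * s.sup (schwartzSeminormFamily ℂ (ℝ × V) ℂ) φ))
      (f := fun p => K p * spatialFourier φ p) (Eventually.of_forall fun p => by
        rw [norm_mul]
        calc _ ≤ ‖K p‖ * (C * s.sup (schwartzSeminormFamily ℂ (ℝ × V) ℂ) φ * decayWeight N p) := by
              gcongr; exact h φ p
          _ = _ := by ring)
    rw [integral_const_mul] at h1
    refine h1.trans (le_of_eq (by ring))

theorem integrable_innerFourier_slice (φ : 𝓢(ℝ × V, ℂ)) (x0 : ℝ) :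
    Integrable (innerFourier fun y => φ (x0, y)) := by
  obtain ⟨C, hC, s, h⟩ := exists_norm_spatialFourier_le (V := V) (Module.finrank ℝ V + 1)
  refine Integrable.mono' (((integrable_one_add_norm_pow_inv volume
    (Nat.lt_succ_self (Module.finrank ℝ V))).const_mul (((1 + |x0|) ^ 2)⁻¹)).const_mul
    (C * s.sup (schwartzSeminormFamily ℂ (ℝ × V) ℂ) φ))
    ((continuous_spatialFourier φ).comp
      (by fun_prop : Continuous fun q : V => (x0, q))).aestronglyMeasurable
    (Eventually.of_forall fun q => h φ (x0, q))

/-- Distributional limits from pointwise limits of kernels. -/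
theorem tendsto_integral_of_kernel {f : ℝ → ℝ × V → ℂ} {Kε : ℝ → ℝ × V → ℂ} {K : ℝ × V → ℂ}
    {G : ℝ × V → ℝ} {N : ℕ} (φ : 𝓢(ℝ × V, ℂ))
    (hf : ∀ ε, 0 < ε → Integrable fun x => f ε x * φ x)
    (hslice : ∀ ε, 0 < ε → ∀ᵐ x0 : ℝ, ∫ y, f ε (x0, y) * φ (x0, y) =
      ∫ q, Kε ε (x0, q) * spatialFourier φ (x0, q))
    (hKm : ∀ ε, 0 < ε → AEStronglyMeasurable (Kε ε))
    (hKG : ∀ ε, 0 < ε → ∀ᵐ p, ‖Kε ε p‖ ≤ G p)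
    (hG : Integrable fun p => G p * decayWeight N p)
    (hlim : ∀ᵐ p, Tendsto (fun ε => Kε ε p) (𝓝[>] 0) (𝓝 (K p))) :
    Tendsto (fun ε => ∫ x, f ε x * φ x) (𝓝[>] 0) (𝓝 (∫ p, K p * spatialFourier φ p)) := by
  obtain ⟨C, hC, s, h⟩ := exists_norm_spatialFourier_le (V := V) N
  set S := s.sup (schwartzSeminormFamily ℂ (ℝ × V) ℂ) φ with hS
  have hS0 : 0 ≤ S := apply_nonneg _ _
  have hbound : ∀ ε, 0 < ε → ∀ᵐ p, ‖Kε ε p * spatialFourier φ p‖ ≤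
      C * S * (G p * decayWeight N p) := by
    intro ε hε
    filter_upwards [hKG ε hε] with p hp
    rw [norm_mul]
    calc _ ≤ G p * (C * S * decayWeight N p) := by
          have : 0 ≤ G p := (norm_nonneg _).trans hp
          gcongr
          exact h φ p
      _ = _ := by ring
  have hmeas : ∀ ε, 0 < ε → AEStronglyMeasurable (fun p => Kε ε p * spatialFourier φ p) :=
    fun ε hε => (hKm ε hε).mul (continuous_spatialFourier φ).aestronglyMeasurable
  have hint : ∀ ε, 0 < ε → Integrable (fun p => Kε ε p * spatialFourier φ p) :=
    fun ε hε => (hG.const_mul _).mono' (hmeas ε hε) (hbound ε hε)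
  have heq : ∀ ε, 0 < ε → ∫ x, f ε x * φ x = ∫ p, Kε ε p * spatialFourier φ p := by
    intro ε hε
    rw [Measure.volume_eq_prod, integral_prod _ (hf ε hε), integral_prod _ (hint ε hε)]
    exact integral_congr_ae (hslice ε hε)
  have := tendsto_integral_filter_of_dominated_convergence (l := 𝓝[>] (0 : ℝ)) (μ := volume)
    (F := fun ε p => Kε ε p * spatialFourier φ p) (f := fun p => K p * spatialFourier φ p)
    (fun p => C * S * (G p * decayWeight N p))
    (by filter_upwards [self_mem_nhdsWithin] with ε hε using hmeas ε hε)
    (by filter_upwards [self_mem_nhdsWithin] with ε hε using hbound ε hε) (hG.const_mul _)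
    (by filter_upwards [hlim] with p hp using hp.mul_const _)
  refine this.congr' ?_
  filter_upwards [self_mem_nhdsWithin] with ε hε
  exact (heq ε hε).symm

end Kernel

/-- Limits of complex numbers are unique, so the chosen distribution agrees with any explicitly
constructed one. -/
theorem boundaryValue_eq {d : ℕ} {f : ℝ → Mink d → ℂ} {T : 𝓢'(Mink d, ℂ)}
    (hT : IsBoundaryValue f T) : boundaryValue f = T := by
  have h : HasBoundaryValue f := ⟨T, hT⟩
  rw [boundaryValue, dif_pos h]
  ext φ
  exact tendsto_nhds_unique (h.choose_spec.2 φ) (hT.2 φ)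

/-! ### Volumes of graphs and growth estimates -/

theorem integrable_mul_schwartz_of_growth {E : Type*} [NormedAddCommGroup E] [NormedSpace ℝ E]
    [MeasurableSpace E] [BorelSpace E] [SecondCountableTopology E] {μ : Measure E}
    [μ.HasTemperateGrowth] {g : E → ℂ} (hg : AEStronglyMeasurable g μ) {C : ℝ} {k : ℕ}
    (h : ∀ᵐ x ∂μ, ‖g x‖ ≤ C * (1 + ‖x‖) ^ k) (φ : 𝓢(E, ℂ)) :
    Integrable (fun x => g x * φ x) μ := by
  have h0 := φ.integrable_pow_mul μ 0
  have hk := φ.integrable_pow_mul μ k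
  refine ((h0.add hk).const_mul (|C| * 2 ^ k)).mono'
    (hg.mul φ.continuous.aestronglyMeasurable) ?_
  filter_upwards [h] with x hx
  have hbin : (1 + ‖x‖) ^ k ≤ 2 ^ k * (1 + ‖x‖ ^ k) := by
    rcases le_total ‖x‖ 1 with h | h
    · calc (1 + ‖x‖) ^ k ≤ 2 ^ k := by gcongr; linarith
        _ ≤ _ := le_mul_of_one_le_right (by positivity) (by simp)
    · calc (1 + ‖x‖) ^ k ≤ (2 * ‖x‖) ^ k := by gcongr; linarith
        _ ≤ _ := by rw [mul_pow]; gcongr; linarith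
  rw [norm_mul]
  calc ‖g x‖ * ‖φ x‖ ≤ |C| * (2 ^ k * (1 + ‖x‖ ^ k)) * ‖φ x‖ := by
        gcongr
        refine hx.trans ?_
        gcongr
        exact le_abs_self C
    _ = _ := by simp only [Pi.add_apply, pow_zero]; ring

theorem measurable_besselU (α : ℂ) : Measurable (besselU α) := by
  have h : StronglyMeasurable (Function.uncurry fun (z : ℂ) (s : ℝ) =>
      Complex.exp (-(z ^ (1 / 2 : ℂ)) * ((s : ℂ) + (s : ℂ)⁻¹)) * (s : ℂ) ^ (-α - 1)) := by
    refine Measurable.stronglyMeasurable ?_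
    unfold Function.uncurry
    fun_prop
  unfold besselU
  exact ((measurable_id.pow_const _).const_mul _).mul
    (h.integral_prod_right (ν := volume.restrict (Set.Ioi (0 : ℝ)))).measurable

instance isAddHaarMeasure_volume_mink {d : ℕ} :
    (volume : Measure (Mink d)).IsAddHaarMeasure := by
  rw [Measure.volume_eq_prod]; infer_instance

theorem continuous_msq {d : ℕ} : Continuous fun x : Mink d => msq x := by
  unfold msq mdot; fun_prop

theorem msq_eq {d : ℕ} (x : Mink d) : msq x = -x.1 ^ 2 + ‖x.2‖ ^ 2 := by
  rw [msq, mdot, real_inner_self_eq_norm_sq]; ring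

theorem continuous_fourierIntegral {d : ℕ} (φ : 𝓢(Mink d, ℂ)) :
    Continuous fun p : Mink d => ∫ x, Complex.exp (Complex.I * (mdot p x : ℝ)) * φ x := by
  have hφ : Continuous φ := φ.continuous
  have h2 : ∀ p : Mink d, Continuous fun x : Mink d => mdot p x := fun p => by unfold mdot; fun_prop
  have h3 : ∀ x : Mink d, Continuous fun p : Mink d => mdot p x := fun p => by unfold mdot; fun_prop
  refine continuous_of_dominated (bound := fun x => ‖φ x‖) (fun p => ?_) (fun p => ?_)
    φ.integrable.norm (Eventually.of_forall fun x => ?_)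
  · have := h2 p
    exact Continuous.aestronglyMeasurable (by fun_prop)
  · refine Eventually.of_forall fun y => ?_
    rw [norm_mul, norm_exp_I_mul_ofReal, one_mul]
  · have := h3 x
    fun_prop

theorem fourierIntegral_eq_time_integral {d : ℕ} (φ : 𝓢(Mink d, ℂ)) (p : Mink d) :
    ∫ x, Complex.exp (Complex.I * (mdot p x : ℝ)) * φ x =
      ∫ t : ℝ, Complex.exp (-Complex.I * (p.1 * t : ℝ)) * spatialFourier φ (t, p.2) := by
  have h2 : Continuous fun x : Mink d => mdot p x := by unfold mdot; fun_prop
  have hi : Integrable fun x : Mink d => Complex.exp (Complex.I * (mdot p x : ℝ)) * φ x := by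
    refine φ.integrable.norm.mono' ?_ (Eventually.of_forall fun y => ?_)
    · have hφ : Continuous φ := φ.continuous
      exact Continuous.aestronglyMeasurable (by fun_prop)
    · rw [norm_mul, norm_exp_I_mul_ofReal, one_mul]
  rw [Measure.volume_eq_prod, integral_prod _ hi]
  refine integral_congr_ae (Eventually.of_forall fun t => ?_)
  simp only [spatialFourier, innerFourier]
  rw [← integral_const_mul]
  refine integral_congr_ae (Eventually.of_forall fun y => ?_)
  simp only [mdot]
  rw [← mul_assoc, ← Complex.exp_add]
  congr 2
  push_cast
  ring

/-- The Fourier transform of the volume measure of a graph. -/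
theorem graphVolume_fourier {d : ℕ} {h : EuclideanSpace ℝ (Fin (d - 1)) → ℝ}
    {D : Set (EuclideanSpace ℝ (Fin (d - 1)))} {ρ : EuclideanSpace ℝ (Fin (d - 1)) → ℝ} {N : ℕ}
    (hD : MeasurableSet D) (hh : Continuous h) (hρm : Measurable ρ) (hρ0 : ∀ q, 0 ≤ ρ q)
    (hρ : ∀ q ∈ D, Real.sqrt |(graphMetric h q).det| = ρ q)
    (hint : Integrable fun q => D.indicator ρ q * ((1 + ‖q‖) ^ N)⁻¹) (φ : 𝓢(Mink d, ℂ)) :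
    Integrable (fun p => ∫ x, Complex.exp (Complex.I * (mdot p x : ℝ)) * φ x) (graphVolume h D) ∧
      ∫ p, (∫ x, Complex.exp (Complex.I * (mdot p x : ℝ)) * φ x) ∂(graphVolume h D) =
        ∫ p : Mink d, D.indicator (fun q => (ρ q : ℂ) * Complex.exp (-Complex.I * (h q * p.1 : ℝ)))
          p.2 * spatialFourier φ p := by
  set F : Mink d → ℂ := fun p => ∫ x, Complex.exp (Complex.I * (mdot p x : ℝ)) * φ x with hF
  have hFc : Continuous F := continuous_fourierIntegral φ
  have hg : Measurable fun q : EuclideanSpace ℝ (Fin (d - 1)) => (h q, q) :=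
    (hh.prodMk continuous_id).measurable
  -- The metric density is needed only on D, where it equals the measurable function ρ; it can
  -- therefore be replaced without studying the determinant elsewhere.
  have hgv : graphVolume h D = ((volume.restrict D).withDensity
      fun q => ((ρ q).toNNReal : ENNReal)).map fun q => (h q, q) := by
    rw [graphVolume]
    congr 1
    refine withDensity_congr_ae ?_
    filter_upwards [ae_restrict_mem hD] with q hq
    rw [hρ q hq]; rfl
  set K : Mink d → ℂ := fun p => D.indicator
    (fun q => (ρ q : ℂ) * Complex.exp (-Complex.I * (h q * p.1 : ℝ))) p.2 with hK
  have hKeq : K = (Prod.snd ⁻¹' D).indicator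
      (fun p : Mink d => (ρ p.2 : ℂ) * Complex.exp (-Complex.I * (h p.2 * p.1 : ℝ))) := by
    ext p
    simp only [hK, Set.indicator, Set.mem_preimage]
    rfl
  have hKm : Measurable K := by
    rw [hKeq]
    refine Measurable.indicator ?_ (measurable_snd hD)
    have := hh.measurable
    fun_prop
  have hKn : ∀ p, ‖K p‖ = D.indicator ρ p.2 := by
    intro p
    simp only [hK, Set.indicator]
    split_ifs
    · rw [norm_mul, Complex.norm_real, Real.norm_of_nonneg (hρ0 _), Complex.norm_exp]
      simp
    · simp
  have hKint : Integrable fun p : Mink d => ‖K p‖ * decayWeight N p := by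
    refine (integrable_time_decay.mul_prod hint).congr (Eventually.of_forall fun p => ?_)
    simp only [hKn, decayWeight]
    ring
  have hprod := integrable_kernel_mul hKm.aestronglyMeasurable hKint φ
  have hpt : ∀ q ∈ D, (ρ q).toNNReal • F (h q, q) = ∫ t : ℝ, K (t, q) * spatialFourier φ (t, q) := by
    intro q hq
    rw [hF]
    simp only
    rw [fourierIntegral_eq_time_integral, NNReal.smul_def, Real.coe_toNNReal _ (hρ0 q),
      Complex.real_smul, ← integral_const_mul]
    refine integral_congr_ae (Eventually.of_forall fun t => ?_)
    simp only [hK, Set.indicator_of_mem hq]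
    ring
  have hswap : Integrable fun q => ∫ t : ℝ, K (t, q) * spatialFourier φ (t, q) := by
    rw [Measure.volume_eq_prod] at hprod
    exact hprod.integral_prod_right
  have hρn : Measurable fun q => (ρ q).toNNReal := hρm.real_toNNReal
  rw [hgv]
  constructor
  · rw [integrable_map_measure hFc.aestronglyMeasurable hg.aemeasurable,
      integrable_withDensity_iff_integrable_smul hρn]
    refine (hswap.restrict (s := D)).congr ?_
    filter_upwards [ae_restrict_mem hD] with q hq
    exact (hpt q hq).symm
  · rw [integral_map hg.aemeasurable hFc.aestronglyMeasurable,
      integral_withDensity_eq_integral_smul hρn, setIntegral_congr_fun hD hpt]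
    have h1 : ∫ p, K p * spatialFourier φ p = ∫ q, ∫ t : ℝ, K (t, q) * spatialFourier φ (t, q) := by
      rw [Measure.volume_eq_prod] at hprod ⊢
      exact integral_prod_symm _ hprod
    rw [h1]
    refine setIntegral_eq_integral_of_forall_compl_eq_zero fun q hq => ?_
    simp only [hK, Set.indicator_of_notMem hq, zero_mul, integral_zero]

/-- The induced metric is the identity minus the rank-one matrix of products of partial derivatives
of h, so the matrix determinant lemma applies. A radial h has gradient κq. -/
theorem det_graphMetric {d : ℕ} {h : EuclideanSpace ℝ (Fin (d - 1)) → ℝ}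
    {q : EuclideanSpace ℝ (Fin (d - 1))} {κ : ℝ}
    (hh : HasFDerivAt h (κ • innerSL ℝ q) q) :
    (graphMetric h q).det = 1 - κ ^ 2 * ‖q‖ ^ 2 := by
  have h1 : graphMetric h q = 1 + Matrix.replicateCol Unit (fun i => -(κ * q i)) *
      Matrix.replicateRow Unit (fun i => κ * q i) := by
    ext i j
    simp only [graphMetric, graphTangent, mdot, Matrix.of_apply, Matrix.add_apply, hh.fderiv,
      Matrix.one_apply, Matrix.mul_apply, Matrix.replicateCol_apply, Matrix.replicateRow_apply]
    simp [PiLp.inner_apply]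
    rcases eq_or_ne i j with rfl | hij
    · simp; ring
    · simp [hij]
  rw [h1, Matrix.det_one_add_replicateCol_mul_replicateRow, EuclideanSpace.norm_sq_eq]
  simp only [dotProduct, Real.norm_eq_abs, sq_abs, Finset.mul_sum]
  rw [sub_eq_add_neg, ← Finset.sum_neg_distrib]
  congr 1
  refine Finset.sum_congr rfl fun i _ => by ring

/-- Here κ² = 1/(|q|² + c), hence the determinant is c/(|q|² + c). The values c = m² and c = -m²
give the two kinds of hyperboloid. -/
theorem sqrt_abs_det_graphMetric {d : ℕ} {c s : ℝ} (hs : s ^ 2 = 1)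
    {q : EuclideanSpace ℝ (Fin (d - 1))} (hq : 0 < ‖q‖ ^ 2 + c) :
    Real.sqrt |(graphMetric (fun q => s * Real.sqrt (‖q‖ ^ 2 + c)) q).det| =
      Real.sqrt |c| / Real.sqrt (‖q‖ ^ 2 + c) := by
  have h1 : HasFDerivAt (fun q : EuclideanSpace ℝ (Fin (d - 1)) => s * Real.sqrt (‖q‖ ^ 2 + c))
      ((s / Real.sqrt (‖q‖ ^ 2 + c)) • innerSL ℝ q) q := by
    have h2 := (((hasStrictFDerivAt_norm_sq q).hasFDerivAt.add_const c).sqrt hq.ne').const_mul s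
    refine h2.congr_fderiv ?_
    ext v
    simp
    field_simp
  rw [det_graphMetric h1, div_pow, hs, Real.sq_sqrt hq.le, ← Real.sqrt_div (abs_nonneg c)]
  congr 1
  rw [show 1 - 1 / (‖q‖ ^ 2 + c) * ‖q‖ ^ 2 = c / (‖q‖ ^ 2 + c) by field_simp; ring, abs_div,
    abs_of_pos hq]

/-! ### The two-sheeted hyperboloid -/

theorem cpow_half_eq {z v : ℂ} (hv : 0 < v.re) (h : v * v = z) : z ^ (1 / 2 : ℂ) = v := by
  rw [← h, ← sq, one_div]
  exact Complex.sq_cpow_two_inv hv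

/-- The root of -z lies in the right half-plane, and the sign of Im z decides whether multiplication
by i or by -i returns it there. This fixes the branch when an argument approaches the cut. -/
theorem cpow_half_eq_neg {z : ℂ} {s : ℝ} (hs : s ^ 2 = 1) (hz : 0 < s * z.im) :
    z ^ (1 / 2 : ℂ) = Complex.I * s * (-z) ^ (1 / 2 : ℂ) := by
  have him : z.im ≠ 0 := fun h => by simp [h] at hz
  have hm : -z ∈ Complex.slitPlane := Or.inr (by simpa using him)
  set v := (-z) ^ (1 / 2 : ℂ) with hv
  have h1 : v * v = -z := cpow_half_mul_self
  have h2 : 0 < v.re := re_cpow_half_pos hm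
  have h3 : 2 * (v.re * v.im) = -z.im := by
    have := congrArg Complex.im h1
    simp only [Complex.mul_im, Complex.neg_im] at this
    linarith
  refine cpow_half_eq ?_ ?_
  · have e : (Complex.I * s * v).re = -(s * v.im) := by simp
    rw [e]
    have : 0 < v.re * (-(s * v.im)) := by
      rw [show v.re * (-(s * v.im)) = s * z.im / 2 by linear_combination (-s / 2) * h3]
      positivity
    exact (pos_iff_pos_of_mul_pos this).1 h2
  · have hs' : (s : ℂ) ^ 2 = 1 := by exact_mod_cast hs
    linear_combination (Complex.I ^ 2 * s ^ 2) * h1 - z * Complex.I ^ 2 * hs' - z * Complex.I_sq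

theorem ae_of_ae_fst {V : Type*} [NormedAddCommGroup V] [InnerProductSpace ℝ V]
    [FiniteDimensional ℝ V] [MeasurableSpace V] [BorelSpace V] {P : ℝ → Prop} (h : ∀ᵐ t : ℝ, P t) :
    ∀ᵐ p : ℝ × V, P p.1 := by
  rw [Measure.volume_eq_prod]
  exact Measure.quasiMeasurePreserving_fst.ae h

theorem ae_of_ae_snd {V : Type*} [NormedAddCommGroup V] [InnerProductSpace ℝ V]
    [FiniteDimensional ℝ V] [MeasurableSpace V] [BorelSpace V] {P : V → Prop} (h : ∀ᵐ q : V, P q) :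
    ∀ᵐ p : ℝ × V, P p.2 := by
  rw [Measure.volume_eq_prod]
  exact Measure.quasiMeasurePreserving_snd.ae h

theorem ae_ne_zero : ∀ᵐ t : ℝ, t ≠ 0 := by
  rw [ae_iff]; simp

theorem abs_msq_le {d : ℕ} (x : Mink d) : |msq x| ≤ 2 * ‖x‖ ^ 2 := by
  rw [msq_eq]
  have h1 : |x.1| ≤ ‖x‖ := norm_fst_le x
  have h2 : ‖x.2‖ ≤ ‖x‖ := norm_snd_le x
  have h3 : x.1 ^ 2 ≤ ‖x‖ ^ 2 := by rw [← sq_abs]; gcongr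
  have h4 : ‖x.2‖ ^ 2 ≤ ‖x‖ ^ 2 := by gcongr
  rw [abs_le]
  constructor <;> nlinarith [sq_nonneg x.1, sq_nonneg ‖x.2‖]

theorem integrable_besselU_mul {d : ℕ} (α : ℝ) {z : Mink d → ℂ} (hz : Measurable z) {c C : ℝ}
    {k : ℕ} (hc : 0 < c) (him : ∀ᵐ x, |(z x).im| = c) (hC : ∀ x, ‖z x‖ ≤ C * (1 + ‖x‖) ^ k)
    (φ : 𝓢(Mink d, ℂ)) : Integrable fun x => besselU α (z x) * φ x := by
  obtain ⟨N, M, hM, h⟩ := exists_norm_besselU_le α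
  refine integrable_mul_schwartz_of_growth (C := M * (1 + |C|) ^ N / c ^ N) (k := k * N)
    ((measurable_besselU α).comp hz).aestronglyMeasurable ?_ φ
  filter_upwards [him] with x hx
  have h0 : (z x).im ≠ 0 := fun h0 => by rw [h0] at hx; simp at hx; linarith
  refine (h _ h0).trans ?_
  rw [hx, div_mul_eq_mul_div, mul_assoc, pow_mul, ← mul_pow]
  have : 1 + ‖z x‖ ≤ (1 + |C|) * (1 + ‖x‖) ^ k := by
    have h1 : 1 ≤ (1 + ‖x‖) ^ k := one_le_pow₀ (by simp)
    have h2 : C * (1 + ‖x‖) ^ k ≤ |C| * (1 + ‖x‖) ^ k := by gcongr; exact le_abs_self C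
    nlinarith [hC x]
  gcongr

theorem norm_mul_add_I_le {d : ℕ} (m τ : ℝ) {r : ℝ} (x : Mink d) (hr : |r| = |msq x|) :
    ‖(m : ℂ) ^ 2 * ((r : ℝ) + Complex.I * (τ : ℝ)) / 4‖ ≤
      (m ^ 2 * (2 + |τ|)) * (1 + ‖x‖) ^ 2 := by
  rw [norm_div, norm_mul, norm_pow, Complex.norm_real, Real.norm_eq_abs, sq_abs]
  have h1 : ‖(r : ℂ) + Complex.I * (τ : ℝ)‖ ≤ |r| + |τ| := by
    refine (norm_add_le _ _).trans ?_
    simp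
  have h2 : |r| + |τ| ≤ (2 + |τ|) * (1 + ‖x‖) ^ 2 := by
    have := abs_msq_le x
    have h3 := norm_nonneg x
    have h4 := abs_nonneg τ
    rw [hr]
    have h5 : 0 ≤ |τ| * ‖x‖ := by positivity
    have h6 : 0 ≤ |τ| * ‖x‖ ^ 2 := by positivity
    nlinarith
  have h3 : ‖(4 : ℂ)‖ = 4 := by simp
  rw [h3, div_le_iff₀ (by norm_num)]
  calc m ^ 2 * ‖(r : ℂ) + Complex.I * (τ : ℝ)‖ ≤ m ^ 2 * ((2 + |τ|) * (1 + ‖x‖) ^ 2) := by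
        gcongr; exact h1.trans h2
    _ ≤ _ := by
        have : 0 ≤ m ^ 2 * (2 + |τ|) * (1 + ‖x‖) ^ 2 := by positivity
        nlinarith

section Slice

variable {V : Type*} [NormedAddCommGroup V] [InnerProductSpace ℝ V] [FiniteDimensional ℝ V]
  [MeasurableSpace V] [BorelSpace V]

/-- Take a = u, b = m²/(4u) and B = m²u/4. Then a(b|y|² + B) is the argument of U_α, while a +
|q|²/(4b) = (|q|² + m²) u/m². The product of the latter with B is a perfect square, so the transform
is a pure exponential in u. -/
theorem integral_besselU_mul_of_re_pos {f : V → ℂ} (hf : Integrable f)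
    (hψ : Integrable (innerFourier f)) {m : ℝ} (hm : 0 < m) {u : ℂ} (hu : 0 < u.re) {α : ℂ}
    (hα : α = ((Module.finrank ℝ V : ℂ) - 1) / 2) :
    ∫ y, besselU α ((m : ℂ) ^ 2 * (‖y‖ ^ 2 + u * u) / 4) * f y =
      (((Real.pi * m ^ 2 : ℝ) : ℂ) ^ (Module.finrank ℝ V / 2 : ℂ))⁻¹ *
        ∫ q, ((m / Real.sqrt (‖q‖ ^ 2 + m ^ 2) : ℝ) : ℂ) *
          Complex.exp (-(Real.sqrt (‖q‖ ^ 2 + m ^ 2) : ℝ) * u) * innerFourier f q := by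
  have hu0 : u ≠ 0 := fun h => by simp [h] at hu
  have hmc : (m : ℂ) ≠ 0 := by exact_mod_cast hm.ne'
  set n := Module.finrank ℝ V with hn
  have hui : 0 < (u⁻¹).re := by
    rw [Complex.inv_re]; exact div_pos hu (Complex.normSq_pos.2 hu0)
  have hb : 0 < ((m : ℂ) ^ 2 / (4 * u)).re := by
    have : (m : ℂ) ^ 2 / (4 * u) = ((m ^ 2 / 4 : ℝ) : ℂ) * u⁻¹ := by push_cast; field_simp
    rw [this, Complex.re_ofReal_mul]; positivity
  have hB : 0 < ((m : ℂ) ^ 2 * u / 4).re := by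
    have : (m : ℂ) ^ 2 * u / 4 = ((m ^ 2 / 4 : ℝ) : ℂ) * u := by push_cast; ring
    rw [this, Complex.re_ofReal_mul]; positivity
  have key := integral_laplaceIntegral_mul hf hψ hu hb hB
  have hpi : ((Real.sqrt Real.pi : ℝ) : ℂ) ≠ 0 := sqrt_pi_ne_zero
  have hL : ∀ y : V, laplaceIntegral (-((n + 1 : ℂ) / 2)) u
      ((m : ℂ) ^ 2 / (4 * u) * ‖y‖ ^ 2 + (m : ℂ) ^ 2 * u / 4) =
      (Real.sqrt Real.pi : ℝ) * u ^ α * besselU α ((m : ℂ) ^ 2 * (‖y‖ ^ 2 + u * u) / 4) := by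
    intro y
    have h1 : 0 < ((m : ℂ) ^ 2 / (4 * u) * ‖y‖ ^ 2 + (m : ℂ) ^ 2 * u / 4).re := by
      have : (m : ℂ) ^ 2 / (4 * u) * (‖y‖ : ℂ) ^ 2 =
        ((‖y‖ ^ 2 : ℝ) : ℂ) * ((m : ℂ) ^ 2 / (4 * u)) := by push_cast; ring
      rw [this, Complex.add_re, Complex.re_ofReal_mul]
      positivity
    have h2 := laplaceIntegral_eq_besselU α hu h1
    have e1 : -((n + 1 : ℂ) / 2) = -α - 1 := by rw [hα]; ring
    have e2 : u * ((m : ℂ) ^ 2 / (4 * u) * ‖y‖ ^ 2 + (m : ℂ) ^ 2 * u / 4) =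
      (m : ℂ) ^ 2 * (‖y‖ ^ 2 + u * u) / 4 := by field_simp
    rw [e1, h2, e2]
  have hR : ∀ q : V, laplaceIntegral (-(1 / 2)) (u + ‖q‖ ^ 2 / (4 * ((m : ℂ) ^ 2 / (4 * u))))
      ((m : ℂ) ^ 2 * u / 4) = (Real.sqrt Real.pi : ℝ) * u ^ (-(1 / 2) : ℂ) *
        (((m / Real.sqrt (‖q‖ ^ 2 + m ^ 2) : ℝ) : ℂ) *
          Complex.exp (-(Real.sqrt (‖q‖ ^ 2 + m ^ 2) : ℝ) * u)) := by
    intro q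
    set E := Real.sqrt (‖q‖ ^ 2 + m ^ 2) with hE
    have hE0 : 0 < E := Real.sqrt_pos.2 (by positivity)
    have hE2 : E ^ 2 = ‖q‖ ^ 2 + m ^ 2 := Real.sq_sqrt (by positivity)
    have e1 : u + ‖q‖ ^ 2 / (4 * ((m : ℂ) ^ 2 / (4 * u))) = ((E ^ 2 / m ^ 2 : ℝ) : ℂ) * u := by
      rw [hE2]; push_cast; field_simp; ring
    have hA : 0 < (((E ^ 2 / m ^ 2 : ℝ) : ℂ) * u).re := by
      rw [Complex.re_ofReal_mul]; positivity
    rw [e1, laplaceIntegral_neg_half hA hB, ofReal_mul_cpow (by positivity) hu0]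
    -- Re u > 0 makes Eu/2 the principal root.
    have e2 : (((E ^ 2 / m ^ 2 : ℝ) : ℂ) * u * ((m : ℂ) ^ 2 * u / 4)) ^ (1 / 2 : ℂ) =
        ((E / 2 : ℝ) : ℂ) * u := by
      refine cpow_half_eq ?_ ?_
      · rw [Complex.re_ofReal_mul]; positivity
      · push_cast; field_simp; norm_num
    have e3 : ((E ^ 2 / m ^ 2 : ℝ) : ℂ) ^ (-(1 / 2) : ℂ) = ((m / E : ℝ) : ℂ) := by
      have : (-(1 / 2) : ℂ) = ((-(1 / 2) : ℝ) : ℂ) := by push_cast; rfl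
      rw [this, ← Complex.ofReal_cpow (by positivity), Real.rpow_neg (by positivity),
        ← Real.sqrt_eq_rpow, ← div_pow, Real.sqrt_sq (by positivity), inv_div]
    rw [e2, e3, show -2 * (((E / 2 : ℝ) : ℂ) * u) = -(E : ℝ) * u by push_cast; ring]
    ring
  rw [← hn] at key
  simp_rw [hL, hR, mul_assoc] at key
  rw [integral_const_mul, integral_const_mul, integral_const_mul, integral_const_mul] at key
  have hc : (4 * (Real.pi : ℂ) * ((m : ℂ) ^ 2 / (4 * u))) ^ (n / 2 : ℂ) =
      ((Real.pi * m ^ 2 : ℝ) : ℂ) ^ (n / 2 : ℂ) * (u ^ (n / 2 : ℂ))⁻¹ := by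
    have e : 4 * (Real.pi : ℂ) * ((m : ℂ) ^ 2 / (4 * u)) = ((Real.pi * m ^ 2 : ℝ) : ℂ) * u⁻¹ := by
      push_cast; field_simp
    rw [e, ofReal_mul_cpow (by positivity) (inv_ne_zero hu0), Complex.inv_cpow]
    exact (Complex.mem_slitPlane_iff_arg.1 (Or.inl hu)).1
  rw [← mul_assoc 4, hc] at key
  have hua : u ^ α ≠ 0 := by simp [Complex.cpow_eq_zero_iff, hu0]
  have huu : u ^ (n / 2 : ℂ) * u ^ (-(1 / 2) : ℂ) = u ^ α := by
    rw [← Complex.cpow_add _ _ hu0, hα]; ring_nf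
  rw [mul_inv, inv_inv] at key
  refine mul_left_cancel₀ (mul_ne_zero hpi hua) ?_
  rw [mul_assoc, key, ← huu]
  simp_rw [mul_assoc]
  ring

end Slice

/-- `√(-t² + iσ0) = iσ|t|`. -/
theorem tendsto_cpow_half_neg_sq {t s : ℝ} (ht : t ≠ 0) (hs : s ^ 2 = 1) :
    Tendsto (fun ε : ℝ => (-(t : ℂ) ^ 2 + Complex.I * (s * ε : ℝ)) ^ (1 / 2 : ℂ)) (𝓝[>] 0)
      (𝓝 (Complex.I * s * |t|)) := by
  have h1 : Tendsto (fun ε : ℝ => Complex.I * s *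
      (((t ^ 2 : ℝ) : ℂ) - Complex.I * (s * ε : ℝ)) ^ (1 / 2 : ℂ)) (𝓝[>] 0)
      (𝓝 (Complex.I * s * |t|)) := by
    have e : (((t ^ 2 : ℝ) : ℂ) - Complex.I * (s * (0 : ℝ) : ℝ)) ^ (1 / 2 : ℂ) = (|t| : ℝ) := by
      refine cpow_half_eq (by simpa using ht) ?_
      rw [← Complex.ofReal_mul, abs_mul_abs_self]
      simp [sq]
    have hc : ContinuousAt (fun ε : ℝ => (((t ^ 2 : ℝ) : ℂ) - Complex.I * (s * ε : ℝ)) ^ (1 / 2 : ℂ))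
        0 := by
      refine (continuousAt_cpow_const (Or.inl ?_)).comp (f := fun ε : ℝ =>
        ((t ^ 2 : ℝ) : ℂ) - Complex.I * (s * ε : ℝ)) (Continuous.continuousAt (by fun_prop))
      rw [show ((t ^ 2 : ℝ) : ℂ) - Complex.I * (s * (0 : ℝ) : ℝ) = ((t ^ 2 : ℝ) : ℂ) by simp,
        Complex.ofReal_re]
      positivity
    have h2 := hc.tendsto
    rw [e] at h2
    exact (h2.mono_left nhdsWithin_le_nhds).const_mul _
  refine h1.congr' ?_
  filter_upwards [self_mem_nhdsWithin] with ε hε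
  have hε : 0 < ε := hε
  rw [cpow_half_eq_neg (z := -(t : ℂ) ^ 2 + Complex.I * (s * ε : ℝ)) hs]
  · congr 2
    push_cast
    ring
  · have : (-(t : ℂ) ^ 2 + Complex.I * (s * ε : ℝ)).im = s * ε := by
      simp [← Complex.ofReal_pow, -Complex.ofReal_mul]
    rw [this, ← mul_assoc, ← sq, hs, one_mul]
    exact hε

theorem measurable_real_sign : Measurable Real.sign := by
  unfold Real.sign
  exact Measurable.ite measurableSet_Iio measurable_const
    (Measurable.ite measurableSet_Ioi measurable_const measurable_const)

theorem real_sign_sq {t : ℝ} (ht : t ≠ 0) : Real.sign t ^ 2 = 1 := by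
  rcases Real.sign_apply_eq_of_ne_zero t ht with h | h <;> rw [h] <;> norm_num

theorem mink_finrank (d : ℕ) (hd : 1 ≤ d) :
    ((Module.finrank ℝ (EuclideanSpace ℝ (Fin (d - 1))) : ℕ) : ℂ) = (d : ℂ) - 1 := by
  rw [finrank_euclideanSpace_fin, Nat.cast_sub hd, Nat.cast_one]

theorem half_sub_one_eq_ofReal (d : ℕ) : (d : ℂ) / 2 - 1 = ((d / 2 - 1 : ℝ) : ℂ) := by
  push_cast; rfl

theorem integrable_hyperbolicU_mul (d : ℕ) {m σ ε : ℝ} (hm : 0 < m) (hσ : σ ^ 2 = 1) (hε : 0 < ε)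
    (φ : 𝓢(Mink d, ℂ)) : Integrable fun x => hyperbolicU d m σ ε x * φ x := by
  unfold hyperbolicU
  rw [half_sub_one_eq_ofReal]
  have hmsq : Measurable fun x : Mink d => msq x := continuous_msq.measurable
  have hsgn : Measurable fun x : Mink d => Real.sign x.1 := measurable_real_sign.comp measurable_fst
  refine integrable_besselU_mul _ (c := m ^ 2 * ε / 4) (C := m ^ 2 * (2 + ε)) (k := 2)
    (by fun_prop) (by positivity) ?_ (fun x => ?_) φ
  · filter_upwards [ae_of_ae_fst ae_ne_zero] with x hx
    have e : (m : ℂ) ^ 2 * ((msq x : ℝ) + Complex.I * (σ * Real.sign x.1 * ε : ℝ)) / 4 =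
        ((m ^ 2 * msq x / 4 : ℝ) : ℂ) + ((m ^ 2 * (σ * Real.sign x.1 * ε) / 4 : ℝ) : ℂ) *
          Complex.I := by push_cast; ring
    rw [e, Complex.add_im, Complex.ofReal_im, zero_add, Complex.im_ofReal_mul, Complex.I_im, mul_one]
    rw [← sq_eq_sq₀ (abs_nonneg _) (by positivity), sq_abs]
    linear_combination (m ^ 2 * ε / 4) ^ 2 * (σ ^ 2 * real_sign_sq hx + hσ)
  · refine (norm_mul_add_I_le m _ x rfl).trans ?_
    gcongr
    rw [abs_mul, abs_of_pos hε]
    refine mul_le_of_le_one_left hε.le ?_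
    rw [abs_mul, ← sq_le_sq₀ (by positivity) (by norm_num), mul_pow, sq_abs, sq_abs, hσ]
    rcases eq_or_ne x.1 0 with h | h
    · simp [h]
    · rw [real_sign_sq h]; norm_num

/-- Re u > 0 bounds |e^{-Eu}| by 1, so all the kernels are dominated by a constant. In the limit the
exponential decay in u turns into the oscillation of the graph p⁰ = σE. -/
theorem exists_isBoundaryValue_hyperbolicU (d : ℕ) (hd : 1 ≤ d) {m σ : ℝ} (hm : 0 < m)
    (hσ : σ ^ 2 = 1) : ∃ T : 𝓢'(Mink d, ℂ), IsBoundaryValue (hyperbolicU d m σ) T ∧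
      ∀ φ, T φ = ∫ p : Mink d, (((Real.pi * m ^ 2 : ℝ) : ℂ) ^ (((d : ℂ) - 1) / 2))⁻¹ *
        (((m / Real.sqrt (‖p.2‖ ^ 2 + m ^ 2) : ℝ) : ℂ) *
          Complex.exp (-Complex.I * ((σ * Real.sqrt (‖p.2‖ ^ 2 + m ^ 2)) * p.1 : ℝ))) *
            spatialFourier φ p := by
  set c : ℂ := (((Real.pi * m ^ 2 : ℝ) : ℂ) ^ (((d : ℂ) - 1) / 2))⁻¹ with hc
  set E : EuclideanSpace ℝ (Fin (d - 1)) → ℝ := fun q => Real.sqrt (‖q‖ ^ 2 + m ^ 2) with hE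
  have hEc : Continuous E := by fun_prop
  have hEm : ∀ q, m ≤ E q := fun q => Real.le_sqrt_of_sq_le (by nlinarith [sq_nonneg ‖q‖])
  have hE0 : ∀ q, 0 < E q := fun q => hm.trans_le (hEm q)
  have hEn : ∀ q, ‖((m / E q : ℝ) : ℂ)‖ ≤ 1 := fun q => by
    have := hE0 q
    rw [Complex.norm_real, Real.norm_of_nonneg (by positivity), div_le_one (hE0 q)]
    exact hEm q
  set N := Module.finrank ℝ (EuclideanSpace ℝ (Fin (d - 1))) + 1 with hN
  have hdecay : Integrable fun p : Mink d => decayWeight N p :=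
    integrable_time_decay.mul_prod (integrable_one_add_norm_pow_inv volume (Nat.lt_succ_self _))
  -- Chosen so that |y|² + u² = x² + iσ sgn(t) ε; the principal root provides the positive real part
  -- required above.
  set u : ℝ → ℝ → ℂ := fun ε t => (-(t : ℂ) ^ 2 +
    Complex.I * (σ * Real.sign t * ε : ℝ)) ^ (1 / 2 : ℂ) with hu
  have hure : ∀ ε, 0 < ε → ∀ t, t ≠ 0 → 0 < (u ε t).re := by
    intro ε hε t ht
    refine re_cpow_half_pos (Or.inr ?_)
    have e : -(t : ℂ) ^ 2 + Complex.I * (σ * Real.sign t * ε : ℝ) =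
      ((-t ^ 2 : ℝ) : ℂ) + ((σ * Real.sign t * ε : ℝ) : ℂ) * Complex.I := by push_cast; ring
    rw [e, Complex.add_im, Complex.ofReal_im, zero_add, Complex.im_ofReal_mul, Complex.I_im, mul_one]
    refine mul_ne_zero (mul_ne_zero (fun h => ?_) (fun h => ?_)) hε.ne'
    · simp [h] at hσ
    · have := real_sign_sq ht; simp [h] at this
  set K : Mink d → ℂ := fun p => c * (((m / E p.2 : ℝ) : ℂ) *
    Complex.exp (-Complex.I * ((σ * E p.2) * p.1 : ℝ))) with hK
  set Kε : ℝ → Mink d → ℂ := fun ε p => c * (((m / E p.2 : ℝ) : ℂ) *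
    Complex.exp (-(E p.2 : ℝ) * u ε p.1)) with hKε
  have hEm' : Measurable E := hEc.measurable
  have hKm : Measurable K := by rw [hK]; fun_prop
  have hKεm : ∀ ε, Measurable (Kε ε) := by
    intro ε
    have := measurable_real_sign
    have hum : Measurable (u ε) := by rw [hu]; fun_prop
    rw [hKε]
    fun_prop
  have hKn : ∀ p, ‖K p‖ ≤ ‖c‖ := by
    intro p
    rw [hK, norm_mul, norm_mul, Complex.norm_exp]
    simp only [neg_mul, Complex.neg_re, Complex.I_mul_re, Complex.ofReal_im, neg_zero, Real.exp_zero,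
      mul_one]
    exact mul_le_of_le_one_right (norm_nonneg _) (hEn _)
  have hKint : Integrable fun p => ‖K p‖ * decayWeight N p := by
    refine (hdecay.const_mul ‖c‖).mono' (hKm.norm.aestronglyMeasurable.mul
      hdecay.aestronglyMeasurable) (Eventually.of_forall fun p => ?_)
    rw [Real.norm_of_nonneg (mul_nonneg (norm_nonneg _) (decayWeight_nonneg _ _))]
    exact mul_le_mul_of_nonneg_right (hKn p) (decayWeight_nonneg _ _)
  obtain ⟨T, hT⟩ := exists_kernel_distribution hKm.aestronglyMeasurable hKint
  refine ⟨T, ⟨fun ε hε φ => integrable_hyperbolicU_mul d hm hσ hε φ, fun φ => ?_⟩, hT⟩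
  rw [hT φ]
  refine tendsto_integral_of_kernel (Kε := Kε) (G := fun _ => ‖c‖) (N := N) φ
    (fun ε hε => integrable_hyperbolicU_mul d hm hσ hε φ) (fun ε hε => ?_)
    (fun ε _ => (hKεm ε).aestronglyMeasurable) (fun ε hε => ?_) (hdecay.const_mul _) ?_
  · filter_upwards [ae_ne_zero] with t ht
    have h := integral_besselU_mul_of_re_pos (integrable_slice φ t)
      (integrable_innerFourier_slice φ t) hm (hure ε hε t ht) (α := (d : ℂ) / 2 - 1)
      (by rw [mink_finrank d hd]; ring)
    rw [mink_finrank d hd, ← integral_const_mul] at h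
    refine Eq.trans ?_ (h.trans ?_)
    · refine integral_congr_ae (Eventually.of_forall fun y => ?_)
      simp only [hyperbolicU, msq_eq, hu, cpow_half_mul_self]
      congr 3
      push_cast
      ring
    · refine integral_congr_ae (Eventually.of_forall fun q => ?_)
      simp only [hKε, hE, spatialFourier]
      ring
  · filter_upwards [ae_of_ae_fst ae_ne_zero] with p hp
    rw [hKε, norm_mul, norm_mul, Complex.norm_exp]
    refine mul_le_of_le_one_right (norm_nonneg _) (mul_le_one₀ (hEn _) (Real.exp_nonneg _) ?_)
    rw [← Complex.ofReal_neg, Complex.re_ofReal_mul, Real.exp_le_one_iff]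
    have := hE0 p.2
    have := hure ε hε p.1 hp
    nlinarith
  · filter_upwards [ae_of_ae_fst ae_ne_zero] with p hp
    have h1 := tendsto_cpow_half_neg_sq (s := σ * Real.sign p.1) hp
      (by rw [mul_pow, hσ, real_sign_sq hp, one_mul])
    have e : -Complex.I * ((σ * E p.2) * p.1 : ℝ) = -(E p.2 : ℝ) *
        (Complex.I * (σ * Real.sign p.1 : ℝ) * |p.1|) := by
      -- The factor sgn(x⁰) in the regularisation converts the limit iσ sgn(t)|t| into iσt, so that
      -- only one sign of the energy occurs.
      have : Real.sign p.1 * |p.1| = p.1 := by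
        rcases lt_or_gt_of_ne hp with h | h
        · rw [Real.sign_of_neg h, abs_of_neg h]; ring
        · rw [Real.sign_of_pos h, abs_of_pos h]; ring
      have h2 : ((Real.sign p.1 : ℝ) : ℂ) * ((|p.1| : ℝ) : ℂ) = p.1 := by exact_mod_cast this
      push_cast
      linear_combination Complex.I * σ * E p.2 * h2
    simp only [hK, hKε, e]
    exact (((h1.const_mul _).cexp).const_mul _).const_mul _

/-- The constant in the theorem is the inverse of the Gaussian normalisation (πm²)^{-(d-1)/2} of the
spatial transform. -/
theorem exp_mul_cpow_cancel {m : ℝ} (hm : 0 < m) (d : ℕ) (hd : 1 ≤ d) :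
    (m : ℂ) ^ (d - 1) * (Real.pi : ℂ) ^ (((d : ℂ) - 1) / 2) *
      (((Real.pi * m ^ 2 : ℝ) : ℂ) ^ (((d : ℂ) - 1) / 2))⁻¹ = 1 := by
  have hpi : (Real.pi : ℂ) ≠ 0 := by exact_mod_cast Real.pi_ne_zero
  have hm0 : (m : ℂ) ≠ 0 := by exact_mod_cast hm.ne'
  have h1 : (((m ^ 2 : ℝ) : ℂ)) ^ (((d : ℂ) - 1) / 2) = (m : ℂ) ^ (d - 1) := by
    rw [show (((d : ℂ) - 1) / 2) = (((d - 1 : ℕ) / 2 : ℝ) : ℂ) by push_cast [Nat.cast_sub hd]; ring,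
      ← Complex.ofReal_cpow (by positivity), ← Real.rpow_natCast m 2, ← Real.rpow_mul hm.le,
      show ((2 : ℕ) : ℝ) * (((d - 1 : ℕ) : ℝ) / 2) = (d - 1 : ℕ) by push_cast; ring,
      Real.rpow_natCast, Complex.ofReal_pow]
  rw [Complex.ofReal_mul, Complex.mul_cpow_ofReal_nonneg Real.pi_pos.le (by positivity), h1]
  have h2 : (Real.pi : ℂ) ^ (((d : ℂ) - 1) / 2) ≠ 0 := by simp [Complex.cpow_eq_zero_iff, hpi]
  have h3 : (m : ℂ) ^ (d - 1) ≠ 0 := pow_ne_zero _ hm0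
  field_simp

/-- Both sides are now integrals of the same kernel against the spatial transform of φ: the density
m/E of the sheet is the prefactor found for U. -/
theorem hyperbolic_fourier (d : ℕ) (hd : 1 ≤ d) {m σ : ℝ} (hm : 0 < m) (hσ : σ ^ 2 = 1) :
    HasBoundaryValue (hyperbolicU d m σ) ∧
      IsFourierTransform (hyperbolicMeasure d m σ)
        (((m : ℂ) ^ (d - 1) * (Real.pi : ℂ) ^ (((d : ℂ) - 1) / 2)) •
          boundaryValue (hyperbolicU d m σ)) := by
  obtain ⟨T, hT, hTφ⟩ := exists_isBoundaryValue_hyperbolicU d hd hm hσ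
  refine ⟨⟨T, hT⟩, fun φ => ?_⟩
  have hcont : Continuous fun q : EuclideanSpace ℝ (Fin (d - 1)) => Real.sqrt (‖q‖ ^ 2 + m ^ 2) := by
    fun_prop
  have hle : ∀ q : EuclideanSpace ℝ (Fin (d - 1)), m ≤ Real.sqrt (‖q‖ ^ 2 + m ^ 2) :=
    fun q => Real.le_sqrt_of_sq_le (by nlinarith [sq_nonneg ‖q‖])
  have hρm : Measurable fun q : EuclideanSpace ℝ (Fin (d - 1)) =>
      m / Real.sqrt (‖q‖ ^ 2 + m ^ 2) := by
    have := hcont.measurable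
    fun_prop
  have hfin := Nat.lt_succ_self (Module.finrank ℝ (EuclideanSpace ℝ (Fin (d - 1))))
  obtain ⟨h1, h2⟩ := graphVolume_fourier (d := d) (D := Set.univ)
    (h := fun q => σ * Real.sqrt (‖q‖ ^ 2 + m ^ 2))
    (ρ := fun q => m / Real.sqrt (‖q‖ ^ 2 + m ^ 2))
    (N := Module.finrank ℝ (EuclideanSpace ℝ (Fin (d - 1))) + 1) MeasurableSet.univ
    (hcont.const_mul σ) hρm
    (fun q => by positivity) (fun q _ => by
      rw [sqrt_abs_det_graphMetric hσ (by positivity), abs_of_pos (by positivity),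
        Real.sqrt_sq hm.le]) (by
      simp only [Set.indicator_univ]
      refine (integrable_one_add_norm_pow_inv volume hfin).mono'
        (hρm.aestronglyMeasurable.mul
          (integrable_one_add_norm_pow_inv volume hfin).aestronglyMeasurable)
        (Eventually.of_forall fun q => ?_)
      rw [Real.norm_of_nonneg (by positivity)]
      refine mul_le_of_le_one_left (by positivity) ?_
      rw [div_le_one (hm.trans_le (hle q))]
      exact hle q) φ
  refine ⟨h1, ?_⟩
  rw [hyperbolicMeasure, h2, boundaryValue_eq hT]
  change ((m : ℂ) ^ (d - 1) * (Real.pi : ℂ) ^ (((d : ℂ) - 1) / 2)) • T φ = _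
  rw [hTφ, smul_eq_mul, ← integral_const_mul]
  refine integral_congr_ae (Eventually.of_forall fun p => ?_)
  simp only [Set.indicator_univ]
  rw [← mul_assoc, ← mul_assoc, exp_mul_cpow_cancel hm d hd, one_mul]

/-! ### The one-sheeted hyperboloid -/

theorem measurable_laplaceIntegral (β A : ℂ) : Measurable (laplaceIntegral β A) := by
  have h : StronglyMeasurable (Function.uncurry fun (B : ℂ) (τ : ℝ) =>
      Complex.exp (-(A * τ) - B / τ) * (τ : ℂ) ^ β) := by
    refine Measurable.stronglyMeasurable ?_
    unfold Function.uncurry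
    fun_prop
  unfold laplaceIntegral
  exact (h.integral_prod_right (ν := volume.restrict (Set.Ioi (0 : ℝ)))).measurable

theorem mul_mem_slitPlane_of_re_pos' {A B : ℂ} (hA : 0 < A.re) (hB : 0 < B.re) :
    0 < ((A * B) ^ (1 / 2 : ℂ)).re := re_cpow_half_pos (mul_mem_slitPlane_of_re_pos hA hB)

theorem norm_exp_neg_two_mul_le {w : ℂ} (hw : 0 ≤ w.re) : ‖Complex.exp (-2 * w)‖ ≤ 1 := by
  rw [Complex.norm_exp, Real.exp_le_one_iff]
  simpa using hw

/-! ### Imaginary Laplace parameters and singular radial weights -/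

section Limit

variable {V : Type*} [NormedAddCommGroup V] [InnerProductSpace ℝ V] [FiniteDimensional ℝ V]
  [MeasurableSpace V] [BorelSpace V]

/-- A limiting case of `integral_laplaceIntegral_mul`. -/
theorem integral_mul_eq_of_tendsto {f : V → ℂ} (hf : Integrable f)
    (hψ : Integrable (innerFourier f)) {a b : ℝ → ℂ} {B b₀ : ℂ} {L A₀ : V → ℂ} {bd g : V → ℝ}
    (ha : ∀ᶠ δ in 𝓝[>] (0 : ℝ), 0 < (a δ).re) (hb : ∀ᶠ δ in 𝓝[>] (0 : ℝ), 0 < (b δ).re)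
    (hB : 0 < B.re) (hb₀ : Tendsto b (𝓝[>] 0) (𝓝 b₀)) (hb₀s : 4 * Real.pi * b₀ ∈ Complex.slitPlane)
    (hL : ∀ y, Tendsto (fun δ => laplaceIntegral (-((Module.finrank ℝ V + 1 : ℂ) / 2)) (a δ)
      (b δ * ‖y‖ ^ 2 + B)) (𝓝[>] 0) (𝓝 (L y)))
    (hLb : ∀ᶠ δ in 𝓝[>] (0 : ℝ), ∀ y, ‖laplaceIntegral (-((Module.finrank ℝ V + 1 : ℂ) / 2)) (a δ)
      (b δ * ‖y‖ ^ 2 + B)‖ ≤ bd y)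
    (hbd : Integrable fun y => bd y * ‖f y‖)
    (hA : ∀ᵐ q : V, Tendsto (fun δ => a δ + ‖q‖ ^ 2 / (4 * b δ)) (𝓝[>] 0) (𝓝 (A₀ q)) ∧
      A₀ q ∈ Complex.slitPlane ∧ A₀ q * B ∈ Complex.slitPlane)
    (hg : ∀ᶠ δ in 𝓝[>] (0 : ℝ), ∀ᵐ q : V,
      ‖(a δ + ‖q‖ ^ 2 / (4 * b δ)) ^ (-(1 / 2) : ℂ)‖ ≤ g q)
    (hgi : Integrable fun q => g q * ‖innerFourier f q‖) :
    ∫ y, L y * f y = ((4 * Real.pi * b₀) ^ (Module.finrank ℝ V / 2 : ℂ))⁻¹ *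
      ∫ q, (Real.sqrt Real.pi : ℝ) * (A₀ q) ^ (-(1 / 2) : ℂ) *
        Complex.exp (-2 * (A₀ q * B) ^ (1 / 2 : ℂ)) * innerFourier f q := by
  set n := Module.finrank ℝ V with hn
  have hpos : ∀ᶠ δ in 𝓝[>] (0 : ℝ), ∀ q : V, 0 < (a δ + ‖q‖ ^ 2 / (4 * b δ)).re := by
    filter_upwards [ha, hb] with δ ha hb q
    have hb0 : b δ ≠ 0 := fun h => by simp [h] at hb
    have e : (‖q‖ : ℂ) ^ 2 / (4 * b δ) = ((‖q‖ ^ 2 / 4 : ℝ) : ℂ) * (b δ)⁻¹ := by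
      push_cast; field_simp
    rw [e, Complex.add_re, Complex.re_ofReal_mul, Complex.inv_re]
    have := Complex.normSq_nonneg (b δ)
    positivity
  have h1 : Tendsto (fun δ => ∫ y, laplaceIntegral (-((n + 1 : ℂ) / 2)) (a δ)
      (b δ * ‖y‖ ^ 2 + B) * f y) (𝓝[>] 0) (𝓝 (∫ y, L y * f y)) := by
    refine tendsto_integral_filter_of_dominated_convergence (fun y => bd y * ‖f y‖) ?_ ?_ hbd ?_
    · refine Eventually.of_forall fun δ => ?_
      have hm := measurable_laplaceIntegral (-((n + 1 : ℂ) / 2)) (a δ)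
      exact (hm.comp (by fun_prop : Measurable fun y : V =>
        b δ * (‖y‖ : ℂ) ^ 2 + B)).aestronglyMeasurable.mul hf.1
    · filter_upwards [hLb] with δ hδ
      refine Eventually.of_forall fun y => ?_
      rw [norm_mul]
      exact mul_le_mul_of_nonneg_right (hδ y) (norm_nonneg _)
    · exact Eventually.of_forall fun y => (hL y).mul_const _
  have h2 : Tendsto (fun δ => ((4 * Real.pi * b δ) ^ (n / 2 : ℂ))⁻¹ *
      ∫ q, laplaceIntegral (-(1 / 2)) (a δ + ‖q‖ ^ 2 / (4 * b δ)) B * innerFourier f q) (𝓝[>] 0)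
      (𝓝 (((4 * Real.pi * b₀) ^ (n / 2 : ℂ))⁻¹ *
      ∫ q, (Real.sqrt Real.pi : ℝ) * (A₀ q) ^ (-(1 / 2) : ℂ) *
        Complex.exp (-2 * (A₀ q * B) ^ (1 / 2 : ℂ)) * innerFourier f q)) := by
    refine Tendsto.mul ?_ ?_
    · refine Tendsto.inv₀ ?_ ?_
      · exact (continuousAt_cpow_const hb₀s).tendsto.comp (hb₀.const_mul _)
      · simp [Complex.cpow_eq_zero_iff, Complex.slitPlane_ne_zero hb₀s]
    · have hc : ∀ᶠ δ in 𝓝[>] (0 : ℝ), (fun q : V => laplaceIntegral (-(1 / 2))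
          (a δ + ‖q‖ ^ 2 / (4 * b δ)) B * innerFourier f q) = fun q =>
          (Real.sqrt Real.pi : ℝ) * (a δ + ‖q‖ ^ 2 / (4 * b δ)) ^ (-(1 / 2) : ℂ) *
        Complex.exp (-2 * ((a δ + ‖q‖ ^ 2 / (4 * b δ)) * B) ^ (1 / 2 : ℂ)) * innerFourier f q := by
        filter_upwards [hpos] with δ hδ
        ext q
        rw [laplaceIntegral_neg_half (hδ q) hB]
      refine Tendsto.congr' (hc.mono fun δ h => (congrArg (fun F => ∫ q, F q) h).symm) ?_
      refine tendsto_integral_filter_of_dominated_convergence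
        (fun q => Real.sqrt Real.pi * (g q * ‖innerFourier f q‖)) ?_ ?_ (hgi.const_mul _) ?_
      · refine Eventually.of_forall fun δ => ?_
        refine AEStronglyMeasurable.mul (Measurable.aestronglyMeasurable ?_) hψ.1
        fun_prop
      · filter_upwards [hpos, hg] with δ hδ hgδ
        filter_upwards [hgδ] with q hq
        have h3 := norm_exp_neg_two_mul_le (mul_mem_slitPlane_of_re_pos' (hδ q) hB).le
        rw [norm_mul, norm_mul, norm_mul, Complex.norm_real, Real.norm_of_nonneg (Real.sqrt_nonneg _),
          mul_assoc, mul_assoc]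
        refine mul_le_mul_of_nonneg_left ?_ (Real.sqrt_nonneg _)
        rw [← mul_assoc]
        refine mul_le_mul_of_nonneg_right ?_ (norm_nonneg _)
        calc _ ≤ g q * 1 := mul_le_mul hq h3 (norm_nonneg _) ((norm_nonneg _).trans hq)
          _ = _ := mul_one _
      · filter_upwards [hA] with q hq
        obtain ⟨hq1, hq2, hq3⟩ := hq
        refine Tendsto.mul_const _ (Tendsto.mul (Tendsto.const_mul _ ?_) ?_)
        · exact (continuousAt_cpow_const hq2).tendsto.comp hq1
        · refine (Tendsto.const_mul _ ?_).cexp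
          exact (continuousAt_cpow_const hq3).tendsto.comp (hq1.mul_const B)
  refine tendsto_nhds_unique (h1.congr' ?_) h2
  filter_upwards [ha, hb] with δ ha hb
  exact integral_laplaceIntegral_mul hf hψ ha hb hB

theorem integrable_pow_mul_slice (φ : 𝓢(ℝ × V, ℂ)) (t : ℝ) (k : ℕ) :
    Integrable fun y => (1 + ‖y‖) ^ k * ‖φ (t, y)‖ := by
  refine Integrable.mono' (((integrable_one_add_norm_pow_inv volume
    (Nat.lt_succ_self (Module.finrank ℝ V))).const_mul (((1 + |t|) ^ 2)⁻¹)).const_mul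
    (2 ^ (2 + (k + (Module.finrank ℝ V + 1))) *
      (Finset.Iic (2 + (k + (Module.finrank ℝ V + 1)), 0)).sup
      (schwartzSeminormFamily ℂ (ℝ × V) ℂ) φ)) ?_ (Eventually.of_forall fun y => ?_)
  · have hφ : Continuous φ := φ.continuous
    exact Continuous.aestronglyMeasurable (by fun_prop)
  · rw [Real.norm_of_nonneg (by positivity)]
    have h := norm_iteratedFDeriv_le_decay φ (k + (Module.finrank ℝ V + 1)) (le_refl 0) t y
    rw [norm_iteratedFDeriv_zero] at h
    refine (mul_le_mul_of_nonneg_left h (by positivity)).trans (le_of_eq ?_)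
    rw [pow_add (1 + ‖y‖), mul_inv]
    have : (1 + ‖y‖) ^ k ≠ 0 := by positivity
    simp only [Nat.succ_eq_add_one]
    field_simp

/-- Radial weights with a square root singularity on a sphere. -/
theorem integrable_rpow_neg_half_weight {m : ℝ} (hm : 0 < m) : Integrable fun q : V =>
    |1 - ‖q‖ ^ 2 / m ^ 2| ^ (-(1 / 2) : ℝ) * ((1 + ‖q‖) ^ (Module.finrank ℝ V + 1))⁻¹ := by
  -- The zero-dimensional case, d = 1, is separate because polar coordinates need a nontrivial
  -- space.
  rcases subsingleton_or_nontrivial V with hV | hV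
  · have : CompactSpace V := Finite.compactSpace
    exact Integrable.of_finite
  set n := Module.finrank ℝ V with hn
  have hn1 : 1 ≤ n := Module.finrank_pos
  rw [integrable_fun_norm_addHaar (μ := (volume : Measure V))
    (f := fun r : ℝ => |1 - r ^ 2 / m ^ 2| ^ (-(1 / 2) : ℝ) * ((1 + r) ^ (n + 1))⁻¹)]
  have hloc : Integrable fun r : ℝ => (Set.Ioo 0 1).indicator (fun x : ℝ => x ^ (-(1 / 2) : ℝ)) ‖r‖ := by
    rw [integrable_fun_norm_addHaar (μ := (volume : Measure ℝ))
      (f := (Set.Ioo 0 1).indicator (fun x : ℝ => x ^ (-(1 / 2) : ℝ)))]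
    simp only [Module.finrank_self, Nat.sub_self, pow_zero, one_smul]
    refine Integrable.integrableOn ?_
    rw [integrable_indicator_iff measurableSet_Ioo]
    exact (intervalIntegral.integrableOn_Ioo_rpow_iff one_pos).2 (by norm_num)
  have hsum := (((hloc.comp_sub_right m).add integrable_time_decay).const_mul
    (m ^ (1 / 2 : ℝ))).integrableOn (s := Set.Ioi 0)
  refine Integrable.mono' hsum ?_ ?_
  · refine Measurable.aestronglyMeasurable ?_
    simp only [smul_eq_mul]
    fun_prop
  · have hne : ∀ᵐ r : ℝ, r ≠ m := by rw [ae_iff]; simp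
    filter_upwards [ae_restrict_mem measurableSet_Ioi, ae_restrict_of_ae hne] with r hr hrm
    have hr : 0 < r := hr
    simp only [smul_eq_mul, Pi.add_apply]
    have hrm' : 0 < |r - m| := abs_pos.2 (sub_ne_zero.2 hrm)
    have h1 : |r - m| / m ≤ |1 - r ^ 2 / m ^ 2| := by
      have e : 1 - r ^ 2 / m ^ 2 = -((r - m) / m * ((r + m) / m)) := by field_simp; ring
      rw [e, abs_neg, abs_mul, abs_div, abs_of_pos hm, abs_of_pos (by positivity : 0 < (r + m) / m)]
      refine le_mul_of_one_le_right (by positivity) ?_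
      rw [one_le_div hm]; linarith
    have h2 : |1 - r ^ 2 / m ^ 2| ^ (-(1 / 2) : ℝ) ≤ m ^ (1 / 2 : ℝ) * |r - m| ^ (-(1 / 2) : ℝ) := by
      refine (Real.rpow_le_rpow_of_nonpos (by positivity) h1 (by norm_num)).trans (le_of_eq ?_)
      rw [Real.div_rpow hrm'.le hm.le, Real.rpow_neg hm.le, div_inv_eq_mul, mul_comm]
    have h3 : r ^ (n - 1) * ((1 + r) ^ (n + 1))⁻¹ ≤ ((1 + |r|) ^ 2)⁻¹ := by
      rw [abs_of_pos hr, ← div_eq_mul_inv, div_le_iff₀ (by positivity), ← div_eq_inv_mul,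
        le_div_iff₀ (by positivity)]
      calc r ^ (n - 1) * (1 + r) ^ 2 ≤ (1 + r) ^ (n - 1) * (1 + r) ^ 2 := by gcongr; linarith
        _ = (1 + r) ^ (n + 1) := by rw [← pow_add]; congr 1; omega
    have h4 : |r - m| ^ (-(1 / 2) : ℝ) * ((1 + |r|) ^ 2)⁻¹ ≤
        (Set.Ioo 0 1).indicator (fun x : ℝ => x ^ (-(1 / 2) : ℝ)) ‖r - m‖ + ((1 + |r|) ^ 2)⁻¹ := by
      rw [Real.norm_eq_abs]
      by_cases h : |r - m| < 1
      · rw [Set.indicator_of_mem (show |r - m| ∈ Set.Ioo (0 : ℝ) 1 from ⟨hrm', h⟩)]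
        have : ((1 + |r|) ^ 2)⁻¹ ≤ 1 := inv_le_one_of_one_le₀ (one_le_pow₀ (by simp))
        have h5 : 0 ≤ ((1 + |r|) ^ 2)⁻¹ := by positivity
        have h6 : 0 ≤ |r - m| ^ (-(1 / 2) : ℝ) := by positivity
        nlinarith
      · rw [Set.indicator_of_notMem (fun hh => h hh.2), zero_add]
        refine mul_le_of_le_one_left (by positivity) ?_
        exact Real.rpow_le_one_of_one_le_of_nonpos (not_lt.1 h) (by norm_num)
    rw [Real.norm_of_nonneg (by positivity)]
    calc r ^ (n - 1) * (|1 - r ^ 2 / m ^ 2| ^ (-(1 / 2) : ℝ) * ((1 + r) ^ (n + 1))⁻¹)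
        = |1 - r ^ 2 / m ^ 2| ^ (-(1 / 2) : ℝ) * (r ^ (n - 1) * ((1 + r) ^ (n + 1))⁻¹) := by ring
      _ ≤ (m ^ (1 / 2 : ℝ) * |r - m| ^ (-(1 / 2) : ℝ)) * ((1 + |r|) ^ 2)⁻¹ := by gcongr
      _ = m ^ (1 / 2 : ℝ) * (|r - m| ^ (-(1 / 2) : ℝ) * ((1 + |r|) ^ 2)⁻¹) := by ring
      _ ≤ _ := by gcongr

/-- Radial weights with a pole at the origin. -/
theorem integrable_norm_inv_weight (hV : 2 ≤ Module.finrank ℝ V) : Integrable fun q : V =>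
    ‖q‖⁻¹ * ((1 + ‖q‖) ^ (Module.finrank ℝ V + 1))⁻¹ := by
  have : Nontrivial V := Module.nontrivial_of_finrank_pos (R := ℝ) (by omega)
  set n := Module.finrank ℝ V with hn
  rw [integrable_fun_norm_addHaar (μ := (volume : Measure V))
    (f := fun r : ℝ => r⁻¹ * ((1 + r) ^ (n + 1))⁻¹)]
  refine Integrable.mono' (integrable_time_decay.integrableOn (s := Set.Ioi 0)) ?_ ?_
  · refine Measurable.aestronglyMeasurable ?_
    simp only [smul_eq_mul]
    fun_prop
  · filter_upwards [ae_restrict_mem measurableSet_Ioi] with r hr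
    have hr : 0 < r := hr
    simp only [smul_eq_mul]
    rw [Real.norm_of_nonneg (by positivity), abs_of_pos hr]
    -- In dimension n ≥ 2 the Jacobian r^{n-1} contains a factor r that cancels the pole, leaving
    -- r^k.
    obtain ⟨k, hk⟩ : ∃ k, n = k + 2 := ⟨n - 2, by omega⟩
    rw [← hn, hk, show k + 2 - 1 = k + 1 by omega, pow_succ r k, mul_assoc, mul_inv_cancel_left₀ hr.ne',
      ← div_eq_mul_inv, div_le_iff₀ (by positivity), ← div_eq_inv_mul, le_div_iff₀ (by positivity)]
    calc r ^ k * (1 + r) ^ 2 ≤ (1 + r) ^ (k + 1) * (1 + r) ^ 2 := by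
          gcongr
          calc r ^ k ≤ (1 + r) ^ k := by gcongr; linarith
            _ ≤ _ := pow_le_pow_right₀ (by linarith) (by omega)
      _ = _ := by rw [← pow_add]

end Limit

theorem continuousAt_besselU (α : ℂ) {z : ℂ} (hz : z ∈ Complex.slitPlane) :
    ContinuousAt (besselU α) z := (hasDerivAt_besselU α hz).continuousAt

theorem I_mul_ofReal_mul_self {σ : ℝ} (hσ : σ ^ 2 = 1) : (Complex.I * σ) * (Complex.I * σ) = -1 := by
  have : (σ : ℂ) ^ 2 = 1 := by exact_mod_cast hσ
  linear_combination Complex.I ^ 2 * this + Complex.I_sq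

theorem I_mul_ofReal_mem_slitPlane {x : ℝ} (hx : x ≠ 0) : Complex.I * x ∈ Complex.slitPlane :=
  Or.inr (by simpa using hx)

section Slice

variable {V : Type*} [NormedAddCommGroup V] [InnerProductSpace ℝ V] [FiniteDimensional ℝ V]
  [MeasurableSpace V] [BorelSpace V]

theorem integrable_weight_mul_norm_spatialFourier {g : V → ℝ} {N : ℕ}
    (hgm : AEStronglyMeasurable g) (hg0 : ∀ q, 0 ≤ g q)
    (hg : Integrable fun q => g q * ((1 + ‖q‖) ^ N)⁻¹) (φ : 𝓢(ℝ × V, ℂ)) (t : ℝ) :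
    Integrable fun q => g q * ‖innerFourier (fun y => φ (t, y)) q‖ := by
  obtain ⟨C, hC, s, h⟩ := exists_norm_spatialFourier_le (V := V) N
  refine (hg.const_mul (C * s.sup (schwartzSeminormFamily ℂ (ℝ × V) ℂ) φ *
    ((1 + |t|) ^ 2)⁻¹)).mono' (hgm.mul (integrable_innerFourier_slice φ t).1.norm)
    (Eventually.of_forall fun q => ?_)
  rw [Real.norm_of_nonneg (mul_nonneg (hg0 q) (norm_nonneg _))]
  refine (mul_le_mul_of_nonneg_left (h φ (t, q)) (hg0 q)).trans (le_of_eq ?_)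
  simp only [decayWeight]
  ring

theorem one_sub_div_ne_zero {m r : ℝ} (hm : 0 < m) (hr : 0 ≤ r) (h : r ≠ m) :
    1 - r ^ 2 / m ^ 2 ≠ 0 := by
  intro h0
  apply h
  have : r ^ 2 = m ^ 2 := by field_simp at h0; linarith
  exact (sq_eq_sq₀ hr hm.le).1 this

theorem ae_norm_ne {m : ℝ} (hm : m ≠ 0) : ∀ᵐ q : V, ‖q‖ ≠ m := by
  have h := Measure.addHaar_sphere_of_ne_zero (volume : Measure V) 0 hm
  rw [ae_iff]
  convert h using 2
  ext q
  simp

/-- Slices of `U_α(m² (-x² + iσε) / 4)` as kernels. -/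
theorem integral_besselU_slice {m σ ε : ℝ} (hm : 0 < m) (hσ : σ ^ 2 = 1) (hε : 0 < ε) {α : ℝ}
    (hα : α = ((Module.finrank ℝ V : ℝ) - 1) / 2) (φ : 𝓢(ℝ × V, ℂ)) (t : ℝ) :
    ∫ y, besselU α ((m : ℂ) ^ 2 * ((t : ℂ) ^ 2 - ‖y‖ ^ 2 + Complex.I * σ * ε) / 4) * φ (t, y) =
      (((Real.pi * m ^ 2 : ℝ) : ℂ) ^ (Module.finrank ℝ V / 2 : ℂ))⁻¹ *
        ((Complex.I * σ) ^ (1 / 2 - (Module.finrank ℝ V : ℂ)) *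
          ∫ q, (Complex.I * σ * (1 - ‖q‖ ^ 2 / m ^ 2 : ℝ)) ^ (-(1 / 2) : ℂ) *
            Complex.exp (-2 * ((Complex.I * σ * (1 - ‖q‖ ^ 2 / m ^ 2 : ℝ)) *
              ((m : ℂ) ^ 2 / 4 * (ε - Complex.I * σ * (t : ℂ) ^ 2))) ^ (1 / 2 : ℂ)) *
            spatialFourier φ (t, q)) := by
  set n := Module.finrank ℝ V with hn
  have hmc : (m : ℂ) ≠ 0 := by exact_mod_cast hm.ne'
  have hσ0 : σ ≠ 0 := fun h => by simp [h] at hσ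
  have hσa : |σ| = 1 := by rw [← sq_eq_sq₀ (abs_nonneg _) one_pos.le, sq_abs, hσ, one_pow]
  set J : ℂ := Complex.I * σ with hJ
  have hJJ : J * J = -1 := I_mul_ofReal_mul_self hσ
  have hJs : J ∈ Complex.slitPlane := I_mul_ofReal_mem_slitPlane hσ0
  have hJ0 : J ≠ 0 := Complex.slitPlane_ne_zero hJs
  have hJre : J.re = 0 := by simp [hJ]
  have hJim : J.im = σ := by simp [hJ]
  -- B is fixed by the requirement that J(bJ|y|² + B), with b = m²/4, be the argument of U_α. Its
  -- real part m²ε/4 is positive only thanks to ε.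
  set B : ℂ := (m : ℂ) ^ 2 / 4 * (ε - J * (t : ℂ) ^ 2) with hB
  have hBeq : B = ((m ^ 2 / 4 * ε : ℝ) : ℂ) + ((-(m ^ 2 / 4 * σ * t ^ 2) : ℝ) : ℂ) * Complex.I := by
    rw [hB, hJ]; push_cast; ring
  have hBre : B.re = m ^ 2 / 4 * ε := by
    rw [hBeq, Complex.add_re, Complex.re_ofReal_mul, Complex.I_re, Complex.ofReal_re]; ring
  have hBim : B.im = -(m ^ 2 / 4 * σ * t ^ 2) := by
    rw [hBeq, Complex.add_im, Complex.im_ofReal_mul, Complex.I_im, Complex.ofReal_im]; ring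
  -- The auxiliary δ > 0 moves both parameters into the right half-plane. Taking b inversely
  -- proportional to δ - J makes a + |q|²/(4b) affine in δ, with limit J(1 - |q|²/m²).
  set a : ℝ → ℂ := fun δ => δ + J with ha
  set b : ℝ → ℂ := fun δ => (m : ℂ) ^ 2 / (4 * (δ - J)) with hb
  have hare : ∀ δ, (a δ).re = δ := fun δ => by simp [ha, hJre]
  have hmul : ∀ δ : ℝ, (a δ) * (δ - J) = ((δ ^ 2 + 1 : ℝ) : ℂ) := fun δ => by
    simp only [ha]; push_cast; linear_combination -hJJ
  have hne : ∀ δ : ℝ, ((δ : ℂ) - J) ≠ 0 := fun δ h => by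
    have h1 := hmul δ
    rw [h, mul_zero] at h1
    have : δ ^ 2 + 1 = 0 := by exact_mod_cast h1.symm
    nlinarith [sq_nonneg δ]
  have hane : ∀ δ : ℝ, a δ ≠ 0 := fun δ h => by
    have h1 := hmul δ
    rw [h, zero_mul] at h1
    have : δ ^ 2 + 1 = 0 := by exact_mod_cast h1.symm
    nlinarith [sq_nonneg δ]
  have hbeq : ∀ δ : ℝ, b δ = ((m ^ 2 / (4 * (δ ^ 2 + 1)) : ℝ) : ℂ) * a δ := fun δ => by
    have h1 := hmul δ
    have h2 := hne δ
    have h3 : ((δ ^ 2 + 1 : ℝ) : ℂ) ≠ 0 := by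
      have : (δ ^ 2 + 1 : ℝ) ≠ 0 := by positivity
      exact_mod_cast this
    rw [hb, Complex.ofReal_div, Complex.ofReal_mul, ← h1]
    have h4 := hane δ
    push_cast
    field_simp
  have hbre : ∀ δ : ℝ, 0 < δ → 0 < (b δ).re := fun δ hδ => by
    rw [hbeq, Complex.re_ofReal_mul, hare]; positivity
  have hbA : ∀ (δ : ℝ) (q : V), a δ + ‖q‖ ^ 2 / (4 * b δ) =
      δ * (1 + ‖q‖ ^ 2 / m ^ 2) + J * (1 - ‖q‖ ^ 2 / m ^ 2 : ℝ) := fun δ q => by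
    have := hne δ
    simp only [ha, hb]
    push_cast
    field_simp
    ring
  have hcontδ : ∀ z : ℂ, Tendsto (fun δ : ℝ => (δ : ℂ) + z) (𝓝[>] 0) (𝓝 z) := fun z => by
    have : Continuous fun δ : ℝ => (δ : ℂ) + z := by fun_prop
    simpa using (this.tendsto 0).mono_left nhdsWithin_le_nhds
  have haJ : Tendsto a (𝓝[>] 0) (𝓝 J) := hcontδ J
  have hbJ : Tendsto b (𝓝[>] 0) (𝓝 ((m : ℂ) ^ 2 / 4 * J)) := by
    have h1 : Tendsto (fun δ : ℝ => (m : ℂ) ^ 2 / (4 * (δ - J))) (𝓝[>] 0)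
        (𝓝 ((m : ℂ) ^ 2 / (4 * (-J)))) := by
      refine Tendsto.div tendsto_const_nhds ((hcontδ (-J)).const_mul 4) ?_
      simpa using hJ0
    have e : (m : ℂ) ^ 2 / (4 * (-J)) = (m : ℂ) ^ 2 / 4 * J := by
      field_simp; linear_combination -hJJ
    rwa [e] at h1
  have hab : ∀ (δ : ℝ) (y : V), a δ * (b δ * ‖y‖ ^ 2 + B) =
      ((m ^ 2 / (4 * (δ ^ 2 + 1)) * ‖y‖ ^ 2 : ℝ) : ℂ) * (a δ) ^ 2 + a δ * B := fun δ y => by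
    rw [hbeq]; push_cast; ring
  have haim : ∀ δ : ℝ, ((a δ) ^ 2).im = 2 * δ * σ := fun δ => by
    rw [sq, Complex.mul_im]; simp [ha, hJre, hJim]; ring
  have haBim : ∀ δ : ℝ, (a δ * B).im = m ^ 2 / 4 * σ * (ε - δ * t ^ 2) := fun δ => by
    rw [Complex.mul_im, hare, hBim, hBre]; simp [ha, hJim]; ring
  have hJB : J * B = (m : ℂ) ^ 2 / 4 * ((t : ℂ) ^ 2 + J * ε) := by
    rw [hB]; linear_combination -(m : ℂ) ^ 2 / 4 * (t : ℂ) ^ 2 * hJJ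
  obtain ⟨N, C, hC, hU⟩ := exists_norm_besselU_le α
  have hβ : -((n + 1 : ℂ) / 2) = -(α : ℂ) - 1 := by rw [hα]; push_cast; ring
  have hLap : ∀ δ : ℝ, 0 < δ → ∀ y : V, laplaceIntegral (-((n + 1 : ℂ) / 2)) (a δ)
      (b δ * ‖y‖ ^ 2 + B) = (Real.sqrt Real.pi : ℝ) * (a δ) ^ (α : ℂ) *
        besselU α (a δ * (b δ * ‖y‖ ^ 2 + B)) := by
    intro δ hδ y
    rw [hβ]
    refine laplaceIntegral_eq_besselU _ (by rw [hare]; exact hδ) ?_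
    have : b δ * (‖y‖ : ℂ) ^ 2 = ((‖y‖ ^ 2 : ℝ) : ℂ) * b δ := by push_cast; ring
    rw [this, Complex.add_re, Complex.re_ofReal_mul, hBre]
    have := hbre δ hδ
    positivity
  set M : ℝ := m ^ 2 / 4 + 2 * ‖B‖ with hM
  have hM0 : 0 ≤ M := by positivity
  set Q : ℝ := Real.sqrt Real.pi * (‖J ^ (α : ℂ)‖ + 1) *
    (C * (1 + M) ^ N / (m ^ 2 / 4 * (ε / 2)) ^ N) with hQ
  have haα : Tendsto (fun δ => (a δ) ^ (α : ℂ)) (𝓝[>] 0) (𝓝 (J ^ (α : ℂ))) :=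
    (continuousAt_cpow_const hJs).tendsto.comp haJ
  have key := integral_mul_eq_of_tendsto (integrable_slice φ t) (integrable_innerFourier_slice φ t)
    (a := a) (b := b) (B := B) (b₀ := (m : ℂ) ^ 2 / 4 * J)
    (L := fun y => (Real.sqrt Real.pi : ℝ) * J ^ (α : ℂ) *
      besselU α ((m : ℂ) ^ 2 * ((t : ℂ) ^ 2 - ‖y‖ ^ 2 + J * ε) / 4))
    (A₀ := fun q => J * (1 - ‖q‖ ^ 2 / m ^ 2 : ℝ))
    (bd := fun y => Q * (1 + ‖y‖) ^ (2 * N))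
    (g := fun q => |1 - ‖q‖ ^ 2 / m ^ 2| ^ (-(1 / 2) : ℝ))
    (by filter_upwards [self_mem_nhdsWithin] with δ hδ; rw [hare]; exact hδ)
    (by filter_upwards [self_mem_nhdsWithin] with δ hδ using hbre δ hδ)
    (by rw [hBre]; positivity) hbJ
    (by
      have e : 4 * (Real.pi : ℂ) * ((m : ℂ) ^ 2 / 4 * J) =
          Complex.I * (Real.pi * m ^ 2 * σ : ℝ) := by rw [hJ]; push_cast; ring
      rw [e]
      exact I_mul_ofReal_mem_slitPlane (by have := Real.pi_pos; positivity))
    ?_ ?_ ?_ ?_ ?_ ?_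
  · have hc : 4 * (Real.pi : ℂ) * ((m : ℂ) ^ 2 / 4 * J) = ((Real.pi * m ^ 2 : ℝ) : ℂ) * J := by
      push_cast; ring
    rw [hc, ofReal_mul_cpow (by have := Real.pi_pos; positivity) hJ0] at key
    simp_rw [mul_assoc] at key
    rw [integral_const_mul, integral_const_mul, integral_const_mul] at key
    have hpi := sqrt_pi_ne_zero
    have hJα : J ^ (α : ℂ) ≠ 0 := by simp [Complex.cpow_eq_zero_iff, hJ0]
    -- The exponents cancel because α + n/2 = n - 1/2. All powers are of the single number J, so no
    -- branch problem arises.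
    have hpow : J ^ (α : ℂ) * J ^ (n / 2 : ℂ) * J ^ (1 / 2 - (n : ℂ)) = 1 := by
      rw [← Complex.cpow_add _ _ hJ0, ← Complex.cpow_add _ _ hJ0, hα]
      push_cast
      ring_nf
      simp
    have hJn : J ^ (n / 2 : ℂ) ≠ 0 := by simp [Complex.cpow_eq_zero_iff, hJ0]
    refine mul_left_cancel₀ (mul_ne_zero hpi hJα) ?_
    simp_rw [mul_assoc]
    rw [key, mul_inv]
    have h5 : J ^ (1 / 2 - (n : ℂ)) * J ^ (α : ℂ) = (J ^ (n / 2 : ℂ))⁻¹ := by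
      refine eq_inv_of_mul_eq_one_left ?_
      linear_combination hpow
    rw [← h5]
    simp only [spatialFourier]
    ring
  · intro y
    have hz : (m : ℂ) ^ 2 * ((t : ℂ) ^ 2 - ‖y‖ ^ 2 + J * ε) / 4 ∈ Complex.slitPlane := by
      refine Or.inr ?_
      have e : (m : ℂ) ^ 2 * ((t : ℂ) ^ 2 - ‖y‖ ^ 2 + J * ε) / 4 =
        ((m ^ 2 * (t ^ 2 - ‖y‖ ^ 2) / 4 : ℝ) : ℂ) + ((m ^ 2 * σ * ε / 4 : ℝ) : ℂ) * Complex.I := by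
        rw [hJ]; push_cast; ring
      rw [e, Complex.add_im, Complex.im_ofReal_mul, Complex.I_im, Complex.ofReal_im]
      simp [hm.ne', hσ0, hε.ne']
    have h1 : Tendsto (fun δ : ℝ => a δ * (b δ * ‖y‖ ^ 2 + B)) (𝓝[>] 0)
        (𝓝 ((m : ℂ) ^ 2 * ((t : ℂ) ^ 2 - ‖y‖ ^ 2 + J * ε) / 4)) := by
      have h2 := haJ.mul ((hbJ.mul_const ((‖y‖ : ℂ) ^ 2)).add_const B)
      have e : J * ((m : ℂ) ^ 2 / 4 * J * ‖y‖ ^ 2 + B) =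
          (m : ℂ) ^ 2 * ((t : ℂ) ^ 2 - ‖y‖ ^ 2 + J * ε) / 4 := by
        linear_combination hJB + (m : ℂ) ^ 2 / 4 * ‖y‖ ^ 2 * hJJ
      rwa [e] at h2
    have h3 := (haα.const_mul ((Real.sqrt Real.pi : ℝ) : ℂ)).mul
      ((continuousAt_besselU α hz).tendsto.comp h1)
    refine h3.congr' ?_
    filter_upwards [self_mem_nhdsWithin] with δ hδ
    rw [hLap δ hδ y]
    rfl
  · have hsmall : ∀ᶠ δ in 𝓝[>] (0 : ℝ), δ * t ^ 2 < ε / 2 := by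
      have : Continuous fun δ : ℝ => δ * t ^ 2 := by fun_prop
      have h := (this.tendsto 0).mono_left (nhdsWithin_le_nhds (s := Set.Ioi 0))
      rw [zero_mul] at h
      exact h.eventually (gt_mem_nhds (half_pos hε))
    have hsmall' : ∀ᶠ δ in 𝓝[>] (0 : ℝ), ‖a δ‖ < 2 :=
      haJ.norm.eventually (gt_mem_nhds (by simp [hJ, hσa]))
    have hα' : ∀ᶠ δ in 𝓝[>] (0 : ℝ), ‖(a δ) ^ (α : ℂ)‖ < ‖J ^ (α : ℂ)‖ + 1 :=
      haα.norm.eventually (gt_mem_nhds (lt_add_one _))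
    filter_upwards [self_mem_nhdsWithin, hsmall, hsmall', hα'] with δ hδ h1 h2 h3 y
    have hδ : 0 < δ := hδ
    rw [hLap δ hδ y, norm_mul, norm_mul, Complex.norm_real,
      Real.norm_of_nonneg (Real.sqrt_nonneg _)]
    set z := a δ * (b δ * ‖y‖ ^ 2 + B) with hz
    -- Both contributions to Im z have the sign of σ once δt² < ε/2, so z stays at a distance from
    -- the cut that is uniform in y and δ. The polynomial bound on U_α then supplies the dominating
    -- function.
    have hzim : m ^ 2 / 4 * (ε / 2) ≤ |z.im| := by
      have h4 : z.im = σ * (m ^ 2 / (4 * (δ ^ 2 + 1)) * ‖y‖ ^ 2 * (2 * δ) +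
          m ^ 2 / 4 * (ε - δ * t ^ 2)) := by
        rw [hz, hab, Complex.add_im, Complex.im_ofReal_mul, haim, haBim]; ring
      rw [h4, abs_mul, hσa, one_mul]
      refine le_trans ?_ (le_abs_self _)
      have : 0 ≤ m ^ 2 / (4 * (δ ^ 2 + 1)) * ‖y‖ ^ 2 * (2 * δ) := by positivity
      have : m ^ 2 / 4 * (ε / 2) ≤ m ^ 2 / 4 * (ε - δ * t ^ 2) := by gcongr; linarith
      linarith
    have hz0 : z.im ≠ 0 := fun h0 => by
      rw [h0, abs_zero] at hzim
      have : 0 < m ^ 2 / 4 * (ε / 2) := by positivity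
      linarith
    have hzn : 1 + ‖z‖ ≤ (1 + M) * (1 + ‖y‖) ^ 2 := by
      have h5 : ‖a δ‖ ^ 2 = δ ^ 2 + 1 := by
        rw [← Complex.normSq_eq_norm_sq, Complex.normSq_apply, hare]
        have : (a δ).im = σ := by simp [ha, hJim]
        rw [this]; linear_combination hσ
      have h6 : ‖z‖ ≤ m ^ 2 / 4 * ‖y‖ ^ 2 + 2 * ‖B‖ := by
        rw [hz, hab]
        refine (norm_add_le _ _).trans (add_le_add (le_of_eq ?_) ?_)
        · rw [norm_mul, norm_pow, h5, Complex.norm_real, Real.norm_of_nonneg (by positivity)]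
          field_simp
        · rw [norm_mul]
          gcongr
      have h7 := norm_nonneg y
      have h8 := norm_nonneg B
      have h9 : 0 ≤ m ^ 2 := by positivity
      rw [hM]
      nlinarith [mul_nonneg h8 h7, mul_nonneg h9 h7, mul_nonneg h8 (sq_nonneg ‖y‖)]
    calc Real.sqrt Real.pi * ‖a δ ^ (α : ℂ)‖ * ‖besselU α z‖
        ≤ Real.sqrt Real.pi * (‖J ^ (α : ℂ)‖ + 1) *
          (C * (1 + ‖z‖) ^ N / |z.im| ^ N) := by
          gcongr
          exact hU z hz0
      _ ≤ Real.sqrt Real.pi * (‖J ^ (α : ℂ)‖ + 1) *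
          (C * ((1 + M) * (1 + ‖y‖) ^ 2) ^ N / (m ^ 2 / 4 * (ε / 2)) ^ N) := by
          gcongr
      _ = _ := by rw [hQ, mul_pow, pow_mul]; ring
  · refine ((integrable_pow_mul_slice φ t (2 * N)).const_mul Q).congr
      (Eventually.of_forall fun y => ?_)
    simp only
    ring
  · filter_upwards [ae_norm_ne (V := V) hm.ne'] with q hq
    have hx := one_sub_div_ne_zero hm (norm_nonneg q) hq
    set x := 1 - ‖q‖ ^ 2 / m ^ 2 with hxdef
    refine ⟨?_, ?_, Or.inr ?_⟩
    · simp_rw [hbA]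
      have : Continuous fun δ : ℝ => (δ : ℂ) * (1 + ‖q‖ ^ 2 / m ^ 2) + J * (x : ℝ) := by fun_prop
      have h := (this.tendsto 0).mono_left (nhdsWithin_le_nhds (s := Set.Ioi 0))
      rw [Complex.ofReal_zero, zero_mul, zero_add] at h
      exact h
    · have e : J * (x : ℝ) = Complex.I * (σ * x : ℝ) := by rw [hJ]; push_cast; ring
      rw [e]
      exact I_mul_ofReal_mem_slitPlane (mul_ne_zero hσ0 hx)
    · have e : J * (x : ℝ) * B = ((m ^ 2 / 4 * x * t ^ 2 : ℝ) : ℂ) +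
          ((m ^ 2 / 4 * x * (σ * ε) : ℝ) : ℂ) * Complex.I := by
        rw [mul_right_comm, hJB, hJ]; push_cast; ring
      rw [e, Complex.add_im, Complex.im_ofReal_mul, Complex.I_im, Complex.ofReal_im]
      simp [hm.ne', hσ0, hε.ne', hx]
  · filter_upwards [self_mem_nhdsWithin] with δ hδ
    filter_upwards [ae_norm_ne (V := V) hm.ne'] with q hq
    have hx := one_sub_div_ne_zero hm (norm_nonneg q) hq
    have e : (-(1 / 2) : ℂ) = ((-(1 / 2) : ℝ) : ℂ) := by push_cast; rfl
    rw [e, Complex.norm_cpow_real]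
    -- The imaginary part of a + |q|²/(4b) is σ(1 - |q|²/m²) for every δ; bounding the modulus below
    -- by it gives a dominating weight free of δ.
    refine Real.rpow_le_rpow_of_nonpos (abs_pos.2 hx) ?_ (by norm_num)
    refine le_trans (le_of_eq ?_) (Complex.abs_im_le_norm _)
    rw [hbA]
    have e2 : (δ : ℂ) * (1 + ‖q‖ ^ 2 / m ^ 2) + J * (1 - ‖q‖ ^ 2 / m ^ 2 : ℝ) =
        ((δ * (1 + ‖q‖ ^ 2 / m ^ 2) : ℝ) : ℂ) + ((σ * (1 - ‖q‖ ^ 2 / m ^ 2) : ℝ) : ℂ) *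
          Complex.I := by rw [hJ]; push_cast; ring
    rw [e2, Complex.add_im, Complex.im_ofReal_mul, Complex.I_im, Complex.ofReal_im, zero_add,
      mul_one, abs_mul, hσa, one_mul]
  · exact integrable_weight_mul_norm_spatialFourier
      (by fun_prop : Measurable fun q : V =>
        |1 - ‖q‖ ^ 2 / m ^ 2| ^ (-(1 / 2) : ℝ)).aestronglyMeasurable (fun q => by positivity)
      (integrable_rpow_neg_half_weight hm) φ t

end Slice

/-! ### The limiting kernel for de Sitter space and its cancellations -/

theorem ofReal_rpow_neg_half {x : ℝ} (hx : 0 ≤ x) :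
    (x : ℂ) ^ (-(1 / 2) : ℂ) = ((Real.sqrt x)⁻¹ : ℝ) := by
  have e : (-(1 / 2) : ℂ) = ((-(1 / 2) : ℝ) : ℂ) := by push_cast; rfl
  rw [e, ← Complex.ofReal_cpow hx, Real.rpow_neg hx, ← Real.sqrt_eq_rpow]

theorem ofReal_cpow_half {x : ℝ} (hx : 0 ≤ x) : (x : ℂ) ^ (1 / 2 : ℂ) = (Real.sqrt x : ℝ) := by
  have e : (1 / 2 : ℂ) = ((1 / 2 : ℝ) : ℂ) := by push_cast; rfl
  rw [e, ← Complex.ofReal_cpow hx, ← Real.sqrt_eq_rpow]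

theorem sqrt_abs_one_sub_div {m r : ℝ} (hm : 0 < m) :
    (Real.sqrt |1 - r ^ 2 / m ^ 2|)⁻¹ = m / Real.sqrt |m ^ 2 - r ^ 2| := by
  have e : 1 - r ^ 2 / m ^ 2 = (m ^ 2 - r ^ 2) / m ^ 2 := by field_simp
  rw [e, abs_div, abs_of_pos (by positivity : 0 < m ^ 2), Real.sqrt_div (abs_nonneg _),
    Real.sqrt_sq hm.le, inv_div]

/-- The spatial Fourier transform of the boundary value of `U_{d/2-1}(m² (-x² + iσ0) / 4)`, up to
the factor `(π m²)^{-(d-1)/2}`. -/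
def deSitterKernel (d : ℕ) (m σ : ℝ) (p : Mink d) : ℂ :=
  if ‖p.2‖ < m then ((Complex.I * σ) ^ (d - 1))⁻¹ * (m / Real.sqrt |m ^ 2 - ‖p.2‖ ^ 2| : ℝ) *
    Complex.exp (-(Real.sqrt |m ^ 2 - ‖p.2‖ ^ 2| * |p.1| : ℝ))
  else -((Complex.I * σ) ^ d)⁻¹ * (m / Real.sqrt |m ^ 2 - ‖p.2‖ ^ 2| : ℝ) *
    Complex.exp (Complex.I * σ * (Real.sqrt |m ^ 2 - ‖p.2‖ ^ 2| * |p.1| : ℝ))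

theorem measurable_deSitterKernel (d : ℕ) (m σ : ℝ) : Measurable (deSitterKernel d m σ) := by
  unfold deSitterKernel
  refine Measurable.ite (measurableSet_lt (by fun_prop) measurable_const) ?_ ?_ <;> fun_prop

theorem norm_I_mul_ofReal {σ : ℝ} (hσ : σ ^ 2 = 1) : ‖Complex.I * (σ : ℂ)‖ = 1 := by
  have hσa : |σ| = 1 := by rw [← sq_eq_sq₀ (abs_nonneg _) one_pos.le, sq_abs, hσ, one_pow]
  simp [hσa]

theorem norm_deSitterKernel_le (d : ℕ) {m σ : ℝ} (hm : 0 < m) (hσ : σ ^ 2 = 1) (p : Mink d) :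
    ‖deSitterKernel d m σ p‖ ≤ (Real.sqrt |1 - ‖p.2‖ ^ 2 / m ^ 2|)⁻¹ := by
  rw [sqrt_abs_one_sub_div hm]
  have h : ‖((m / Real.sqrt |m ^ 2 - ‖p.2‖ ^ 2| : ℝ) : ℂ)‖ = m / Real.sqrt |m ^ 2 - ‖p.2‖ ^ 2| := by
    rw [Complex.norm_real, Real.norm_of_nonneg (by positivity)]
  unfold deSitterKernel
  split_ifs
  · rw [norm_mul, norm_mul, h, norm_inv, norm_pow, norm_I_mul_ofReal hσ, one_pow, inv_one, one_mul,
      Complex.norm_exp, ← Complex.ofReal_neg, Complex.ofReal_re]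
    refine mul_le_of_le_one_right (by positivity) ?_
    rw [Real.exp_le_one_iff]
    have : 0 ≤ Real.sqrt |m ^ 2 - ‖p.2‖ ^ 2| * |p.1| := by positivity
    linarith
  · rw [norm_mul, norm_mul, h, norm_neg, norm_inv, norm_pow, norm_I_mul_ofReal hσ, one_pow, inv_one,
      one_mul, Complex.norm_exp]
    refine mul_le_of_le_one_right (by positivity) ?_
    rw [Complex.re_mul_ofReal]
    simp

/-- Convergence of the kernels of `integral_besselU_slice`. -/
theorem tendsto_slice_kernel (d : ℕ) (hd : 1 ≤ d) {m σ : ℝ} (hm : 0 < m) (hσ : σ ^ 2 = 1)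
    {p : Mink d} (ht : p.1 ≠ 0) (hq : ‖p.2‖ ≠ m) :
    Tendsto (fun ε : ℝ => (Complex.I * σ) ^ (1 / 2 - ((d : ℂ) - 1)) *
      ((Complex.I * σ * (1 - ‖p.2‖ ^ 2 / m ^ 2 : ℝ)) ^ (-(1 / 2) : ℂ) *
            Complex.exp (-2 * ((Complex.I * σ * (1 - ‖p.2‖ ^ 2 / m ^ 2 : ℝ)) *
              ((m : ℂ) ^ 2 / 4 * (ε - Complex.I * σ * (p.1 : ℂ) ^ 2))) ^ (1 / 2 : ℂ)))) (𝓝[>] 0)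
      (𝓝 (deSitterKernel d m σ p)) := by
  obtain ⟨t, q⟩ := p
  simp only at ht hq ⊢
  have hσ0 : σ ≠ 0 := fun h => by simp [h] at hσ
  set J : ℂ := Complex.I * σ with hJ
  have hJJ : J * J = -1 := I_mul_ofReal_mul_self hσ
  have hJs : J ∈ Complex.slitPlane := I_mul_ofReal_mem_slitPlane hσ0
  have hJ0 : J ≠ 0 := Complex.slitPlane_ne_zero hJs
  have hx := one_sub_div_ne_zero hm (norm_nonneg q) hq
  have hxs := sqrt_abs_one_sub_div (r := ‖q‖) hm
  set x := 1 - ‖q‖ ^ 2 / m ^ 2 with hxdef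
  set E := Real.sqrt |m ^ 2 - ‖q‖ ^ 2| with hE
  have hmx : m ^ 2 * x = m ^ 2 - ‖q‖ ^ 2 := by rw [hxdef]; field_simp
  have hE0 : 0 < E := by
    refine Real.sqrt_pos.2 (abs_pos.2 ?_)
    rw [← hmx]; exact mul_ne_zero (by positivity) hx
  have hE2 : E ^ 2 = |m ^ 2 - ‖q‖ ^ 2| := Real.sq_sqrt (abs_nonneg _)
  have hprod : ∀ ε : ℝ, J * (x : ℝ) * ((m : ℂ) ^ 2 / 4 * (ε - J * (t : ℂ) ^ 2)) =
      ((m ^ 2 - ‖q‖ ^ 2 : ℝ) : ℂ) * (((t : ℂ) ^ 2 + J * ε) / 4) := by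
    intro ε
    rw [← hmx]
    push_cast
    linear_combination -(x : ℂ) * m ^ 2 / 4 * t ^ 2 * hJJ
  simp_rw [hprod]
  unfold deSitterKernel
  simp only [← hE]
  rcases lt_or_gt_of_ne hq with hlt | hgt
  -- Inside the ball the radicand tends to the positive number (E|t|/2)², away from the cut, so the
  -- limit is a decaying exponential.
  · have hx0 : 0 < m ^ 2 - ‖q‖ ^ 2 := by nlinarith [norm_nonneg q]
    have hxp : 0 < x := by
      have : 0 < m ^ 2 * x := by rw [hmx]; exact hx0
      exact pos_of_mul_pos_right this (by positivity)
    rw [abs_of_pos hx0] at hE2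
    rw [if_pos hlt, mul_comm J (x : ℂ), ofReal_mul_cpow hxp hJ0, ofReal_rpow_neg_half hxp.le]
    rw [abs_of_pos hxp] at hxs
    rw [hxs]
    have h1 : Tendsto (fun ε : ℝ => (((m ^ 2 - ‖q‖ ^ 2 : ℝ) : ℂ) *
        (((t : ℂ) ^ 2 + J * ε) / 4)) ^ (1 / 2 : ℂ)) (𝓝[>] 0) (𝓝 ((E * |t| / 2 : ℝ) : ℂ)) := by
      have e : ((m ^ 2 - ‖q‖ ^ 2 : ℝ) : ℂ) * (((t : ℂ) ^ 2 + J * (0 : ℝ)) / 4) =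
          ((E * |t| / 2 : ℝ) : ℂ) * ((E * |t| / 2 : ℝ) : ℂ) := by
        rw [← hE2, mul_comm ((E * |t| / 2 : ℝ) : ℂ), ← Complex.ofReal_mul,
          show E * |t| / 2 * (E * |t| / 2) = E ^ 2 * (t ^ 2 / 4) by rw [← sq_abs t]; ring]
        push_cast; ring
      have hp : 0 < E * |t| / 2 := by have := abs_pos.2 ht; positivity
      have h2 := (continuousAt_cpow_const (b := (1 / 2 : ℂ)) (a := ((m ^ 2 - ‖q‖ ^ 2 : ℝ) : ℂ) *
        (((t : ℂ) ^ 2 + J * (0 : ℝ)) / 4)) (by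
          rw [e, ← Complex.ofReal_mul]
          exact Or.inl (by rw [Complex.ofReal_re]; positivity)))
      have h3 := ContinuousAt.comp (x := (0 : ℝ)) (f := fun ε : ℝ => ((m ^ 2 - ‖q‖ ^ 2 : ℝ) : ℂ) *
        (((t : ℂ) ^ 2 + J * ε) / 4)) h2 (Continuous.continuousAt (by fun_prop))
      have h4 := h3.tendsto.mono_left (nhdsWithin_le_nhds (s := Set.Ioi 0))
      simp only [Function.comp_def] at h4
      rwa [cpow_half_eq (v := ((E * |t| / 2 : ℝ) : ℂ)) (by rw [Complex.ofReal_re]; exact hp)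
        e.symm] at h4
    have h5 := (((h1.const_mul (-2)).cexp).const_mul (((m / E : ℝ) : ℂ) * J ^ (-(1 / 2) : ℂ))).const_mul
      (J ^ (1 / 2 - ((d : ℂ) - 1)))
    convert h5 using 2
    have e1 : J ^ (1 / 2 - ((d : ℂ) - 1)) * J ^ (-(1 / 2) : ℂ) = (J ^ (d - 1))⁻¹ := by
      rw [← Complex.cpow_add _ _ hJ0, ← Complex.cpow_natCast, ← Complex.cpow_neg,
        Nat.cast_sub hd]
      congr 1
      push_cast; ring
    have e2 : (-(E * |t| : ℝ) : ℂ) = -2 * ((E * |t| / 2 : ℝ) : ℂ) := by push_cast; ring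
    rw [← e1, e2]
    ring
  · have hx0 : m ^ 2 - ‖q‖ ^ 2 < 0 := by nlinarith [norm_nonneg q]
    have hxp : x < 0 := by
      have : m ^ 2 * x < 0 := by rw [hmx]; exact hx0
      by_contra! h
      have : 0 ≤ m ^ 2 * x := by positivity
      linarith
    rw [abs_of_neg hx0] at hE2
    have hnx : 0 < -x := by linarith
    rw [if_neg (not_lt.2 hgt.le)]
    -- Outside the ball x < 0. Writing Jx = |x| J⁻¹ extracts a positive scalar and keeps the
    -- remaining power on the principal branch.
    have e0 : J * (x : ℝ) = ((-x : ℝ) : ℂ) * J⁻¹ := by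
      have : J⁻¹ = -J := by
        rw [inv_eq_iff_eq_inv, eq_comm]
        refine inv_eq_of_mul_eq_one_left ?_
        linear_combination -hJJ
      rw [this]; push_cast; ring
    rw [e0, ofReal_mul_cpow hnx (inv_ne_zero hJ0), ofReal_rpow_neg_half hnx.le]
    rw [abs_of_neg hxp] at hxs
    rw [hxs, Complex.inv_cpow _ _ (Complex.mem_slitPlane_iff_arg.1 hJs).1]
    have h1 : Tendsto (fun ε : ℝ => (((m ^ 2 - ‖q‖ ^ 2 : ℝ) : ℂ) *
        (((t : ℂ) ^ 2 + J * ε) / 4)) ^ (1 / 2 : ℂ)) (𝓝[>] 0)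
          (𝓝 (((E / 2 : ℝ) : ℂ) * (Complex.I * (-σ : ℝ) * |t|))) := by
      have h2 := (tendsto_cpow_half_neg_sq (s := -σ) ht (by rw [neg_sq, hσ])).const_mul
        (((E / 2 : ℝ) : ℂ))
      refine h2.congr' ?_
      filter_upwards [self_mem_nhdsWithin] with ε hε
      have hε : 0 < ε := hε
      have h3 : -(t : ℂ) ^ 2 + Complex.I * (-σ * ε : ℝ) ≠ 0 := by
        intro h
        have h4 := congrArg Complex.im h
        have e : -(t : ℂ) ^ 2 + Complex.I * (-σ * ε : ℝ) =
          ((-t ^ 2 : ℝ) : ℂ) + ((-σ * ε : ℝ) : ℂ) * Complex.I := by push_cast; ring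
        rw [e, Complex.add_im, Complex.im_ofReal_mul, Complex.I_im, Complex.ofReal_im] at h4
        simp [hσ0, hε.ne'] at h4
      have h5 : ((m ^ 2 - ‖q‖ ^ 2 : ℝ) : ℂ) * (((t : ℂ) ^ 2 + J * ε) / 4) =
          (((E / 2) ^ 2 : ℝ) : ℂ) * (-(t : ℂ) ^ 2 + Complex.I * (-σ * ε : ℝ)) := by
        rw [div_pow, hE2, hJ]; push_cast; ring
      rw [h5, ofReal_mul_cpow (by positivity) h3, ofReal_cpow_half (by positivity),
        Real.sqrt_sq (by positivity)]
    have h5 := (((h1.const_mul (-2)).cexp).const_mul (((m / E : ℝ) : ℂ) *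
      (J ^ (-(1 / 2) : ℂ))⁻¹)).const_mul (J ^ (1 / 2 - ((d : ℂ) - 1)))
    convert h5 using 2
    -- The total exponent is 2 - d, and J² = -1 is the origin of the minus sign. Inside the ball the
    -- total is 1 - d instead.
    have e1 : J ^ (1 / 2 - ((d : ℂ) - 1)) * (J ^ (-(1 / 2) : ℂ))⁻¹ = -(J ^ d)⁻¹ := by
      rw [← Complex.cpow_neg, ← Complex.cpow_add _ _ hJ0, ← Complex.cpow_natCast J d,
        ← Complex.cpow_neg, show 1 / 2 - ((d : ℂ) - 1) + - -(1 / 2) = ((2 : ℕ) : ℂ) + -(d : ℂ) by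
          push_cast; ring, Complex.cpow_add _ _ hJ0, Complex.cpow_natCast, sq, hJJ]
      ring
    have e2 : J * (E * |t| : ℝ) = -2 * (((E / 2 : ℝ) : ℂ) * (Complex.I * (-σ : ℝ) * |t|)) := by
      rw [hJ]; push_cast; ring
    rw [← e1, e2]
    ring

theorem integrable_deSitterU_mul (d : ℕ) {m σ ε : ℝ} (hm : 0 < m) (hσ : σ ^ 2 = 1) (hε : 0 < ε)
    (φ : 𝓢(Mink d, ℂ)) : Integrable fun x => deSitterU d m σ ε x * φ x := by
  unfold deSitterU
  rw [half_sub_one_eq_ofReal]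
  have hσa : |σ| = 1 := by rw [← sq_eq_sq₀ (abs_nonneg _) one_pos.le, sq_abs, hσ, one_pow]
  have hmsq : Measurable fun x : Mink d => msq x := continuous_msq.measurable
  refine integrable_besselU_mul _ (c := m ^ 2 * ε / 4) (C := m ^ 2 * (2 + ε)) (k := 2)
    (by fun_prop) (by positivity) (Eventually.of_forall fun x => ?_) (fun x => ?_) φ
  · have e : (m : ℂ) ^ 2 * (-(msq x : ℝ) + Complex.I * (σ * ε : ℝ)) / 4 =
        ((-(m ^ 2 * msq x / 4) : ℝ) : ℂ) + ((m ^ 2 * (σ * ε) / 4 : ℝ) : ℂ) *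
          Complex.I := by push_cast; ring
    rw [e, Complex.add_im, Complex.ofReal_im, zero_add, Complex.im_ofReal_mul, Complex.I_im, mul_one,
      abs_div, abs_mul, abs_mul, hσa, abs_of_pos hε, one_mul, abs_of_pos (by positivity),
      abs_of_pos (by norm_num : (0 : ℝ) < 4)]
  · have h := norm_mul_add_I_le m (σ * ε) (r := -msq x) x (abs_neg _)
    rw [abs_mul, hσa, one_mul, abs_of_pos hε] at h
    push_cast at h ⊢
    exact h

/-- All kernels are dominated by the weight |1 - |q|²/m²|^{-1/2}, which is integrable after
multiplication by the decay of spatial transforms. Pointwise convergence fails at most on the null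
sets t = 0 and |q| = m. -/
theorem exists_isBoundaryValue_deSitterU (d : ℕ) (hd : 1 ≤ d) {m σ : ℝ} (hm : 0 < m)
    (hσ : σ ^ 2 = 1) : ∃ T : 𝓢'(Mink d, ℂ), IsBoundaryValue (deSitterU d m σ) T ∧
      ∀ φ, Integrable (fun p => deSitterKernel d m σ p * spatialFourier φ p) ∧
        T φ = (((Real.pi * m ^ 2 : ℝ) : ℂ) ^ (((d : ℂ) - 1) / 2))⁻¹ *
          ∫ p : Mink d, deSitterKernel d m σ p * spatialFourier φ p := by
  set c : ℂ := (((Real.pi * m ^ 2 : ℝ) : ℂ) ^ (((d : ℂ) - 1) / 2))⁻¹ with hc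
  set N := Module.finrank ℝ (EuclideanSpace ℝ (Fin (d - 1))) + 1 with hN
  set J : ℂ := Complex.I * σ with hJ
  have hJn : ‖J‖ = 1 := norm_I_mul_ofReal hσ
  set g : EuclideanSpace ℝ (Fin (d - 1)) → ℝ := fun q =>
    |1 - ‖q‖ ^ 2 / m ^ 2| ^ (-(1 / 2) : ℝ) with hg
  have hg0 : ∀ q, 0 ≤ g q := fun q => by positivity
  have hgs : ∀ q, g q = (Real.sqrt |1 - ‖q‖ ^ 2 / m ^ 2|)⁻¹ := fun q => by
    rw [hg, Real.sqrt_eq_rpow, ← Real.rpow_neg (abs_nonneg _)]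
  have hG : Integrable fun p : Mink d => g p.2 * decayWeight N p := by
    refine (integrable_time_decay.mul_prod (integrable_rpow_neg_half_weight
      (V := EuclideanSpace ℝ (Fin (d - 1))) hm)).congr (Eventually.of_forall fun p => ?_)
    simp only [decayWeight]
    ring
  have hKm := measurable_deSitterKernel d m σ
  have hKint : Integrable fun p => ‖deSitterKernel d m σ p‖ * decayWeight N p := by
    refine hG.mono' (hKm.norm.aestronglyMeasurable.mul
      (continuous_decayWeight N).aestronglyMeasurable) (Eventually.of_forall fun p => ?_)
    rw [Real.norm_of_nonneg (mul_nonneg (norm_nonneg _) (decayWeight_nonneg _ _)), hgs]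
    exact mul_le_mul_of_nonneg_right (norm_deSitterKernel_le d hm hσ p) (decayWeight_nonneg _ _)
  obtain ⟨T, hT⟩ := exists_kernel_distribution hKm.aestronglyMeasurable hKint
  refine ⟨c • T, ⟨fun ε hε φ => integrable_deSitterU_mul d hm hσ hε φ, fun φ => ?_⟩, fun φ =>
    ⟨integrable_kernel_mul hKm.aestronglyMeasurable hKint φ, by rw [← hT]; rfl⟩⟩
  have hcT : (c • T) φ = ∫ p, (c * deSitterKernel d m σ p) * spatialFourier φ p := by
    change c • T φ = _
    rw [hT, smul_eq_mul, ← integral_const_mul]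
    simp_rw [mul_assoc]
  rw [hcT]
  set Kε : ℝ → Mink d → ℂ := fun ε p => c * (J ^ (1 / 2 - ((d : ℂ) - 1)) *
      ((J * (1 - ‖p.2‖ ^ 2 / m ^ 2 : ℝ)) ^ (-(1 / 2) : ℂ) *
            Complex.exp (-2 * ((J * (1 - ‖p.2‖ ^ 2 / m ^ 2 : ℝ)) *
              ((m : ℂ) ^ 2 / 4 * (ε - J * (p.1 : ℂ) ^ 2))) ^ (1 / 2 : ℂ)))) with hKε
  refine tendsto_integral_of_kernel (Kε := Kε)
    (G := fun p => ‖c‖ * ‖J ^ (1 / 2 - ((d : ℂ) - 1))‖ * g p.2) (N := N) φ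
    (fun ε hε => integrable_deSitterU_mul d hm hσ hε φ) (fun ε hε => ?_)
    (fun ε _ => ?_) (fun ε hε => ?_) ?_ ?_
  · refine Eventually.of_forall fun t => ?_
    have h := integral_besselU_slice (V := EuclideanSpace ℝ (Fin (d - 1))) hm hσ hε
      (α := (d : ℝ) / 2 - 1) (by
        rw [finrank_euclideanSpace_fin, Nat.cast_sub hd]; push_cast; ring) φ t
    rw [mink_finrank d hd, ← half_sub_one_eq_ofReal, ← integral_const_mul, ← integral_const_mul] at h
    refine Eq.trans ?_ (h.trans ?_)
    · refine integral_congr_ae (Eventually.of_forall fun y => ?_)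
      simp only [deSitterU, msq_eq]
      congr 3
      push_cast
      ring
    · refine integral_congr_ae (Eventually.of_forall fun q => ?_)
      simp only [hKε]
      ring
  · refine Measurable.aestronglyMeasurable ?_
    rw [hKε]
    fun_prop
  · refine Eventually.of_forall fun p => ?_
    set x := 1 - ‖p.2‖ ^ 2 / m ^ 2 with hx
    have h1 : ‖(J * (x : ℝ)) ^ (-(1 / 2) : ℂ)‖ = g p.2 := by
      have e : (-(1 / 2) : ℂ) = ((-(1 / 2) : ℝ) : ℂ) := by push_cast; rfl
      rw [e, Complex.norm_cpow_real, norm_mul, hJn, one_mul, Complex.norm_real, Real.norm_eq_abs]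
    have h2 : ‖Complex.exp (-2 * (J * (x : ℝ) *
        ((m : ℂ) ^ 2 / 4 * (ε - J * (p.1 : ℂ) ^ 2))) ^ (1 / 2 : ℂ))‖ ≤ 1 := by
      refine norm_exp_neg_two_mul_le ?_
      have := Complex.abs_arg_le_pi (J * (x : ℝ) * ((m : ℂ) ^ 2 / 4 * (ε - J * (p.1 : ℂ) ^ 2)))
      rcases eq_or_ne (J * (x : ℝ) * ((m : ℂ) ^ 2 / 4 * (ε - J * (p.1 : ℂ) ^ 2))) 0 with h | h
      · rw [h]; simp
      · rw [Complex.cpow_def_of_ne_zero h, Complex.exp_re]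
        refine mul_nonneg (Real.exp_nonneg _) (Real.cos_nonneg_of_mem_Icc ?_)
        rw [show (1 / 2 : ℂ) = ((1 / 2 : ℝ) : ℂ) by norm_num, Complex.im_mul_ofReal, Complex.log_im]
        obtain ⟨h3, h4⟩ := abs_le.1 this
        constructor <;> linarith
    simp only [hKε]
    rw [norm_mul, norm_mul, norm_mul, h1]
    calc _ ≤ ‖c‖ * (‖J ^ (1 / 2 - ((d : ℂ) - 1))‖ * (g p.2 * 1)) := by
          have := hg0 p.2
          gcongr
      _ = _ := by ring
  · refine (hG.const_mul (‖c‖ * ‖J ^ (1 / 2 - ((d : ℂ) - 1))‖)).congr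
      (Eventually.of_forall fun p => ?_)
    simp only
    ring
  · filter_upwards [ae_of_ae_fst ae_ne_zero, ae_of_ae_snd (ae_norm_ne hm.ne')] with p hp hq
    exact (tendsto_slice_kernel d hd hm hσ hp hq).const_mul c

/-- For |q| < m the coefficients are i^d i^{-(d-1)} = i and (-i)^d (-i)^{-(d-1)} = -i, and the
exponential does not depend on σ, so the sum vanishes. For |q| > m both coefficients become 1 after
the overall sign, and e^{iE|t|} + e^{-iE|t|} is even in t, so it is the sum over both graphs. -/
theorem deSitterKernel_combination (d : ℕ) (hd : 1 ≤ d) (m : ℝ) (p : Mink d) :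
    -(Complex.I ^ d * deSitterKernel d m 1 p + (-Complex.I) ^ d * deSitterKernel d m (-1) p) =
      if ‖p.2‖ < m then 0 else (m / Real.sqrt |m ^ 2 - ‖p.2‖ ^ 2| : ℝ) *
        (Complex.exp (-Complex.I * (Real.sqrt |m ^ 2 - ‖p.2‖ ^ 2| * p.1 : ℝ)) +
        Complex.exp (-Complex.I * (-Real.sqrt |m ^ 2 - ‖p.2‖ ^ 2| * p.1 : ℝ))) := by
  obtain ⟨k, rfl⟩ : ∃ k, d = k + 1 := ⟨d - 1, by omega⟩
  have hI : Complex.I ≠ 0 := Complex.I_ne_zero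
  have hI' : -Complex.I ≠ 0 := neg_ne_zero.2 hI
  have h1 := pow_ne_zero k hI
  have h2 := pow_ne_zero k hI'
  have h3 := pow_ne_zero (k + 1) hI
  have h4 := pow_ne_zero (k + 1) hI'
  unfold deSitterKernel
  split_ifs
  · simp only [Complex.ofReal_one, mul_one, Complex.ofReal_neg, mul_neg, Nat.add_sub_cancel]
    rw [pow_succ, pow_succ]
    field_simp
    ring
  · simp only [Complex.ofReal_one, mul_one, Complex.ofReal_neg, mul_neg]
    field_simp
    rcases le_total 0 p.1 with h | h
    · rw [abs_of_nonneg h]; push_cast; ring_nf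
    · rw [abs_of_nonpos h]; push_cast; ring_nf

/-- The density blows up like an inverse square root at the equator |q| = m. It is controlled by the
same radial weight as the kernels of U, which keeps each half of the hyperboloid integrable. -/
theorem graphVolume_hyperboloid_fourier (d : ℕ) {m s : ℝ} (hm : 0 < m) (hs : s ^ 2 = 1)
    (φ : 𝓢(Mink d, ℂ)) :
    Integrable (fun p => ∫ x, Complex.exp (Complex.I * (mdot p x : ℝ)) * φ x)
        (graphVolume (fun q => s * Real.sqrt (‖q‖ ^ 2 - m ^ 2)) {q | m < ‖q‖}) ∧
      Integrable (fun p : Mink d => ({q | m < ‖q‖} : Set (EuclideanSpace ℝ (Fin (d - 1)))).indicator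
        (fun q => ((m / Real.sqrt |m ^ 2 - ‖q‖ ^ 2| : ℝ) : ℂ) *
          Complex.exp (-Complex.I * (s * Real.sqrt |m ^ 2 - ‖q‖ ^ 2| * p.1 : ℝ))) p.2 *
            spatialFourier φ p) ∧
      ∫ p, (∫ x, Complex.exp (Complex.I * (mdot p x : ℝ)) * φ x)
        ∂(graphVolume (fun q => s * Real.sqrt (‖q‖ ^ 2 - m ^ 2)) {q | m < ‖q‖}) =
      ∫ p : Mink d, ({q | m < ‖q‖} : Set (EuclideanSpace ℝ (Fin (d - 1)))).indicator
        (fun q => ((m / Real.sqrt |m ^ 2 - ‖q‖ ^ 2| : ℝ) : ℂ) *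
          Complex.exp (-Complex.I * (s * Real.sqrt |m ^ 2 - ‖q‖ ^ 2| * p.1 : ℝ))) p.2 *
            spatialFourier φ p := by
  set D : Set (EuclideanSpace ℝ (Fin (d - 1))) := {q | m < ‖q‖} with hD
  have hDm : MeasurableSet D := measurableSet_lt measurable_const (by fun_prop)
  set ρ : EuclideanSpace ℝ (Fin (d - 1)) → ℝ := fun q => m / Real.sqrt |m ^ 2 - ‖q‖ ^ 2| with hρ
  have hρm : Measurable ρ := by fun_prop
  have hρ0 : ∀ q, 0 ≤ ρ q := fun q => by positivity
  set N := Module.finrank ℝ (EuclideanSpace ℝ (Fin (d - 1))) + 1 with hN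
  have hpos : ∀ q ∈ D, |m ^ 2 - ‖q‖ ^ 2| = ‖q‖ ^ 2 - m ^ 2 ∧ 0 < ‖q‖ ^ 2 - m ^ 2 := fun q hq => by
    have hq : m < ‖q‖ := hq
    have : 0 < ‖q‖ ^ 2 - m ^ 2 := by nlinarith
    exact ⟨by rw [abs_sub_comm, abs_of_pos this], this⟩
  have hint : Integrable fun q => D.indicator ρ q * ((1 + ‖q‖) ^ N)⁻¹ := by
    refine (integrable_rpow_neg_half_weight (V := EuclideanSpace ℝ (Fin (d - 1))) hm).mono' ?_
      (Eventually.of_forall fun q => ?_)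
    · exact ((hρm.indicator hDm).mul (by fun_prop)).aestronglyMeasurable
    · have h1 : |1 - ‖q‖ ^ 2 / m ^ 2| ^ (-(1 / 2) : ℝ) = ρ q := by
        rw [Real.rpow_neg (abs_nonneg _), ← Real.sqrt_eq_rpow, sqrt_abs_one_sub_div hm]
      have h2 : 0 ≤ D.indicator ρ q := Set.indicator_nonneg (fun q _ => hρ0 q) q
      rw [h1, Real.norm_of_nonneg (by positivity)]
      refine mul_le_mul_of_nonneg_right ?_ (by positivity)
      exact Set.indicator_le_self' (fun q _ => hρ0 q) q
  obtain ⟨h1, h2⟩ := graphVolume_fourier (d := d) (D := D) (ρ := ρ) (N := N)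
    (h := fun q => s * Real.sqrt (‖q‖ ^ 2 - m ^ 2)) hDm (by fun_prop) hρm hρ0 (fun q hq => by
      have h := sqrt_abs_det_graphMetric (c := -m ^ 2) hs (q := q) (by linarith [(hpos q hq).2])
      rw [abs_neg, abs_of_pos (show 0 < m ^ 2 by positivity), Real.sqrt_sq hm.le] at h
      rw [hρ]
      simp only
      rw [(hpos q hq).1]
      exact h) hint φ
  have hK : (fun p : Mink d => D.indicator (fun q => (ρ q : ℂ) *
        Complex.exp (-Complex.I * (s * Real.sqrt (‖q‖ ^ 2 - m ^ 2) * p.1 : ℝ))) p.2) =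
      fun p : Mink d => D.indicator (fun q => (ρ q : ℂ) *
        Complex.exp (-Complex.I * (s * Real.sqrt |m ^ 2 - ‖q‖ ^ 2| * p.1 : ℝ))) p.2 := by
    ext p
    by_cases hp : p.2 ∈ D
    · rw [Set.indicator_of_mem hp, Set.indicator_of_mem hp, (hpos _ hp).1]
    · rw [Set.indicator_of_notMem hp, Set.indicator_of_notMem hp]
  refine ⟨h1, ?_, ?_⟩
  · have hKm : Measurable fun p : Mink d => D.indicator (fun q => (ρ q : ℂ) *
        Complex.exp (-Complex.I * (s * Real.sqrt |m ^ 2 - ‖q‖ ^ 2| * p.1 : ℝ))) p.2 := by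
      have : (fun p : Mink d => D.indicator (fun q => (ρ q : ℂ) *
          Complex.exp (-Complex.I * (s * Real.sqrt |m ^ 2 - ‖q‖ ^ 2| * p.1 : ℝ))) p.2) =
          (Prod.snd ⁻¹' D).indicator fun p : Mink d => (ρ p.2 : ℂ) *
            Complex.exp (-Complex.I * (s * Real.sqrt |m ^ 2 - ‖p.2‖ ^ 2| * p.1 : ℝ)) := by
        ext p; simp only [Set.indicator, Set.mem_preimage]
      rw [this]
      exact Measurable.indicator (by fun_prop) (measurable_snd hDm)
    refine integrable_kernel_mul (N := N) hKm.aestronglyMeasurable ?_ φ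
    refine (integrable_time_decay.mul_prod hint).congr (Eventually.of_forall fun p => ?_)
    have : ‖D.indicator (fun q => (ρ q : ℂ) *
        Complex.exp (-Complex.I * (s * Real.sqrt |m ^ 2 - ‖q‖ ^ 2| * p.1 : ℝ))) p.2‖ =
        D.indicator ρ p.2 := by
      simp only [Set.indicator]
      split_ifs
      · rw [norm_mul, Complex.norm_real, Real.norm_of_nonneg (hρ0 _), Complex.norm_exp]
        simp
      · simp
    simp only [this, decayWeight]
    ring
  · rw [h2]
    exact congrArg (fun K : Mink d → ℂ => ∫ p, K p * spatialFourier φ p) hK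

/-- The Fourier transform of the natural measure on de Sitter space. -/
theorem deSitter_fourier (d : ℕ) (hd : 1 ≤ d) {m : ℝ} (hm : 0 < m) :
    HasBoundaryValue (deSitterU d m 1) ∧ HasBoundaryValue (deSitterU d m (-1)) ∧
      IsFourierTransform (deSitterMeasure d m)
        ((-((m : ℂ) ^ (d - 1) * (Real.pi : ℂ) ^ (((d : ℂ) - 1) / 2))) •
          (Complex.I ^ d • boundaryValue (deSitterU d m 1) +
            (-Complex.I) ^ d • boundaryValue (deSitterU d m (-1)))) := by
  obtain ⟨T₁, hT₁, hφ₁⟩ := exists_isBoundaryValue_deSitterU d hd hm (σ := 1) (by norm_num)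
  obtain ⟨T₂, hT₂, hφ₂⟩ := exists_isBoundaryValue_deSitterU d hd hm (σ := -1) (by norm_num)
  refine ⟨⟨T₁, hT₁⟩, ⟨T₂, hT₂⟩, fun φ => ?_⟩
  obtain ⟨i1, j1, h1⟩ := graphVolume_hyperboloid_fourier d hm (s := 1) (by norm_num) φ
  obtain ⟨i2, j2, h2⟩ := graphVolume_hyperboloid_fourier d hm (s := -1) (by norm_num) φ
  simp only [one_mul, neg_one_mul] at i1 i2 h1 h2 j1 j2
  refine ⟨i1.add_measure i2, ?_⟩
  rw [deSitterMeasure, integral_add_measure i1 i2, h1, h2, boundaryValue_eq hT₁,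
    boundaryValue_eq hT₂]
  change (-((m : ℂ) ^ (d - 1) * (Real.pi : ℂ) ^ (((d : ℂ) - 1) / 2))) •
    (Complex.I ^ d • T₁ φ + (-Complex.I) ^ d • T₂ φ) = _
  rw [(hφ₁ φ).2, (hφ₂ φ).2, ← integral_add j1 j2]
  simp only [smul_eq_mul]
  have hc := exp_mul_cpow_cancel hm d hd
  set c := (((Real.pi * m ^ 2 : ℝ) : ℂ) ^ (((d : ℂ) - 1) / 2))⁻¹ with hcdef
  set I₁ := ∫ p : Mink d, deSitterKernel d m 1 p * spatialFourier φ p with hI₁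
  set I₂ := ∫ p : Mink d, deSitterKernel d m (-1) p * spatialFourier φ p with hI₂
  have e : -((m : ℂ) ^ (d - 1) * (Real.pi : ℂ) ^ (((d : ℂ) - 1) / 2)) *
      (Complex.I ^ d * (c * I₁) + (-Complex.I) ^ d * (c * I₂)) =
      -(Complex.I ^ d) * I₁ + -((-Complex.I) ^ d) * I₂ := by
    linear_combination -(Complex.I ^ d * I₁ + (-Complex.I) ^ d * I₂) * hc
  rw [e, hI₁, hI₂, ← integral_const_mul, ← integral_const_mul,
    ← integral_add ((hφ₁ φ).1.const_mul _) ((hφ₂ φ).1.const_mul _)]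
  refine integral_congr_ae (Eventually.of_forall fun p => ?_)
  have hk := deSitterKernel_combination d hd m p
  simp only
  rw [← add_mul]
  have e2 : -(Complex.I ^ d) * (deSitterKernel d m 1 p * spatialFourier φ p) +
      -((-Complex.I) ^ d) * (deSitterKernel d m (-1) p * spatialFourier φ p) =
      -(Complex.I ^ d * deSitterKernel d m 1 p + (-Complex.I) ^ d * deSitterKernel d m (-1) p) *
        spatialFourier φ p := by ring
  rw [e2, hk]
  congr 1
  rcases lt_trichotomy ‖p.2‖ m with h | h | h
  · have hn : p.2 ∉ ({q | m < ‖q‖} : Set (EuclideanSpace ℝ (Fin (d - 1)))) := not_lt.2 h.le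
    rw [if_pos h, Set.indicator_of_notMem hn, Set.indicator_of_notMem hn, add_zero]
  -- On the sphere |q| = m the root vanishes and division by zero gives 0, so the two integrands
  -- agree there as well.
  · have hn : p.2 ∉ ({q | m < ‖q‖} : Set (EuclideanSpace ℝ (Fin (d - 1)))) := not_lt.2 h.le
    rw [if_neg (not_lt.2 h.ge), Set.indicator_of_notMem hn, Set.indicator_of_notMem hn, h]
    simp
  · have hn : p.2 ∈ ({q | m < ‖q‖} : Set (EuclideanSpace ℝ (Fin (d - 1)))) := h
    rw [if_neg (not_lt.2 h.le), Set.indicator_of_mem hn, Set.indicator_of_mem hn, mul_add]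

/-! ### The powers `(w ± i0)^l` -/

theorem mul_cpow_of_re_pos {x y : ℂ} (hx0 : x ≠ 0) (hx : 0 ≤ x.re) (hy : 0 < y.re) (γ : ℂ) :
    (x * y) ^ γ = x ^ γ * y ^ γ := by
  have hy0 : y ≠ 0 := fun h => by simp [h] at hy
  have h1 := abs_le.1 (Complex.abs_arg_le_pi_div_two_iff.2 hx)
  have h2 := abs_lt.1 (Complex.abs_arg_lt_pi_div_two_iff.2 (Or.inl hy))
  rw [Complex.cpow_def_of_ne_zero (mul_ne_zero hx0 hy0), Complex.cpow_def_of_ne_zero hx0,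
    Complex.cpow_def_of_ne_zero hy0, ← Complex.exp_add,
    (Complex.log_mul_eq_add_log_iff hx0 hy0).2 ⟨by linarith, by linarith⟩, add_mul]

theorem integrableOn_exp_neg_div_mul_rpow {c s : ℝ} (hc : 0 < c) (hs : 0 < s) :
    IntegrableOn (fun τ : ℝ => Real.exp (-c / τ) * τ ^ (-s - 1)) (Set.Ioi 0) := by
  have h1 := integrableOn_rpow_mul_exp_neg_mul_rpow (s := s - 1) (p := 1) (by linarith) one_pos hc
  rw [← integrableOn_Ioi_comp_rpow_iff' _ (p := -1) (by norm_num)] at h1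
  refine h1.congr_fun (fun τ hτ => ?_) measurableSet_Ioi
  have hτ : 0 < τ := hτ
  simp only [smul_eq_mul, Real.rpow_one]
  rw [Real.rpow_neg_one, Real.inv_rpow hτ.le, ← Real.rpow_neg hτ.le, ← mul_assoc, ← Real.rpow_add hτ,
    mul_comm, div_eq_mul_inv]
  ring_nf

theorem norm_laplace_integrand_le {β A B : ℂ} (hA : 0 ≤ A.re) {c τ : ℝ} (hc : c ≤ B.re)
    (hτ : 0 < τ) : ‖Complex.exp (-(A * τ) - B / τ) * (τ : ℂ) ^ β‖ ≤ Real.exp (-c / τ) * τ ^ β.re := by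
  rw [norm_laplace_integrand β A B hτ]
  gcongr
  have h1 : c / τ ≤ B.re / τ := by gcongr
  have h2 : 0 ≤ A.re * τ := by positivity
  rw [neg_div]
  linarith

theorem laplaceIntegral_zero_ofReal {s x : ℝ} (hs : 0 < s) (hx : 0 < x) :
    laplaceIntegral (-(s : ℂ) - 1) 0 x = Complex.Gamma s * (x : ℂ) ^ (-(s : ℂ)) := by
  have h := Complex.integral_cpow_mul_exp_neg_mul_Ioi (a := (s : ℂ)) (r := x)
    (by simpa using hs) hx
  rw [← integral_comp_rpow_Ioi _ (p := -1) (by norm_num)] at h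
  rw [one_div, Complex.inv_cpow _ _ (by
    rw [Complex.arg_ofReal_of_nonneg hx.le]; exact Real.pi_pos.ne), ← Complex.cpow_neg] at h
  rw [mul_comm, ← h, laplaceIntegral]
  refine setIntegral_congr_fun measurableSet_Ioi fun τ hτ => ?_
  have hτ : 0 < τ := hτ
  have hτc : (τ : ℂ) ≠ 0 := by exact_mod_cast hτ.ne'
  simp only [abs_neg, abs_one, one_mul, Complex.real_smul, zero_mul, neg_zero, zero_sub]
  rw [Real.rpow_neg_one, show (-1 - 1 : ℝ) = ((-2 : ℤ) : ℝ) by norm_num, Real.rpow_intCast]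
  push_cast
  rw [Complex.inv_cpow _ _ (by
    rw [Complex.arg_ofReal_of_nonneg hτ.le]; exact Real.pi_pos.ne), ← Complex.cpow_neg,
    ← Complex.cpow_intCast, ← mul_assoc, ← Complex.cpow_add _ _ hτc, mul_comm, div_eq_mul_inv]
  congr 2
  push_cast
  ring

/-- For p > 0 this is Euler's integral after τ ↦ 1/τ; the identity theorem extends it to the right
half-plane. At A = 0, powers thus replace U_α in the Laplace representation. -/
theorem laplaceIntegral_zero {s : ℝ} (hs : 0 < s) {p : ℂ} (hp : 0 < p.re) :
    laplaceIntegral (-(s : ℂ) - 1) 0 p = Complex.Gamma s * p ^ (-(s : ℂ)) := by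
  have hopen : IsOpen {p : ℂ | 0 < p.re} := isOpen_lt continuous_const Complex.continuous_re
  have hdiff : DifferentiableOn ℂ (laplaceIntegral (-(s : ℂ) - 1) 0) {p : ℂ | 0 < p.re} := by
    intro w hw
    have hw : 0 < w.re := hw
    refine DifferentiableAt.differentiableWithinAt ?_
    have hre : (-(s : ℂ) - 1).re = -s - 1 := by simp
    have hder := hasDerivAt_integral_of_dominated_loc_of_deriv_le
      (μ := volume.restrict (Set.Ioi (0 : ℝ)))
      (F := fun (v : ℂ) (τ : ℝ) => Complex.exp (-(0 * τ) - v / τ) * (τ : ℂ) ^ (-(s : ℂ) - 1))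
      (F' := fun (v : ℂ) (τ : ℝ) => -(τ : ℂ)⁻¹ *
        (Complex.exp (-(0 * τ) - v / τ) * (τ : ℂ) ^ (-(s : ℂ) - 1)))
      (x₀ := w) (s := {v : ℂ | w.re / 2 < v.re})
      (bound := fun τ : ℝ => Real.exp (-(w.re / 2) / τ) * τ ^ (-(s + 1) - 1))
      ((isOpen_lt continuous_const Complex.continuous_re).mem_nhds (by simp; linarith))
      (Eventually.of_forall fun v =>
        (continuousOn_laplace_integrand _ 0 v).aestronglyMeasurable measurableSet_Ioi)
      ?_ ?_ ?_ ?_ ?_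
    · exact hder.2.differentiableAt
    · refine (integrableOn_exp_neg_div_mul_rpow hw hs).mono'
        ((continuousOn_laplace_integrand _ 0 w).aestronglyMeasurable measurableSet_Ioi) ?_
      filter_upwards [ae_restrict_mem measurableSet_Ioi] with τ hτ
      have h := norm_laplace_integrand_le (β := -(s : ℂ) - 1) (A := 0) (by simp) (le_refl w.re) hτ
      rwa [hre] at h
    · refine ContinuousOn.aestronglyMeasurable ?_ measurableSet_Ioi
      refine ContinuousOn.mul ?_ (continuousOn_laplace_integrand _ 0 w)
      intro τ hτ
      have hs0 : (τ : ℂ) ≠ 0 := by exact_mod_cast (ne_of_gt hτ)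
      exact ContinuousAt.continuousWithinAt (by fun_prop (disch := assumption))
    · filter_upwards [ae_restrict_mem measurableSet_Ioi] with τ hτ v hv
      have hτ' : 0 < τ := hτ
      have hv' : w.re / 2 < v.re := hv
      have h := norm_laplace_integrand_le (β := -(s : ℂ) - 1) (A := 0) (by simp) hv'.le hτ'
      rw [hre] at h
      rw [norm_mul, norm_neg, norm_inv, Complex.norm_real, Real.norm_of_nonneg hτ'.le]
      refine (mul_le_mul_of_nonneg_left h (by positivity)).trans (le_of_eq ?_)
      have e : τ ^ (-(s + 1) - 1) = τ ^ (-s - 1) / τ := by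
        rw [← Real.rpow_sub_one hτ'.ne']
        ring_nf
      rw [e]
      generalize τ ^ (-s - 1) = r
      ring
    · exact integrableOn_exp_neg_div_mul_rpow (by linarith) (by linarith)
    · filter_upwards with τ v _
      have h := ((((hasDerivAt_id v).div_const (τ : ℂ)).const_sub (-(0 * (τ : ℂ)))).cexp).mul_const
        ((τ : ℂ) ^ (-(s : ℂ) - 1))
      refine h.congr_deriv ?_
      simp only [id, one_div]
      ring
  have hdiff2 : DifferentiableOn ℂ (fun p : ℂ => Complex.Gamma s * p ^ (-(s : ℂ)))
      {p : ℂ | 0 < p.re} := fun w hw =>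
    ((differentiableAt_id.cpow_const (Or.inl hw)).const_mul _).differentiableWithinAt
  have hconn : IsPreconnected {p : ℂ | 0 < p.re} := (convex_halfSpace_re_gt 0).isPreconnected
  refine (hdiff.analyticOnNhd hopen).eqOn_of_preconnected_of_frequently_eq
    (hdiff2.analyticOnNhd hopen) hconn (z₀ := 1) (by simp) ?_ hp
  have h1 : Tendsto (fun x : ℝ => (x : ℂ)) (𝓝[>] 1) (𝓝[≠] (1 : ℂ)) := by
    refine tendsto_nhdsWithin_iff.2 ⟨?_, ?_⟩
    · exact (Complex.continuous_ofReal.tendsto' 1 1 (by simp)).mono_left nhdsWithin_le_nhds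
    · filter_upwards [self_mem_nhdsWithin] with x hx
      have hx : 1 < x := hx
      simpa using hx.ne'
  refine h1.frequently (Eventually.frequently ?_)
  filter_upwards [self_mem_nhdsWithin] with x hx
  have hx : 1 < x := hx
  exact laplaceIntegral_zero_ofReal hs (by linarith)

section Slice

variable {V : Type*} [NormedAddCommGroup V] [InnerProductSpace ℝ V] [FiniteDimensional ℝ V]
  [MeasurableSpace V] [BorelSpace V]

/-- Slices of `(w + iσε)^{-α}`, `w = -m² x² / 4`, as kernels. -/
theorem integral_cpow_slice (hV : 2 ≤ Module.finrank ℝ V) {m σ ε : ℝ} (hm : 0 < m)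
    (hσ : σ ^ 2 = 1) (hε : 0 < ε) {α : ℝ}
    (hα : α = ((Module.finrank ℝ V : ℝ) - 1) / 2) (φ : 𝓢(ℝ × V, ℂ)) (t : ℝ) :
    Complex.Gamma α * (Complex.I * σ) ^ (α : ℂ) *
      ∫ y, ((m : ℂ) ^ 2 / 4 * ((t : ℂ) ^ 2 - ‖y‖ ^ 2) + Complex.I * σ * ε) ^ (-(α : ℂ)) * φ (t, y) =
      ((4 * Real.pi * ((m : ℂ) ^ 2 / 4 * (Complex.I * σ))) ^ (Module.finrank ℝ V / 2 : ℂ))⁻¹ *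
        ∫ q, (Real.sqrt Real.pi : ℝ) * (Complex.I * (-σ) * (‖q‖ ^ 2 / m ^ 2 : ℝ)) ^ (-(1 / 2) : ℂ) *
            Complex.exp (-2 * ((Complex.I * (-σ) * (‖q‖ ^ 2 / m ^ 2 : ℝ)) *
              (ε - Complex.I * σ * ((m : ℂ) ^ 2 / 4 * (t : ℂ) ^ 2))) ^ (1 / 2 : ℂ)) *
            spatialFourier φ (t, q) := by
  set n := Module.finrank ℝ V with hn
  have hα0 : 0 < α := by
    have : (2 : ℝ) ≤ n := by exact_mod_cast hV
    rw [hα]; linarith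
  have hmc : (m : ℂ) ≠ 0 := by exact_mod_cast hm.ne'
  have hσ0 : σ ≠ 0 := fun h => by simp [h] at hσ
  have hσa : |σ| = 1 := by rw [← sq_eq_sq₀ (abs_nonneg _) one_pos.le, sq_abs, hσ, one_pow]
  have hJn : Complex.I * (-σ : ℂ) = -(Complex.I * σ) := by ring
  rw [hJn]
  set J : ℂ := Complex.I * σ with hJ
  have hJJ : J * J = -1 := I_mul_ofReal_mul_self hσ
  have hJs : J ∈ Complex.slitPlane := I_mul_ofReal_mem_slitPlane hσ0
  have hJ0 : J ≠ 0 := Complex.slitPlane_ne_zero hJs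
  have hJre : J.re = 0 := by simp [hJ]
  have hJim : J.im = σ := by simp [hJ]
  set B : ℂ := ε - J * ((m : ℂ) ^ 2 / 4 * (t : ℂ) ^ 2) with hB
  have hBeq : B = (ε : ℂ) + ((-(m ^ 2 / 4 * σ * t ^ 2) : ℝ) : ℂ) * Complex.I := by
    rw [hB, hJ]; push_cast; ring
  have hBre : B.re = ε := by
    rw [hBeq, Complex.add_re, Complex.re_ofReal_mul, Complex.I_re, Complex.ofReal_re]; ring
  -- Now a tends to 0 rather than to J, so the limiting Laplace integral is a power. The number b is
  -- again tilted by δ into the right half-plane, and J(m²J|y|²/4 + B) = w + iσε.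
  set a : ℝ → ℂ := fun δ => δ with ha
  set b : ℝ → ℂ := fun δ => (m : ℂ) ^ 2 / 4 * (δ + J) with hb
  have hmul : ∀ δ : ℝ, (δ + J) * (δ - J) = ((δ ^ 2 + 1 : ℝ) : ℂ) := fun δ => by
    push_cast; linear_combination -hJJ
  have hne : ∀ δ : ℝ, ((δ : ℂ) + J) ≠ 0 := fun δ h => by
    have h1 := hmul δ
    rw [h, zero_mul] at h1
    have : δ ^ 2 + 1 = 0 := by exact_mod_cast h1.symm
    nlinarith [sq_nonneg δ]
  have hbre : ∀ δ : ℝ, (b δ).re = m ^ 2 / 4 * δ := fun δ => by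
    have : b δ = ((m ^ 2 / 4 : ℝ) : ℂ) * (δ + J) := by rw [hb]; push_cast; rfl
    rw [this, Complex.re_ofReal_mul]; simp [hJre]
  have hpre : ∀ δ : ℝ, ∀ y : V, (b δ * ‖y‖ ^ 2 + B).re = m ^ 2 / 4 * δ * ‖y‖ ^ 2 + ε := by
    intro δ y
    have : b δ * (‖y‖ : ℂ) ^ 2 = ((‖y‖ ^ 2 : ℝ) : ℂ) * b δ := by push_cast; ring
    rw [this, Complex.add_re, Complex.re_ofReal_mul, hbre, hBre]; ring
  have hbA : ∀ (δ : ℝ) (q : V), a δ + ‖q‖ ^ 2 / (4 * b δ) =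
      δ + (‖q‖ ^ 2 / (m ^ 2 * (δ ^ 2 + 1)) : ℝ) * (δ - J) := fun δ q => by
    have h1 := hne δ
    have h3 : (δ : ℂ) - J ≠ 0 := fun h => by
      have h1 := hmul δ
      rw [h, mul_zero] at h1
      have : δ ^ 2 + 1 = 0 := by exact_mod_cast h1.symm
      nlinarith [sq_nonneg δ]
    simp only [ha, hb]
    rw [Complex.ofReal_div, Complex.ofReal_mul, ← hmul]
    push_cast
    field_simp
  have hbJ : Tendsto b (𝓝[>] 0) (𝓝 ((m : ℂ) ^ 2 / 4 * J)) := by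
    have : Continuous b := by fun_prop
    have h := (this.tendsto 0).mono_left (nhdsWithin_le_nhds (s := Set.Ioi 0))
    simpa [hb] using h
  have hβ : -((n + 1 : ℂ) / 2) = -(α : ℂ) - 1 := by rw [hα]; push_cast; ring
  have hβre : (-(α : ℂ) - 1).re = -α - 1 := by simp
  have hint := integrableOn_exp_neg_div_mul_rpow hε hα0
  have key := integral_mul_eq_of_tendsto (integrable_slice φ t) (integrable_innerFourier_slice φ t)
    (a := a) (b := b) (B := B) (b₀ := (m : ℂ) ^ 2 / 4 * J)
    (L := fun y => laplaceIntegral (-(α : ℂ) - 1) 0 ((m : ℂ) ^ 2 / 4 * J * ‖y‖ ^ 2 + B))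
    (A₀ := fun q => -J * (‖q‖ ^ 2 / m ^ 2 : ℝ))
    (bd := fun _ => ∫ τ in Set.Ioi (0 : ℝ), Real.exp (-ε / τ) * τ ^ (-α - 1))
    (g := fun q => Real.sqrt 2 * m * ‖q‖⁻¹)
    (by filter_upwards [self_mem_nhdsWithin] with δ hδ using by simpa [ha] using hδ)
    (by filter_upwards [self_mem_nhdsWithin] with δ hδ
        have hδ : 0 < δ := hδ
        rw [hbre]; positivity)
    (by rw [hBre]; exact hε) hbJ
    (by
      have e : 4 * (Real.pi : ℂ) * ((m : ℂ) ^ 2 / 4 * J) =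
          Complex.I * (Real.pi * m ^ 2 * σ : ℝ) := by rw [hJ]; push_cast; ring
      rw [e]
      exact I_mul_ofReal_mem_slitPlane (by have := Real.pi_pos; positivity))
    ?_ ?_ ((integrable_slice φ t).norm.const_mul _) ?_ ?_ ?_
  · rw [← integral_const_mul]
    refine Eq.trans (integral_congr_ae (Eventually.of_forall fun y => ?_)) key
    have h0 := hpre 0 y
    have hb0 : b 0 = (m : ℂ) ^ 2 / 4 * J := by simp [hb]
    rw [hb0] at h0
    simp only
    rw [laplaceIntegral_zero hα0 (by rw [h0]; positivity), ← mul_assoc]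
    congr 1
    have e : (m : ℂ) ^ 2 / 4 * ((t : ℂ) ^ 2 - ‖y‖ ^ 2) + J * ε =
        J * ((m : ℂ) ^ 2 / 4 * J * ‖y‖ ^ 2 + B) := by
      rw [hB]
      linear_combination ((m : ℂ) ^ 2 / 4 * (t : ℂ) ^ 2 - (m : ℂ) ^ 2 / 4 * ‖y‖ ^ 2) * hJJ
    rw [e, mul_cpow_of_re_pos hJ0 hJre.ge (by rw [h0]; positivity)]
    have : J ^ (α : ℂ) * J ^ (-(α : ℂ)) = 1 := by
      rw [← Complex.cpow_add _ _ hJ0]; simp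
    linear_combination Complex.Gamma α *
      ((m : ℂ) ^ 2 / 4 * J * ‖y‖ ^ 2 + B) ^ (-(α : ℂ)) * this
  · intro y
    rw [hβ]
    refine tendsto_integral_filter_of_dominated_convergence
      (fun τ => Real.exp (-ε / τ) * τ ^ (-α - 1)) ?_ ?_ hint ?_
    · exact Eventually.of_forall fun δ =>
        (continuousOn_laplace_integrand _ _ _).aestronglyMeasurable measurableSet_Ioi
    · filter_upwards [self_mem_nhdsWithin] with δ hδ
      have hδ : 0 < δ := hδ
      filter_upwards [ae_restrict_mem measurableSet_Ioi] with τ hτ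
      have h := norm_laplace_integrand_le (β := -(α : ℂ) - 1) (A := a δ)
        (B := b δ * ‖y‖ ^ 2 + B) (by simpa [ha] using hδ.le) (c := ε)
        (by rw [hpre]; have : 0 ≤ m ^ 2 / 4 * δ * ‖y‖ ^ 2 := by positivity
            linarith) hτ
      rwa [hβre] at h
    · refine Eventually.of_forall fun τ => ?_
      have : Continuous fun δ : ℝ => Complex.exp (-(a δ * τ) - (b δ * ‖y‖ ^ 2 + B) / τ) *
        (τ : ℂ) ^ (-(α : ℂ) - 1) := by
        simp only [ha, hb]
        simp only [div_eq_mul_inv]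
        fun_prop
      have h := (this.tendsto 0).mono_left (nhdsWithin_le_nhds (s := Set.Ioi 0))
      simpa [ha, hb] using h
  · filter_upwards [self_mem_nhdsWithin] with δ hδ y
    have hδ : 0 < δ := hδ
    rw [hβ]
    refine norm_integral_le_of_norm_le hint ?_
    filter_upwards [ae_restrict_mem measurableSet_Ioi] with τ hτ
    have h := norm_laplace_integrand_le (β := -(α : ℂ) - 1) (A := a δ)
      (B := b δ * ‖y‖ ^ 2 + B) (by simpa [ha] using hδ.le) (c := ε)
      (by rw [hpre]; have : 0 ≤ m ^ 2 / 4 * δ * ‖y‖ ^ 2 := by positivity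
          linarith) hτ
    rwa [hβre] at h
  · have hnt : Nontrivial V := Module.nontrivial_of_finrank_pos (R := ℝ) (by omega)
    have hne0 : ∀ᵐ q : V, q ≠ 0 := by rw [ae_iff]; simp
    filter_upwards [hne0] with q hq
    have hq0 : ‖q‖ ≠ 0 := norm_ne_zero_iff.2 hq
    refine ⟨?_, ?_, Or.inr ?_⟩
    · have h : Tendsto (fun δ => a δ + ‖q‖ ^ 2 / (4 * b δ)) (𝓝[>] 0)
          (𝓝 ((0 : ℝ) + ‖q‖ ^ 2 / (4 * ((m : ℂ) ^ 2 / 4 * J)))) := by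
        refine Tendsto.add ?_ (Tendsto.div tendsto_const_nhds (hbJ.const_mul 4) ?_)
        · exact (Complex.continuous_ofReal.tendsto 0).mono_left nhdsWithin_le_nhds
        · simp [hJ0, hm.ne']
      have e : ((0 : ℝ) : ℂ) + ‖q‖ ^ 2 / (4 * ((m : ℂ) ^ 2 / 4 * J)) =
          -J * (‖q‖ ^ 2 / m ^ 2 : ℝ) := by
        push_cast
        field_simp
        linear_combination (‖q‖ : ℂ) ^ 2 * hJJ
      rwa [e] at h
    · have e : -J * (‖q‖ ^ 2 / m ^ 2 : ℝ) = Complex.I * (-(σ * (‖q‖ ^ 2 / m ^ 2)) : ℝ) := by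
        rw [hJ]; push_cast; ring
      rw [e]
      exact I_mul_ofReal_mem_slitPlane (by
        have : ‖q‖ ^ 2 / m ^ 2 ≠ 0 := by positivity
        exact neg_ne_zero.2 (mul_ne_zero hσ0 this))
    · have e : -J * (‖q‖ ^ 2 / m ^ 2 : ℝ) * B = ((-(‖q‖ ^ 2 * t ^ 2 / 4) : ℝ) : ℂ) +
          ((-(‖q‖ ^ 2 / m ^ 2 * (σ * ε)) : ℝ) : ℂ) * Complex.I := by
        rw [hB]
        push_cast
        field_simp
        linear_combination ((‖q‖ : ℂ) ^ 2 * m ^ 2 * (t : ℂ) ^ 2) * hJJ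
      rw [e, Complex.add_im, Complex.im_ofReal_mul, Complex.I_im, Complex.ofReal_im]
      simp [hm.ne', hσ0, hε.ne', hq]
  · filter_upwards [self_mem_nhdsWithin, mem_nhdsWithin_of_mem_nhds (Iio_mem_nhds one_pos)] with δ hδ hδ1
    have hδ : 0 < δ := hδ
    have hδ1 : δ < 1 := hδ1
    have hnt : Nontrivial V := Module.nontrivial_of_finrank_pos (R := ℝ) (by omega)
    have hne0 : ∀ᵐ q : V, q ≠ 0 := by rw [ae_iff]; simp
    filter_upwards [hne0] with q hq
    have hq0 : 0 < ‖q‖ := norm_pos_iff.2 hq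
    have e : (-(1 / 2) : ℂ) = ((-(1 / 2) : ℝ) : ℂ) := by push_cast; rfl
    rw [e, Complex.norm_cpow_real]
    -- The constant √2 comes from δ² + 1 ≤ 2 for δ < 1.
    have e3 : Real.sqrt 2 * m * ‖q‖⁻¹ = (‖q‖ ^ 2 / (m ^ 2 * 2)) ^ (-(1 / 2) : ℝ) := by
      rw [Real.rpow_neg (by positivity), ← Real.sqrt_eq_rpow, Real.sqrt_div (by positivity),
        Real.sqrt_sq hq0.le, Real.sqrt_mul (by positivity), Real.sqrt_sq hm.le]
      field_simp
    rw [e3]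
    refine Real.rpow_le_rpow_of_nonpos (by positivity) ?_ (by norm_num)
    refine le_trans ?_ (Complex.abs_im_le_norm _)
    rw [hbA]
    have e2 : (δ : ℂ) + (‖q‖ ^ 2 / (m ^ 2 * (δ ^ 2 + 1)) : ℝ) * (δ - J) =
        ((δ + ‖q‖ ^ 2 / (m ^ 2 * (δ ^ 2 + 1)) * δ : ℝ) : ℂ) +
          ((-(σ * (‖q‖ ^ 2 / (m ^ 2 * (δ ^ 2 + 1)))) : ℝ) : ℂ) *
          Complex.I := by rw [hJ]; push_cast; ring
    rw [e2, Complex.add_im, Complex.im_ofReal_mul, Complex.I_im, Complex.ofReal_im, zero_add,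
      mul_one, abs_neg, abs_mul, hσa, one_mul, abs_of_pos (by positivity)]
    gcongr
    nlinarith
  · refine integrable_weight_mul_norm_spatialFourier (N := n + 1)
      (by fun_prop : Measurable fun q : V => Real.sqrt 2 * m * ‖q‖⁻¹).aestronglyMeasurable
      (fun q => by positivity) ?_ φ t
    refine ((integrable_norm_inv_weight hV).const_mul (Real.sqrt 2 * m)).congr
      (Eventually.of_forall fun q => ?_)
    simp only
    ring

end Slice

theorem warg_eq {d : ℕ} (m : ℝ) (x : Mink d) : warg m x = m ^ 2 / 4 * (x.1 ^ 2 - ‖x.2‖ ^ 2) := by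
  rw [warg, msq_eq]; ring

theorem continuous_warg {d : ℕ} (m : ℝ) : Continuous fun x : Mink d => warg m x := by
  have := continuous_msq (d := d)
  unfold warg
  fun_prop

theorem abs_eq_one_of_sq {σ : ℝ} (hσ : σ ^ 2 = 1) : |σ| = 1 := by
  rw [← sq_eq_sq₀ (abs_nonneg _) one_pos.le, sq_abs, hσ, one_pow]

theorem im_add_I_mul (w τ : ℝ) : ((w : ℂ) + Complex.I * (τ : ℝ)).im = τ := by simp

theorem re_add_I_mul (w τ : ℝ) : ((w : ℂ) + Complex.I * (τ : ℝ)).re = w := by simp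

theorem le_norm_add_I_mul {σ : ℝ} (hσ : σ ^ 2 = 1) (w : ℝ) {ε : ℝ} (hε : 0 < ε) :
    ε ≤ ‖(w : ℂ) + Complex.I * (σ * ε : ℝ)‖ := by
  refine le_trans (le_of_eq ?_) (Complex.abs_im_le_norm _)
  rw [im_add_I_mul, abs_mul, abs_eq_one_of_sq hσ, one_mul, abs_of_pos hε]

theorem measurable_wPow (d : ℕ) (m σ : ℝ) (l : ℂ) (ε : ℝ) : Measurable (wPow d m σ l ε) := by
  have : Measurable fun x : Mink d => warg m x := (continuous_warg m).measurable
  unfold wPow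
  fun_prop

theorem integrable_wPow_mul (d : ℕ) (m : ℝ) {σ ε : ℝ} (hσ : σ ^ 2 = 1) (hε : 0 < ε) {l : ℝ}
    (hl : l ≤ 0) (φ : 𝓢(Mink d, ℂ)) : Integrable fun x => wPow d m σ l ε x * φ x := by
  refine integrable_mul_schwartz_of_growth (C := ε ^ l) (k := 0)
    (measurable_wPow d m σ l ε).aestronglyMeasurable (Eventually.of_forall fun x => ?_) φ
  rw [wPow, Complex.norm_cpow_real, pow_zero, mul_one]
  exact Real.rpow_le_rpow_of_nonpos hε (le_norm_add_I_mul hσ _ hε) hl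

/-- The order d/2 - 1 is again the one for which the partial transform is elementary. The kernels
are bounded by a multiple of 1/|q|, which is locally integrable when the space has dimension at
least 2; this is the role of d ≥ 3. -/
theorem hasBoundaryValue_wPow_top (d : ℕ) (hd : 3 ≤ d) {m σ : ℝ} (hm : 0 < m) (hσ : σ ^ 2 = 1) :
    HasBoundaryValue (wPow d m σ (1 - (d : ℂ) / 2)) := by
  set V := EuclideanSpace ℝ (Fin (d - 1)) with hV
  have hrank : Module.finrank ℝ V = d - 1 := finrank_euclideanSpace_fin
  have hd1 : 1 ≤ d := by omega
  set N := Module.finrank ℝ V + 1 with hN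
  set α : ℝ := (d : ℝ) / 2 - 1 with hα
  have hd3 : (3 : ℝ) ≤ d := by exact_mod_cast hd
  have hl : 1 - (d : ℂ) / 2 = ((-α : ℝ) : ℂ) := by rw [hα]; push_cast; ring
  have hint : ∀ ε, 0 < ε → ∀ φ : 𝓢(Mink d, ℂ),
      Integrable fun x => wPow d m σ (1 - (d : ℂ) / 2) ε x * φ x := fun ε hε φ => by
    rw [hl]; exact integrable_wPow_mul d m hσ hε (by rw [hα]; linarith) φ
  have hσ0 : σ ≠ 0 := fun h => by simp [h] at hσ
  set J : ℂ := Complex.I * σ with hJ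
  have hJJ : J * J = -1 := I_mul_ofReal_mul_self hσ
  have hJ0 : J ≠ 0 := Complex.slitPlane_ne_zero (I_mul_ofReal_mem_slitPlane hσ0)
  have hΓ : Complex.Gamma α * J ^ (α : ℂ) ≠ 0 := by
    refine mul_ne_zero (Complex.Gamma_ne_zero_of_re_pos ?_) (by simp [Complex.cpow_eq_zero_iff, hJ0])
    rw [Complex.ofReal_re, hα]; linarith
  set c : ℂ := (Complex.Gamma α * J ^ (α : ℂ))⁻¹ * (((4 * Real.pi * ((m : ℂ) ^ 2 / 4 * J)) ^
    (((d : ℂ) - 1) / 2))⁻¹ * (Real.sqrt Real.pi : ℝ)) with hc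
  set K : Mink d → ℂ := fun p => c * ((Complex.I * (-σ) * (‖p.2‖ ^ 2 / m ^ 2 : ℝ)) ^ (-(1 / 2) : ℂ) *
    Complex.exp (-2 * (((‖p.2‖ / 2 : ℝ) : ℂ) * (Complex.I * (-σ : ℝ) * |p.1|)))) with hK
  set Kε : ℝ → Mink d → ℂ := fun ε p => c *
    ((Complex.I * (-σ) * (‖p.2‖ ^ 2 / m ^ 2 : ℝ)) ^ (-(1 / 2) : ℂ) *
      Complex.exp (-2 * ((Complex.I * (-σ) * (‖p.2‖ ^ 2 / m ^ 2 : ℝ)) *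
              (ε - Complex.I * σ * ((m : ℂ) ^ 2 / 4 * (p.1 : ℂ) ^ 2))) ^ (1 / 2 : ℂ))) with hKε
  have hA : ∀ q : V, ‖(Complex.I * (-σ) * (‖q‖ ^ 2 / m ^ 2 : ℝ)) ^ (-(1 / 2) : ℂ)‖ = m * ‖q‖⁻¹ := by
    intro q
    have e : (-(1 / 2) : ℂ) = ((-(1 / 2) : ℝ) : ℂ) := by push_cast; rfl
    have e2 : ‖Complex.I * (-σ : ℂ)‖ = 1 := by
      rw [mul_neg, norm_neg]; exact norm_I_mul_ofReal hσ
    rw [e, Complex.norm_cpow_real, norm_mul, e2, one_mul, Complex.norm_real,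
      Real.norm_of_nonneg (by positivity), Real.rpow_neg (by positivity), ← Real.sqrt_eq_rpow,
      Real.sqrt_div (by positivity), Real.sqrt_sq (norm_nonneg _), Real.sqrt_sq hm.le, inv_div,
      div_eq_mul_inv]
  have hG : Integrable fun p : Mink d => ‖c‖ * (m * ‖p.2‖⁻¹) * decayWeight N p := by
    refine ((integrable_time_decay.mul_prod (integrable_norm_inv_weight (V := V)
      (by omega))).const_mul (‖c‖ * m)).congr (Eventually.of_forall fun p => ?_)
    simp only [decayWeight]
    ring
  have hKm : Measurable K := by fun_prop
  have hKεm : ∀ ε, Measurable (Kε ε) := fun ε => by simp only [hKε]; fun_prop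
  have hKn : ∀ p, ‖K p‖ ≤ ‖c‖ * (m * ‖p.2‖⁻¹) := by
    intro p
    simp only [hK]
    rw [norm_mul c, norm_mul ((Complex.I * _ * _) ^ (_ : ℂ)), hA]
    refine mul_le_mul_of_nonneg_left (mul_le_of_le_one_right (by positivity) ?_) (norm_nonneg _)
    refine norm_exp_neg_two_mul_le ?_
    simp
  have hKint : Integrable fun p => ‖K p‖ * decayWeight N p := by
    refine hG.mono' (hKm.norm.aestronglyMeasurable.mul
      (continuous_decayWeight N).aestronglyMeasurable) (Eventually.of_forall fun p => ?_)
    rw [Real.norm_of_nonneg (mul_nonneg (norm_nonneg _) (decayWeight_nonneg _ _))]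
    exact mul_le_mul_of_nonneg_right (hKn p) (decayWeight_nonneg _ _)
  obtain ⟨T, hT⟩ := exists_kernel_distribution hKm.aestronglyMeasurable hKint
  refine ⟨T, hint, fun φ => ?_⟩
  rw [hT]
  refine tendsto_integral_of_kernel (Kε := Kε) (N := N) φ (fun ε hε => hint ε hε φ)
    (fun ε hε => Eventually.of_forall fun t => ?_) (fun ε _ => (hKεm ε).aestronglyMeasurable)
    (fun ε hε => Eventually.of_forall fun p => ?_) hG ?_
  · have h := integral_cpow_slice (V := V) (by omega) hm hσ hε (α := α)
      (by rw [hrank, Nat.cast_sub hd1, hα]; push_cast; ring) φ t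
    rw [mink_finrank d hd1] at h
    have h2 : ∫ y, wPow d m σ (1 - (d : ℂ) / 2) ε (t, y) * φ (t, y) =
        ∫ y : V, ((m : ℂ) ^ 2 / 4 * ((t : ℂ) ^ 2 - ‖y‖ ^ 2) + Complex.I * σ * ε) ^ (-(α : ℂ)) *
          φ (t, y) := by
      refine integral_congr_ae (Eventually.of_forall fun y => ?_)
      simp only [wPow, warg_eq, hl]
      congr 2
      · push_cast; ring
      · push_cast; rfl
    rw [h2, ← inv_mul_cancel_left₀ hΓ (∫ y : V, _), h, ← integral_const_mul, ← integral_const_mul]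
    refine integral_congr_ae (Eventually.of_forall fun q => ?_)
    simp only [hKε, hc]
    ring
  · simp only [hKε]
    rw [norm_mul c, norm_mul ((Complex.I * _ * _) ^ (_ : ℂ)), hA]
    refine mul_le_mul_of_nonneg_left (mul_le_of_le_one_right (by positivity) ?_) (norm_nonneg _)
    refine norm_exp_neg_two_mul_le ?_
    generalize Complex.I * (-σ : ℂ) * (‖p.2‖ ^ 2 / m ^ 2 : ℝ) *
      (ε - J * ((m : ℂ) ^ 2 / 4 * (p.1 : ℂ) ^ 2)) = z
    have := Complex.abs_arg_le_pi z
    rcases eq_or_ne z 0 with h | h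
    · rw [h]; simp
    · rw [Complex.cpow_def_of_ne_zero h, Complex.exp_re]
      refine mul_nonneg (Real.exp_nonneg _) (Real.cos_nonneg_of_mem_Icc ?_)
      rw [show (1 / 2 : ℂ) = ((1 / 2 : ℝ) : ℂ) by norm_num, Complex.im_mul_ofReal, Complex.log_im]
      obtain ⟨h3, h4⟩ := abs_le.1 this
      constructor <;> linarith
  · filter_upwards [ae_of_ae_fst ae_ne_zero] with p hp
    simp only [hK, hKε]
    refine Tendsto.const_mul _ (Tendsto.const_mul _ (Tendsto.cexp (Tendsto.const_mul _ ?_)))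
    -- The regularisation w + iσε differs from that of t² by the factor m²/4 contained in w, so ε is
    -- rescaled accordingly.
    have hscale : Tendsto (fun ε : ℝ => 4 / m ^ 2 * ε) (𝓝[>] 0) (𝓝[>] 0) := by
      refine tendsto_nhdsWithin_iff.2 ⟨?_, ?_⟩
      · have : Continuous fun ε : ℝ => 4 / m ^ 2 * ε := by fun_prop
        simpa using (this.tendsto 0).mono_left (nhdsWithin_le_nhds (s := Set.Ioi 0))
      · filter_upwards [self_mem_nhdsWithin] with ε hε
        have hε : 0 < ε := hε
        show 0 < 4 / m ^ 2 * ε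
        positivity
    have h1 := ((tendsto_cpow_half_neg_sq (s := -σ) hp (by rw [neg_sq, hσ])).comp hscale).const_mul
      (((‖p.2‖ / 2 : ℝ) : ℂ))
    refine h1.congr' ?_
    filter_upwards [self_mem_nhdsWithin] with ε hε
    have hε : 0 < ε := hε
    have hmc : (m : ℂ) ≠ 0 := by exact_mod_cast hm.ne'
    have h5 : Complex.I * (-σ : ℂ) * (‖p.2‖ ^ 2 / m ^ 2 : ℝ) *
        (ε - J * ((m : ℂ) ^ 2 / 4 * (p.1 : ℂ) ^ 2)) =
        (((‖p.2‖ / 2) ^ 2 : ℝ) : ℂ) * (-(p.1 : ℂ) ^ 2 + Complex.I * (-σ * (4 / m ^ 2 * ε) : ℝ)) := by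
      have h6 : Complex.I * (-σ : ℂ) = -J := by rw [hJ]; ring
      have h7 : Complex.I * ((-σ * (4 / m ^ 2 * ε) : ℝ) : ℂ) = -J * (4 / m ^ 2 * ε) := by
        rw [hJ]; push_cast; ring
      rw [h6, h7]
      push_cast
      clear_value J
      field_simp
      linear_combination 4 * (m : ℂ) ^ 2 * (p.1 : ℂ) ^ 2 * (‖p.2‖ : ℂ) ^ 2 * hJJ
    have h3 : -(p.1 : ℂ) ^ 2 + Complex.I * (-σ * (4 / m ^ 2 * ε) : ℝ) ≠ 0 := by
      intro h
      have h4 := congrArg Complex.im h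
      rw [← Complex.ofReal_pow, ← Complex.ofReal_neg, im_add_I_mul] at h4
      simp [hσ0, hε.ne', hm.ne'] at h4
    rw [h5]
    rcases eq_or_ne p.2 0 with hq | hq
    · simp [hq]
    · have hq0 : 0 < ‖p.2‖ := norm_pos_iff.2 hq
      rw [ofReal_mul_cpow (by positivity) h3, ofReal_cpow_half (by positivity),
        Real.sqrt_sq (by positivity)]
      rfl

/-! ### Less singular powers of w, and the case d = 1 -/

theorem hasTemperateGrowth_warg (d : ℕ) (m : ℝ) :
    Function.HasTemperateGrowth fun x : Mink d => ((warg m x : ℝ) : ℂ) := by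
  have h1 : Function.HasTemperateGrowth fun x : Mink d => x.1 :=
    (ContinuousLinearMap.fst ℝ ℝ (EuclideanSpace ℝ (Fin (d - 1)))).hasTemperateGrowth
  have h2 : Function.HasTemperateGrowth fun x : Mink d => ‖x.2‖ ^ 2 :=
    (Function.hasTemperateGrowth_norm_sq (H := EuclideanSpace ℝ (Fin (d - 1)))).comp
      (ContinuousLinearMap.snd ℝ ℝ (EuclideanSpace ℝ (Fin (d - 1)))).hasTemperateGrowth
  have h3 : Function.HasTemperateGrowth fun x : Mink d => m ^ 2 / 4 * (x.1 ^ 2 - ‖x.2‖ ^ 2) :=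
    (Function.HasTemperateGrowth.const _).mul ((h1.pow 2).sub h2)
  have h4 := Function.HasTemperateGrowth.comp Complex.ofRealCLM.hasTemperateGrowth h3
  refine (congrArg Function.HasTemperateGrowth ?_).mp h4
  ext x
  simp only [Function.comp, warg_eq, Complex.ofRealCLM_apply]

theorem wPow_add_one (d : ℕ) {m σ ε : ℝ} (hσ : σ ^ 2 = 1) (hε : 0 < ε) (l : ℂ) (x : Mink d) :
    wPow d m σ (l + 1) ε x =
      wPow d m σ l ε x * (warg m x : ℝ) + Complex.I * (σ * ε : ℝ) * wPow d m σ l ε x := by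
  have h0 : ((warg m x : ℝ) : ℂ) + Complex.I * (σ * ε : ℝ) ≠ 0 := fun h => by
    have := le_norm_add_I_mul hσ (warg m x) hε
    rw [h, norm_zero] at this
    linarith
  unfold wPow
  rw [Complex.cpow_add _ _ h0, Complex.cpow_one]
  ring

/-- Split the additional factor w + iσε. Multiplication by w has temperate growth and passes to the
test function; the iσε term multiplies a convergent family and disappears. -/
theorem hasBoundaryValue_wPow_add_one (d : ℕ) {m σ : ℝ} (hσ : σ ^ 2 = 1) {l : ℂ}
    (h : HasBoundaryValue (wPow d m σ l)) : HasBoundaryValue (wPow d m σ (l + 1)) := by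
  obtain ⟨T, hT, hlim⟩ := h
  set g : Mink d → ℂ := fun x => ((warg m x : ℝ) : ℂ) with hg
  have hgt : Function.HasTemperateGrowth g := hasTemperateGrowth_warg d m
  have hsplit : ∀ ε, 0 < ε → ∀ φ : 𝓢(Mink d, ℂ), (fun x => wPow d m σ (l + 1) ε x * φ x) =
      fun x => wPow d m σ l ε x * (SchwartzMap.smulLeftCLM ℂ g φ) x +
        (Complex.I * (σ * ε : ℝ)) * (wPow d m σ l ε x * φ x) := by
    intro ε hε φ
    ext x
    rw [wPow_add_one d hσ hε, SchwartzMap.smulLeftCLM_apply_apply hgt, smul_eq_mul]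
    ring
  refine ⟨TemperedDistribution.smulLeftCLM ℂ g T, fun ε hε φ => ?_, fun φ => ?_⟩
  · rw [hsplit ε hε]
    exact (hT ε hε _).add ((hT ε hε φ).const_mul _)
  · rw [TemperedDistribution.smulLeftCLM_apply_apply]
    have hε0 : Tendsto (fun ε : ℝ => Complex.I * (σ * ε : ℝ)) (𝓝[>] 0) (𝓝 0) := by
      have : Continuous fun ε : ℝ => Complex.I * (σ * ε : ℝ) := by fun_prop
      simpa using (this.tendsto 0).mono_left (nhdsWithin_le_nhds (s := Set.Ioi 0))
    have h := (hlim (SchwartzMap.smulLeftCLM ℂ g φ)).add (hε0.mul (hlim φ))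
    rw [zero_mul, add_zero] at h
    refine h.congr' ?_
    filter_upwards [self_mem_nhdsWithin] with ε hε
    rw [hsplit ε hε, integral_add (hT ε hε _) ((hT ε hε φ).const_mul _), integral_const_mul]

/-- Downward induction on k: for even d the most singular exponent 1 - d/2 is the integer -(d/2 -
1), and each multiplication by w raises the exponent by one. -/
theorem hasBoundaryValue_wPow_neg_natCast (d : ℕ) (hd : Even d) {m σ : ℝ} (hm : 0 < m)
    (hσ : σ ^ 2 = 1) {k : ℕ} (hk : 1 ≤ k) (hkd : k ≤ d / 2 - 1) :
    HasBoundaryValue (wPow d m σ (-(k : ℂ))) := by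
  induction hkd using Nat.decreasingInduction with
  | self =>
    have h := hasBoundaryValue_wPow_top d (by omega) hm hσ
    obtain ⟨r, rfl⟩ := hd
    have e : (r + r) / 2 - 1 = r - 1 := by omega
    rw [e] at hk ⊢
    rw [Nat.cast_sub (by omega)]
    push_cast at h ⊢
    convert h using 2
    ring
  | of_succ k hk' ih =>
    have h := hasBoundaryValue_wPow_add_one d hσ (ih (by omega))
    push_cast at h
    simpa using h

/-- Dominated convergence for families bounded polynomially and uniformly in ε. It suffices when the
limit is a function, as happens for d = 1. -/
theorem exists_isBoundaryValue_of_tendsto_ae {d : ℕ} {f : ℝ → Mink d → ℂ} {g : Mink d → ℂ} {C : ℝ}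
    {k : ℕ} (hf : ∀ ε, 0 < ε → ∀ φ : 𝓢(Mink d, ℂ), Integrable fun x => f ε x * φ x)
    (hm : ∀ ε, AEStronglyMeasurable (f ε)) (hg : AEStronglyMeasurable g)
    (hfC : ∀ᶠ ε in 𝓝[>] (0 : ℝ), ∀ x, ‖f ε x‖ ≤ C * (1 + ‖x‖) ^ k)
    (hgC : ∀ x, ‖g x‖ ≤ C * (1 + ‖x‖) ^ k)
    (hlim : ∀ᵐ x, Tendsto (fun ε => f ε x) (𝓝[>] 0) (𝓝 (g x))) : HasBoundaryValue f := by
  have hgi : ∀ φ : 𝓢(Mink d, ℂ), Integrable fun x => g x * φ x := fun φ =>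
    integrable_mul_schwartz_of_growth hg (Eventually.of_forall hgC) φ
  set M := k + (Module.finrank ℝ (Mink d) + 1) with hM
  have hdec : Integrable fun x : Mink d => ((1 + ‖x‖) ^ (Module.finrank ℝ (Mink d) + 1))⁻¹ :=
    integrable_one_add_norm_pow_inv volume (Nat.lt_succ_self _)
  have hC0 : 0 ≤ C := by
    have := (norm_nonneg _).trans (hgC 0)
    simpa using this
  have hbound : ∀ (φ : 𝓢(Mink d, ℂ)) x, C * (1 + ‖x‖) ^ k * ‖φ x‖ ≤ C * (2 ^ M *
      (Finset.Iic (M, 0)).sup (schwartzSeminormFamily ℂ (Mink d) ℂ) φ) *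
        ((1 + ‖x‖) ^ (Module.finrank ℝ (Mink d) + 1))⁻¹ := by
    intro φ x
    have h := SchwartzMap.one_add_le_sup_seminorm_apply (𝕜 := ℂ) (m := (M, 0)) (k := M)
      (n := 0) le_rfl le_rfl φ x
    rw [norm_iteratedFDeriv_zero, hM, pow_add] at h
    rw [← div_eq_mul_inv, le_div_iff₀ (by positivity)]
    calc _ = C * ((1 + ‖x‖) ^ k * (1 + ‖x‖) ^ (Module.finrank ℝ (Mink d) + 1) * ‖φ x‖) := by ring
      _ ≤ _ := mul_le_mul_of_nonneg_left h hC0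
  refine ⟨ContinuousLinearMap.toPointwiseConvergenceCLM _ _ _ _
    (SchwartzMap.mkCLMtoNormedSpace (𝕜 := ℂ) (σ := RingHom.id ℂ)
      (fun φ : 𝓢(Mink d, ℂ) => ∫ x, g x * φ x) ?_ ?_ ?_), hf, fun φ => ?_⟩
  · intro φ χ
    rw [← integral_add (hgi φ) (hgi χ)]
    refine integral_congr_ae (Eventually.of_forall fun x => ?_)
    simp [mul_add]
  · intro c φ
    simp only [smul_apply, smul_eq_mul, RingHom.id_apply]
    rw [← integral_const_mul]
    refine integral_congr_ae (Eventually.of_forall fun x => ?_)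
    simp only
    ring
  · refine ⟨Finset.Iic (M, 0), C * 2 ^ M *
      ∫ x : Mink d, ((1 + ‖x‖) ^ (Module.finrank ℝ (Mink d) + 1))⁻¹,
      mul_nonneg (by positivity) (integral_nonneg fun x => by positivity), fun φ => ?_⟩
    refine (norm_integral_le_of_norm_le (hdec.const_mul (C * (2 ^ M *
      (Finset.Iic (M, 0)).sup (schwartzSeminormFamily ℂ (Mink d) ℂ) φ)))
      (Eventually.of_forall fun x => ?_)).trans (le_of_eq ?_)
    · rw [norm_mul]
      exact (mul_le_mul_of_nonneg_right (hgC x) (norm_nonneg _)).trans (hbound φ x)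
    · rw [integral_const_mul]; ring
  · refine tendsto_integral_filter_of_dominated_convergence (fun x => C * (2 ^ M *
      (Finset.Iic (M, 0)).sup (schwartzSeminormFamily ℂ (Mink d) ℂ) φ) *
        ((1 + ‖x‖) ^ (Module.finrank ℝ (Mink d) + 1))⁻¹) ?_ ?_ (hdec.const_mul _) ?_
    · exact Eventually.of_forall fun ε => (hm ε).mul φ.continuous.aestronglyMeasurable
    · filter_upwards [hfC] with ε hε
      refine Eventually.of_forall fun x => ?_
      rw [norm_mul]
      exact (mul_le_mul_of_nonneg_right (hε x) (norm_nonneg _)).trans (hbound φ x)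
    · filter_upwards [hlim] with x hx using hx.mul_const _

theorem norm_cpow_half_le (z : ℂ) : ‖z ^ (1 / 2 : ℂ)‖ ≤ 1 + ‖z‖ := by
  have e : (1 / 2 : ℂ) = ((1 / 2 : ℝ) : ℂ) := by push_cast; rfl
  rw [e, Complex.norm_cpow_real, ← Real.sqrt_eq_rpow, Real.sqrt_le_iff]
  constructor
  · positivity
  · nlinarith [norm_nonneg z]

/-- For d = 1 there is no spatial direction and w = m²t²/4 is positive off t = 0. The exponent is
+1/2, so both boundary values are an ordinary continuous function. -/
theorem hasBoundaryValue_wPow_one {m σ : ℝ} (hm : 0 < m) (hσ : σ ^ 2 = 1) :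
    HasBoundaryValue (wPow 1 m σ (1 / 2)) := by
  have hwabs : ∀ x : Mink 1, 1 + |warg m x| + 1 ≤ (2 + m ^ 2) * (1 + ‖x‖) ^ 2 := by
    intro x
    have h1 := abs_msq_le x
    have h2 : |warg m x| ≤ m ^ 2 * ‖x‖ ^ 2 := by
      rw [warg, abs_div, abs_neg, abs_mul, abs_of_pos (by positivity : 0 < m ^ 2),
        abs_of_pos (by norm_num : (0 : ℝ) < 4), div_le_iff₀ (by norm_num)]
      have : 0 ≤ m ^ 2 * ‖x‖ ^ 2 := by positivity
      have : m ^ 2 * |msq x| ≤ m ^ 2 * (2 * ‖x‖ ^ 2) := by gcongr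
      linarith
    have h3 := norm_nonneg x
    have h4 : 0 ≤ m ^ 2 * ‖x‖ := by positivity
    nlinarith [sq_nonneg m]
  have hn : ∀ ε, 0 < ε → ∀ x : Mink 1, ‖wPow 1 m σ (1 / 2) ε x‖ ≤
      ((2 + m ^ 2) * (1 + ε)) * (1 + ‖x‖) ^ 2 := by
    intro ε hε x
    refine (norm_cpow_half_le _).trans ?_
    have h1 : ‖((warg m x : ℝ) : ℂ) + Complex.I * (σ * ε : ℝ)‖ ≤ |warg m x| + ε := by
      refine (norm_add_le _ _).trans (le_of_eq ?_)
      simp [abs_eq_one_of_sq hσ, abs_of_pos hε]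
    have h2 := hwabs x
    have h3 := abs_nonneg (warg m x)
    have h4 : (1 + ε) * (1 + |warg m x| + 1) ≤ (1 + ε) * ((2 + m ^ 2) * (1 + ‖x‖) ^ 2) := by gcongr
    nlinarith [mul_nonneg hε.le h3]
  refine exists_isBoundaryValue_of_tendsto_ae (C := (2 + m ^ 2) * (1 + 1)) (k := 2)
    (g := fun x => ((warg m x : ℝ) : ℂ) ^ (1 / 2 : ℂ))
    (fun ε hε φ => integrable_mul_schwartz_of_growth
      (measurable_wPow 1 m σ (1 / 2) ε).aestronglyMeasurable (Eventually.of_forall (hn ε hε)) φ)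
    (fun ε => (measurable_wPow 1 m σ (1 / 2) ε).aestronglyMeasurable) ?_ ?_ ?_ ?_
  · have : Measurable fun x : Mink 1 => warg m x := (continuous_warg m).measurable
    exact Measurable.aestronglyMeasurable (by fun_prop)
  · filter_upwards [self_mem_nhdsWithin, mem_nhdsWithin_of_mem_nhds (Iio_mem_nhds one_pos)]
      with ε hε hε1 x
    have hε1 : ε < 1 := hε1
    refine (hn ε hε x).trans ?_
    gcongr
  · intro x
    refine (norm_cpow_half_le _).trans ?_
    have h2 := hwabs x
    rw [Complex.norm_real, Real.norm_eq_abs]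
    have : 0 ≤ (2 + m ^ 2) * (1 + ‖x‖) ^ 2 := by positivity
    nlinarith
  · filter_upwards [ae_of_ae_fst ae_ne_zero] with x hx
    have hw : 0 < warg m x := by
      have : x.2 = 0 := Subsingleton.elim (α := EuclideanSpace ℝ (Fin 0)) _ _
      rw [warg_eq, this, norm_zero]
      have := sq_pos_of_ne_zero hx
      simp only [ne_eq, OfNat.ofNat_ne_zero, not_false_eq_true, zero_pow, sub_zero]
      positivity
    have hc := ContinuousAt.comp (x := (0 : ℝ))
      (f := fun ε : ℝ => ((warg m x : ℝ) : ℂ) + Complex.I * (σ * ε : ℝ))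
      (continuousAt_cpow_const (b := (1 / 2 : ℂ)) (Or.inl (by
        rw [re_add_I_mul]; exact hw)))
      (Continuous.continuousAt (by fun_prop))
    have h := hc.tendsto.mono_left (nhdsWithin_le_nhds (s := Set.Ioi 0))
    simpa [Function.comp_def, wPow] using h

theorem hasBoundaryValue_wPow_of_odd (d : ℕ) (hd : Odd d) {m σ : ℝ} (hm : 0 < m) (hσ : σ ^ 2 = 1) :
    HasBoundaryValue (wPow d m σ (1 - (d : ℂ) / 2)) := by
  rcases eq_or_ne d 1 with rfl | h1
  · have e : 1 - ((1 : ℕ) : ℂ) / 2 = 1 / 2 := by push_cast; norm_num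
    rw [e]
    exact hasBoundaryValue_wPow_one hm hσ
  · refine hasBoundaryValue_wPow_top d ?_ hm hσ
    obtain ⟨k, rfl⟩ := hd
    omega

/-! ### Jumps across the cut in even dimension -/

/-- The light cone is null because its slice at each t ≠ 0 is a sphere of radius |t|. -/
theorem ae_warg_ne_zero (d : ℕ) {m : ℝ} (hm : m ≠ 0) : ∀ᵐ x : Mink d, warg m x ≠ 0 := by
  have hmeas : MeasurableSet {x : Mink d | warg m x = 0} :=
    measurableSet_eq_fun (continuous_warg m).measurable measurable_const
  rw [ae_iff]
  simp only [not_not]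
  rw [Measure.volume_eq_prod, Measure.measure_prod_null hmeas]
  filter_upwards [ae_ne_zero] with t ht
  refine measure_mono_null ?_ (Measure.addHaar_sphere_of_ne_zero
    (volume : Measure (EuclideanSpace ℝ (Fin (d - 1)))) 0 (abs_ne_zero.2 ht))
  intro y hy
  have hy : warg m (t, y) = 0 := hy
  rw [warg_eq] at hy
  have h1 : t ^ 2 - ‖y‖ ^ 2 = 0 := by
    rcases mul_eq_zero.1 hy with h | h
    · exact absurd h (by positivity)
    · exact h
  rw [mem_sphere_zero_iff_norm, ← sq_eq_sq₀ (norm_nonneg _) (abs_nonneg _), sq_abs]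
  linarith

theorem tendsto_const_mul_nhdsGT_zero {c : ℝ} (hc : 0 < c) :
    Tendsto (fun ε : ℝ => c * ε) (𝓝[>] 0) (𝓝[>] 0) := by
  refine tendsto_nhdsWithin_iff.2 ⟨?_, ?_⟩
  · have : Continuous fun ε : ℝ => c * ε := by fun_prop
    simpa using (this.tendsto 0).mono_left (nhdsWithin_le_nhds (s := Set.Ioi 0))
  · filter_upwards [self_mem_nhdsWithin] with ε hε
    exact mul_pos hc hε

/-- Rescaling ε by 4/m² turns the argument into w + iσε, the variable in which the connection
formulas and the powers of w are written. -/
theorem deSitterU_eq (d : ℕ) {m : ℝ} (hm : 0 < m) (σ ε : ℝ) (x : Mink d) :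
    deSitterU d m σ (4 / m ^ 2 * ε) x =
      besselU ((d : ℂ) / 2 - 1) ((warg m x : ℝ) + Complex.I * (σ * ε : ℝ)) := by
  have hmc : (m : ℂ) ≠ 0 := by exact_mod_cast hm.ne'
  unfold deSitterU warg
  congr 1
  push_cast
  field_simp

theorem integrable_besselU_warg (d : ℕ) {m σ ε : ℝ} (hm : 0 < m) (hσ : σ ^ 2 = 1) (hε : 0 < ε)
    (φ : 𝓢(Mink d, ℂ)) : Integrable fun x => besselU ((d : ℂ) / 2 - 1)
      ((warg m x : ℝ) + Complex.I * (σ * ε : ℝ)) * φ x := by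
  have := integrable_deSitterU_mul d hm hσ (ε := 4 / m ^ 2 * ε) (by positivity) φ
  simpa only [deSitterU_eq d hm] using this

theorem tendsto_besselU_warg (d : ℕ) (hd : 1 ≤ d) {m σ : ℝ} (hm : 0 < m) (hσ : σ ^ 2 = 1)
    (φ : 𝓢(Mink d, ℂ)) : Tendsto (fun ε => ∫ x, besselU ((d : ℂ) / 2 - 1)
      ((warg m x : ℝ) + Complex.I * (σ * ε : ℝ)) * φ x) (𝓝[>] 0)
      (𝓝 (boundaryValue (deSitterU d m σ) φ)) := by
  obtain ⟨T, hT, -⟩ := exists_isBoundaryValue_deSitterU d hd hm hσ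
  rw [boundaryValue_eq hT]
  have h := (hT.2 φ).comp (tendsto_const_mul_nhdsGT_zero (c := 4 / m ^ 2) (by positivity))
  simpa only [Function.comp_def, deSitterU_eq d hm] using h

theorem tendsto_wPow (d : ℕ) {m σ : ℝ} {l : ℂ} (h : HasBoundaryValue (wPow d m σ l))
    (φ : 𝓢(Mink d, ℂ)) : Tendsto (fun ε => ∫ x, wPow d m σ l ε x * φ x) (𝓝[>] 0)
      (𝓝 (boundaryValue (wPow d m σ l) φ)) := by
  obtain ⟨T, hT⟩ := h
  rw [boundaryValue_eq hT]
  exact hT.2 φ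

theorem add_I_mul_mem_slitPlane {w τ : ℝ} (hτ : τ ≠ 0) :
    (w : ℂ) + Complex.I * (τ : ℝ) ∈ Complex.slitPlane := Or.inr (by rwa [im_add_I_mul])

theorem norm_add_I_mul_le {w τ R : ℝ} (hw : |w| ≤ R) (hτ : |τ| ≤ 1) :
    ‖(w : ℂ) + Complex.I * (τ : ℝ)‖ ≤ R + 1 := by
  refine (norm_add_le _ _).trans (add_le_add ?_ ?_)
  · rwa [Complex.norm_real, Real.norm_eq_abs]
  · rwa [norm_mul, Complex.norm_I, one_mul, Complex.norm_real, Real.norm_eq_abs]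

theorem abs_log_le_add_inv {x : ℝ} (hx : 0 < x) : |Real.log x| ≤ x + x⁻¹ := by
  have h1 := Real.log_le_sub_one_of_pos hx
  have h2 := Real.log_le_sub_one_of_pos (inv_pos.2 hx)
  rw [Real.log_inv] at h2
  have h3 := inv_pos.2 hx
  rw [abs_le]
  constructor <;> linarith

theorem norm_clog_le {z : ℂ} (hz : z ≠ 0) : ‖Complex.log z‖ ≤ ‖z‖ + ‖z‖⁻¹ + Real.pi := by
  have h0 : Complex.log z = (Real.log ‖z‖ : ℝ) + (Complex.arg z : ℝ) * Complex.I := rfl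
  rw [h0]
  refine (norm_add_le _ _).trans (add_le_add ?_ ?_)
  · rw [Complex.norm_real]
    exact abs_log_le_add_inv (norm_pos_iff.2 hz)
  · rw [norm_mul, Complex.norm_I, mul_one, Complex.norm_real]
    exact Complex.abs_arg_le_pi z

/-- For equal moduli the difference of logarithms is purely imaginary. Applied to w - iε and w + iε,
this bounds the jump even where each logarithm blows up. -/
theorem norm_clog_sub_clog_le {z w : ℂ} (h : ‖z‖ = ‖w‖) :
    ‖Complex.log z - Complex.log w‖ ≤ 2 * Real.pi := by
  have h0 : Complex.log z - Complex.log w = ((Complex.arg z - Complex.arg w : ℝ) : ℂ) * Complex.I := by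
    unfold Complex.log
    rw [h]
    push_cast
    ring
  rw [h0, norm_mul, Complex.norm_I, mul_one, Complex.norm_real, Real.norm_eq_abs]
  have h1 := abs_le.1 (Complex.abs_arg_le_pi z)
  have h2 := abs_le.1 (Complex.abs_arg_le_pi w)
  rw [abs_le]
  constructor <;> linarith

theorem norm_add_I_mul_neg (w τ : ℝ) :
    ‖(w : ℂ) + Complex.I * (-τ : ℝ)‖ = ‖(w : ℂ) + Complex.I * (τ : ℝ)‖ := by
  rw [← Complex.norm_conj]
  simp

theorem exists_norm_le_closedBall {g : ℂ → ℂ} (hg : Continuous g) (R : ℝ) :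
    ∃ B, 0 ≤ B ∧ ∀ z, ‖z‖ ≤ R → ‖g z‖ ≤ B := by
  obtain ⟨B, hB⟩ := (isCompact_closedBall (0 : ℂ) R).exists_bound_of_continuousOn hg.continuousOn
  exact ⟨max B 0, le_max_right _ _, fun z hz => (hB z (by simpa using hz)).trans (le_max_left _ _)⟩

theorem tendsto_add_I_mul (w σ : ℝ) : Tendsto (fun ε : ℝ => (w : ℂ) + Complex.I * (σ * ε : ℝ))
    (𝓝[>] 0) (𝓝 (w : ℂ)) := by
  have : Continuous fun ε : ℝ => (w : ℂ) + Complex.I * (σ * ε : ℝ) := by fun_prop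
  simpa using (this.tendsto 0).mono_left (nhdsWithin_le_nhds (s := Set.Ioi 0))

/-- The jump of the logarithm across the negative half-line. -/
theorem tendsto_clog_sub_clog {w : ℝ} (hw : w ≠ 0) :
    Tendsto (fun ε : ℝ => Complex.log ((w : ℂ) + Complex.I * (-1 * ε : ℝ)) -
      Complex.log ((w : ℂ) + Complex.I * (1 * ε : ℝ))) (𝓝[>] 0)
      (𝓝 (if w < 0 then -(2 * Real.pi * Complex.I) else 0)) := by
  split_ifs with h
  · have h1 := Complex.tendsto_log_nhdsWithin_im_neg_of_re_neg_of_im_zero (z := (w : ℂ))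
      (by simpa using h) (by simp)
    have h2 := Complex.tendsto_log_nhdsWithin_im_nonneg_of_re_neg_of_im_zero (z := (w : ℂ))
      (by simpa using h) (by simp)
    have e1 : Tendsto (fun ε : ℝ => (w : ℂ) + Complex.I * (-1 * ε : ℝ)) (𝓝[>] 0)
        (𝓝[{z : ℂ | z.im < 0}] (w : ℂ)) := by
      refine tendsto_nhdsWithin_iff.2 ⟨tendsto_add_I_mul w (-1), ?_⟩
      filter_upwards [self_mem_nhdsWithin] with ε hε
      have hε : 0 < ε := hε
      show ((w : ℂ) + Complex.I * (-1 * ε : ℝ)).im < 0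
      rw [im_add_I_mul]; linarith
    have e2 : Tendsto (fun ε : ℝ => (w : ℂ) + Complex.I * (1 * ε : ℝ)) (𝓝[>] 0)
        (𝓝[{z : ℂ | 0 ≤ z.im}] (w : ℂ)) := by
      refine tendsto_nhdsWithin_iff.2 ⟨tendsto_add_I_mul w 1, ?_⟩
      filter_upwards [self_mem_nhdsWithin] with ε hε
      have hε : 0 < ε := hε
      show 0 ≤ ((w : ℂ) + Complex.I * (1 * ε : ℝ)).im
      rw [im_add_I_mul]; linarith
    have h3 := (h1.comp e1).sub (h2.comp e2)
    rw [show ((Real.log ‖(w : ℂ)‖ : ℝ) : ℂ) - Real.pi * Complex.I -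
      ((Real.log ‖(w : ℂ)‖ : ℝ) + Real.pi * Complex.I) = -(2 * Real.pi * Complex.I) by ring] at h3
    exact h3
  · have hw' : 0 < w := lt_of_le_of_ne (not_lt.1 h) hw.symm
    have hc := continuousAt_clog (x := (w : ℂ)) (Or.inl (by simpa using hw'))
    have h3 := (hc.tendsto.comp (tendsto_add_I_mul w (-1))).sub
      (hc.tendsto.comp (tendsto_add_I_mul w 1))
    simpa [Function.comp_def] using h3

theorem even_half_sub_one {d : ℕ} (hd : Even d) (hd2 : 2 ≤ d) :
    (d : ℂ) / 2 - 1 = ((d / 2 - 1 : ℕ) : ℂ) := by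
  obtain ⟨r, rfl⟩ := hd
  rw [show (r + r) / 2 - 1 = r - 1 by omega, Nat.cast_sub (by omega)]
  push_cast
  ring

theorem integrable_wPow_natCast_sub_mul (d : ℕ) (m : ℝ) {σ ε : ℝ} (hσ : σ ^ 2 = 1) (hε : 0 < ε)
    {a j : ℕ} (hj : j ≤ a) (φ : 𝓢(Mink d, ℂ)) :
    Integrable fun x => wPow d m σ ((j : ℂ) - a) ε x * φ x := by
  have e : (j : ℂ) - a = ((j - a : ℝ) : ℂ) := by push_cast; rfl
  rw [e]
  exact integrable_wPow_mul d m hσ hε (by have : (j : ℝ) ≤ a := by exact_mod_cast hj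
                                          linarith) φ

/-- Across the cut, `log z 𝐅_a(z)` plus an entire function jumps by `-2πi 𝐅_a`. -/
theorem tendsto_integral_log_jump (d : ℕ) {m : ℝ} (hm : m ≠ 0) (α : ℂ) {E : ℂ → ℂ}
    (hE : Continuous E) {φ : 𝓢(Mink d, ℂ)} (hφ : HasCompactSupport φ) (c : ℂ) :
    Tendsto (fun ε : ℝ => ∫ x,
      (c * (Complex.log ((warg m x : ℝ) + Complex.I * (-1 * ε : ℝ)) *
          boldF α ((warg m x : ℝ) + Complex.I * (-1 * ε : ℝ))) +
        E ((warg m x : ℝ) + Complex.I * (-1 * ε : ℝ)) -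
      (c * (Complex.log ((warg m x : ℝ) + Complex.I * (1 * ε : ℝ)) *
          boldF α ((warg m x : ℝ) + Complex.I * (1 * ε : ℝ))) +
        E ((warg m x : ℝ) + Complex.I * (1 * ε : ℝ)))) * φ x) (𝓝[>] 0)
      (𝓝 (c * -(2 * Real.pi * Complex.I) *
        ∫ x in {x : Mink d | warg m x < 0}, boldF α (warg m x : ℝ) * φ x)) := by
  have hwc : Continuous fun x : Mink d => warg m x := continuous_warg m
  have hFc : ∀ α, Continuous (boldF α) := fun α => (differentiable_boldF α).continuous
  obtain ⟨R, hR⟩ := hφ.isCompact.exists_bound_of_continuousOn hwc.continuousOn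
  obtain ⟨B, hB0, hB⟩ := exists_norm_le_closedBall (hFc α) (R + 1)
  obtain ⟨B', hB'0, hB'⟩ := exists_norm_le_closedBall (hFc (α + 1)) (R + 1)
  obtain ⟨BE, hBE0, hBE⟩ := exists_norm_le_closedBall hE (R + 1)
  have hset : MeasurableSet {x : Mink d | warg m x < 0} :=
    measurableSet_lt hwc.measurable measurable_const
  have hlimint : c * -(2 * Real.pi * Complex.I) *
        ∫ x in {x : Mink d | warg m x < 0}, boldF α (warg m x : ℝ) * φ x =
      ∫ x : Mink d, c * ((if warg m x < 0 then -(2 * Real.pi * Complex.I) else 0) *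
        boldF α (warg m x : ℝ)) * φ x := by
    rw [← integral_const_mul, ← integral_indicator hset]
    refine integral_congr_ae (Eventually.of_forall fun x => ?_)
    simp only [Set.indicator, Set.mem_ofPred_eq]
    split_ifs
    · ring
    · simp
  rw [hlimint]
  refine tendsto_integral_filter_of_dominated_convergence (fun x =>
    (‖c‖ * (2 * Real.pi * B + (R + 2 + Real.pi) * (B' * 2)) + (BE + BE)) * ‖φ x‖) ?_ ?_
    (φ.integrable.norm.const_mul _) ?_
  · refine Eventually.of_forall fun ε => Measurable.aestronglyMeasurable ?_
    have h1 := hwc.measurable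
    have h2 := (hFc α).measurable
    have h3 := hE.measurable
    have h4 := φ.continuous.measurable
    fun_prop
  · filter_upwards [self_mem_nhdsWithin, mem_nhdsWithin_of_mem_nhds (Iio_mem_nhds one_pos)]
      with ε hε hε1
    have hε : 0 < ε := hε
    have hε1 : ε < 1 := hε1
    refine Eventually.of_forall fun x => ?_
    rw [norm_mul]
    by_cases hx : x ∈ tsupport φ
    swap
    · rw [image_eq_zero_of_notMem_tsupport hx, norm_zero, mul_zero, mul_zero]
    refine mul_le_mul_of_nonneg_right ?_ (norm_nonneg _)
    have hw : |warg m x| ≤ R := hR x hx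
    have hR0 : 0 ≤ R := (abs_nonneg _).trans hw
    have hn := norm_add_I_mul_neg (warg m x) ε
    rw [neg_one_mul, one_mul]
    set z₁ : ℂ := (warg m x : ℝ) + Complex.I * (-ε : ℝ) with hz₁
    set z₂ : ℂ := (warg m x : ℝ) + Complex.I * (ε : ℝ) with hz₂
    have hz₁n : ‖z₁‖ ≤ R + 1 := norm_add_I_mul_le hw (by rw [abs_neg, abs_of_pos hε]; exact hε1.le)
    have hz₂n : ‖z₂‖ ≤ R + 1 := norm_add_I_mul_le hw (by rw [abs_of_pos hε]; exact hε1.le)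
    have hεz : ε ≤ ‖z₂‖ := by
      have := le_norm_add_I_mul (σ := 1) (by norm_num) (warg m x) hε
      rwa [one_mul] at this
    have hz₂0 : z₂ ≠ 0 := norm_pos_iff.1 (hε.trans_le hεz)
    have hFd : ‖boldF α z₁ - boldF α z₂‖ ≤ B' * (2 * ε) := by
      have h := (convex_closedBall (0 : ℂ) (R + 1)).norm_image_sub_le_of_norm_hasDerivWithin_le
        (f := boldF α) (f' := boldF (α + 1)) (C := B')
        (fun z _ => (hasDerivAt_boldF α z).hasDerivWithinAt)
        (fun z hz => hB' z (by simpa using hz)) (x := z₂) (y := z₁)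
        (by simpa using hz₂n) (by simpa using hz₁n)
      have e : z₁ - z₂ = ((-(2 * ε) : ℝ) : ℂ) * Complex.I := by rw [hz₁, hz₂]; push_cast; ring
      rwa [e, norm_mul, Complex.norm_I, mul_one, Complex.norm_real, norm_neg,
        Real.norm_of_nonneg (by positivity)] at h
    have hlog : ‖Complex.log z₂‖ * ε ≤ R + 2 + Real.pi := by
      have h1 := norm_clog_le hz₂0
      have h2 : ‖z₂‖⁻¹ * ε ≤ 1 := by
        rw [← div_eq_inv_mul]
        exact div_le_one_of_le₀ hεz (norm_nonneg _)
      have h3 : (‖z₂‖ + Real.pi) * ε ≤ (‖z₂‖ + Real.pi) * 1 := by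
        have := Real.pi_pos
        gcongr
      calc _ ≤ (‖z₂‖ + ‖z₂‖⁻¹ + Real.pi) * ε := by gcongr
        _ = (‖z₂‖ + Real.pi) * ε + ‖z₂‖⁻¹ * ε := by ring
        _ ≤ _ := by linarith
    -- The jump of the logarithm is bounded. The other term pairs log z₂, which is at most of size
    -- 1/ε, with a difference of 𝐅 of size ε, so the whole integrand is dominated up to the light
    -- cone.
    have e : c * (Complex.log z₁ * boldF α z₁) + E z₁ - (c * (Complex.log z₂ * boldF α z₂) + E z₂) =
        c * ((Complex.log z₁ - Complex.log z₂) * boldF α z₁ +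
          Complex.log z₂ * (boldF α z₁ - boldF α z₂)) + (E z₁ - E z₂) := by ring
    rw [e]
    refine (norm_add_le _ _).trans (add_le_add ?_ ?_)
    · rw [norm_mul]
      refine mul_le_mul_of_nonneg_left ((norm_add_le _ _).trans (add_le_add ?_ ?_)) (norm_nonneg _)
      · rw [norm_mul]
        exact mul_le_mul (norm_clog_sub_clog_le hn) (hB _ hz₁n) (norm_nonneg _)
          (by have := Real.pi_pos; positivity)
      · rw [norm_mul]
        calc _ ≤ ‖Complex.log z₂‖ * (B' * (2 * ε)) := by gcongr
          _ = (‖Complex.log z₂‖ * ε) * (B' * 2) := by ring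
          _ ≤ _ := by gcongr
    · exact (norm_sub_le _ _).trans (add_le_add (hBE _ hz₁n) (hBE _ hz₂n))
  · filter_upwards [ae_warg_ne_zero d hm] with x hx
    refine Tendsto.mul_const _ ?_
    have t1 := tendsto_add_I_mul (warg m x) (-1)
    have t2 := tendsto_add_I_mul (warg m x) 1
    have hlogj := tendsto_clog_sub_clog hx
    have F1 := ((hFc α).tendsto _).comp t1
    have F2 := ((hFc α).tendsto _).comp t2
    have E1 := (hE.tendsto _).comp t1
    have E2 := (hE.tendsto _).comp t2
    have hFd : Tendsto (fun ε : ℝ => Complex.log ((warg m x : ℝ) + Complex.I * (1 * ε : ℝ)) *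
        (boldF α ((warg m x : ℝ) + Complex.I * (-1 * ε : ℝ)) -
          boldF α ((warg m x : ℝ) + Complex.I * (1 * ε : ℝ)))) (𝓝[>] 0) (𝓝 0) := by
      have hsub : Tendsto (fun ε : ℝ => boldF α ((warg m x : ℝ) + Complex.I * (-1 * ε : ℝ)) -
          boldF α ((warg m x : ℝ) + Complex.I * (1 * ε : ℝ))) (𝓝[>] 0) (𝓝 0) := by
        have := F1.sub F2
        rwa [sub_self] at this
      have hbd : ∀ᶠ ε in 𝓝[>] (0 : ℝ),
          ‖Complex.log ((warg m x : ℝ) + Complex.I * (1 * ε : ℝ))‖ ≤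
            (|warg m x| + 1) + |warg m x|⁻¹ + Real.pi := by
        filter_upwards [self_mem_nhdsWithin, mem_nhdsWithin_of_mem_nhds (Iio_mem_nhds one_pos)]
          with ε hε hε1
        have hε : 0 < ε := hε
        have hε1 : ε < 1 := hε1
        have hre : |warg m x| ≤ ‖((warg m x : ℝ) : ℂ) + Complex.I * (1 * ε : ℝ)‖ := by
          refine le_trans (le_of_eq ?_) (Complex.abs_re_le_norm _)
          rw [re_add_I_mul]
        have hpos := abs_pos.2 hx
        refine (norm_clog_le (norm_pos_iff.1 (hpos.trans_le hre))).trans ?_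
        have := norm_add_I_mul_le (le_refl |warg m x|) (τ := 1 * ε)
          (by rw [one_mul, abs_of_pos hε]; exact hε1.le)
        gcongr
      exact isBoundedUnder_le_mul_tendsto_zero (isBoundedUnder_of_eventually_le hbd) hsub
    have htot := (((hlogj.mul F1).add hFd).const_mul c).add (E1.sub E2)
    rw [sub_self, add_zero, add_zero] at htot
    refine htot.congr fun ε => ?_
    simp only [Function.comp_def]
    ring

/-- Subtract the logarithmic connection formula below the cut from that above it, with the signs
taken as -i0 minus +i0. The entire part disappears, the coefficients Γ(a - j) are those built into
`rhoMinus`, and the jump -2πi of the logarithm yields the step function. The common factor 2i√π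
appears because the formula is for √π U_a. -/
theorem boundaryValue_deSitterU_sub_even (d : ℕ) (hd : Even d) (hd2 : 2 ≤ d) {m : ℝ} (hm : 0 < m)
    {φ : 𝓢(Mink d, ℂ)} (hφ : HasCompactSupport φ) :
    boundaryValue (deSitterU d m (-1)) φ - boundaryValue (deSitterU d m 1) φ =
      2 * Complex.I * (Real.sqrt Real.pi : ℝ) * negPowFEven d m φ := by
  set a := d / 2 - 1 with ha
  have h1s : ((1 : ℝ)) ^ 2 = 1 := by norm_num
  have h2s : ((-1 : ℝ)) ^ 2 = 1 := by norm_num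
  obtain ⟨E, hE, hU⟩ := exists_besselU_natCast_eq a
  set c : ℕ → ℂ := fun k => (-1 : ℂ) ^ k * Complex.Gamma (a - k) / k.factorial with hc
  have hbv : ∀ σ : ℝ, σ ^ 2 = 1 → ∀ j ∈ Finset.range a,
      HasBoundaryValue (wPow d m σ ((j : ℂ) - a)) := by
    intro σ hσ j hj
    have hj := Finset.mem_range.1 hj
    have h := hasBoundaryValue_wPow_neg_natCast d hd hm hσ (k := a - j) (by omega) (by omega)
    rwa [Nat.cast_sub hj.le, neg_sub] at h
  have hlim := (tendsto_besselU_warg d (by omega) hm h2s φ).sub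
    (tendsto_besselU_warg d (by omega) hm h1s φ)
  have hsum : Tendsto (fun ε => ∑ j ∈ Finset.range a, c j *
      ((∫ x, wPow d m (-1) ((j : ℂ) - a) ε x * φ x) - ∫ x, wPow d m 1 ((j : ℂ) - a) ε x * φ x))
      (𝓝[>] 0) (𝓝 (∑ j ∈ Finset.range a, c j * (boundaryValue (wPow d m (-1) ((j : ℂ) - a)) φ -
        boundaryValue (wPow d m 1 ((j : ℂ) - a)) φ))) :=
    tendsto_finsetSum _ fun j hj => ((tendsto_wPow d (hbv _ h2s j hj) φ).sub
      (tendsto_wPow d (hbv _ h1s j hj) φ)).const_mul _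
  have hjump := tendsto_integral_log_jump d hm.ne' (a : ℂ) hE.continuous hφ ((-1) ^ (a + 1))
  have hkey : ∀ ε : ℝ, 0 < ε → ((Real.sqrt Real.pi : ℝ) : ℂ) *
      ((∫ x, besselU ((d : ℂ) / 2 - 1) ((warg m x : ℝ) + Complex.I * (-1 * ε : ℝ)) * φ x) -
        ∫ x, besselU ((d : ℂ) / 2 - 1) ((warg m x : ℝ) + Complex.I * (1 * ε : ℝ)) * φ x) =
      ∑ j ∈ Finset.range a, c j *
      ((∫ x, wPow d m (-1) ((j : ℂ) - a) ε x * φ x) - ∫ x, wPow d m 1 ((j : ℂ) - a) ε x * φ x) +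
      ∫ x, ((-1) ^ (a + 1) * (Complex.log ((warg m x : ℝ) + Complex.I * (-1 * ε : ℝ)) *
          boldF a ((warg m x : ℝ) + Complex.I * (-1 * ε : ℝ))) +
        E ((warg m x : ℝ) + Complex.I * (-1 * ε : ℝ)) -
      ((-1) ^ (a + 1) * (Complex.log ((warg m x : ℝ) + Complex.I * (1 * ε : ℝ)) *
          boldF a ((warg m x : ℝ) + Complex.I * (1 * ε : ℝ))) +
        E ((warg m x : ℝ) + Complex.I * (1 * ε : ℝ)))) * φ x := by
    intro ε hε
    have i1 := integrable_besselU_warg d hm h2s hε φ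
    have i2 := integrable_besselU_warg d hm h1s hε φ
    have iw : ∀ j ∈ Finset.range a, Integrable fun x => c j *
        (wPow d m (-1) ((j : ℂ) - a) ε x * φ x - wPow d m 1 ((j : ℂ) - a) ε x * φ x) :=
      fun j hj => ((integrable_wPow_natCast_sub_mul d m h2s hε (Finset.mem_range.1 hj).le φ).sub
        (integrable_wPow_natCast_sub_mul d m h1s hε (Finset.mem_range.1 hj).le φ)).const_mul _
    have hs : ∑ j ∈ Finset.range a, c j * ((∫ x, wPow d m (-1) ((j : ℂ) - a) ε x * φ x) -
        ∫ x, wPow d m 1 ((j : ℂ) - a) ε x * φ x) = ∫ x, ∑ j ∈ Finset.range a, c j *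
        (wPow d m (-1) ((j : ℂ) - a) ε x * φ x - wPow d m 1 ((j : ℂ) - a) ε x * φ x) := by
      rw [integral_finsetSum _ iw]
      refine Finset.sum_congr rfl fun j hj => ?_
      rw [integral_const_mul, integral_sub
        (integrable_wPow_natCast_sub_mul d m h2s hε (Finset.mem_range.1 hj).le φ)
        (integrable_wPow_natCast_sub_mul d m h1s hε (Finset.mem_range.1 hj).le φ)]
    have hD : Integrable fun x => ((Real.sqrt Real.pi : ℝ) : ℂ) *
        (besselU ((d : ℂ) / 2 - 1) ((warg m x : ℝ) + Complex.I * (-1 * ε : ℝ)) * φ x -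
        besselU ((d : ℂ) / 2 - 1) ((warg m x : ℝ) + Complex.I * (1 * ε : ℝ)) * φ x) :=
      (i1.sub i2).const_mul _
    rw [hs, ← integral_sub i1 i2, ← integral_const_mul, ← sub_eq_iff_eq_add',
      ← integral_sub hD (integrable_finsetSum _ iw)]
    refine integral_congr_ae (Eventually.of_forall fun x => ?_)
    simp only
    have u1 := hU _ (add_I_mul_mem_slitPlane (w := warg m x) (τ := -1 * ε) (by linarith))
    have u2 := hU _ (add_I_mul_mem_slitPlane (w := warg m x) (τ := 1 * ε) (by linarith))
    rw [even_half_sub_one hd hd2, ← ha]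
    have e : ∑ j ∈ Finset.range a, c j * (wPow d m (-1) ((j : ℂ) - a) ε x * φ x -
        wPow d m 1 ((j : ℂ) - a) ε x * φ x) =
        (∑ j ∈ Finset.range a, c j * ((warg m x : ℝ) + Complex.I * (-1 * ε : ℝ)) ^ ((j : ℂ) - a)) *
          φ x - (∑ j ∈ Finset.range a,
          c j * ((warg m x : ℝ) + Complex.I * (1 * ε : ℝ)) ^ ((j : ℂ) - a)) * φ x := by
      rw [Finset.sum_mul, Finset.sum_mul, ← Finset.sum_sub_distrib]
      refine Finset.sum_congr rfl fun j _ => ?_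
      simp only [wPow]
      ring
    rw [e]
    linear_combination φ x * u1 - φ x * u2
  have hfin := tendsto_nhds_unique ((hlim.const_mul ((Real.sqrt Real.pi : ℝ) : ℂ)).congr'
    (by filter_upwards [self_mem_nhdsWithin] with ε hε using hkey ε hε)) (hsum.add hjump)
  have hpi : ((Real.sqrt Real.pi : ℝ) : ℂ) ≠ 0 := sqrt_pi_ne_zero
  have hpi2 : ((Real.sqrt Real.pi : ℝ) : ℂ) * ((Real.sqrt Real.pi : ℝ) : ℂ) = Real.pi := by
    exact_mod_cast Real.mul_self_sqrt Real.pi_pos.le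
  refine mul_left_cancel₀ hpi (hfin.trans ?_)
  have hN : negPowFEven d m φ = (∑ j ∈ Finset.range a,
      ((-1 : ℂ) ^ j / (j.factorial : ℂ)) * (Complex.Gamma (-((j : ℂ) - a)) /
        (2 * Real.pi * Complex.I) * (boundaryValue (wPow d m (-1) ((j : ℂ) - a)) φ -
          boundaryValue (wPow d m 1 ((j : ℂ) - a)) φ))) + (-1 : ℂ) ^ a *
      ∫ x in {x : Mink d | warg m x < 0}, boldF (a : ℂ) (warg m x : ℝ) * φ x := rfl
  rw [hN]
  have hpic : (Real.pi : ℂ) ≠ 0 := by exact_mod_cast Real.pi_ne_zero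
  have e1 : ((Real.sqrt Real.pi : ℝ) : ℂ) * (2 * Complex.I * (Real.sqrt Real.pi : ℝ) *
      (∑ j ∈ Finset.range a, ((-1 : ℂ) ^ j / (j.factorial : ℂ)) * (Complex.Gamma (-((j : ℂ) - a)) /
        (2 * Real.pi * Complex.I) * (boundaryValue (wPow d m (-1) ((j : ℂ) - a)) φ -
          boundaryValue (wPow d m 1 ((j : ℂ) - a)) φ)))) = ∑ j ∈ Finset.range a, c j *
        (boundaryValue (wPow d m (-1) ((j : ℂ) - a)) φ -
        boundaryValue (wPow d m 1 ((j : ℂ) - a)) φ) := by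
    rw [Finset.mul_sum, Finset.mul_sum]
    refine Finset.sum_congr rfl fun j _ => ?_
    simp only [hc]
    rw [neg_sub]
    generalize Complex.Gamma ((a : ℂ) - j) = G
    generalize boundaryValue (wPow d m (-1) ((j : ℂ) - a)) φ -
        boundaryValue (wPow d m 1 ((j : ℂ) - a)) φ = X
    have hI := Complex.I_ne_zero
    have hf : (j.factorial : ℂ) ≠ 0 := by exact_mod_cast j.factorial_ne_zero
    calc _ = (((Real.sqrt Real.pi : ℝ) : ℂ) * ((Real.sqrt Real.pi : ℝ) : ℂ)) * (2 * Complex.I *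
          ((-1 : ℂ) ^ j / (j.factorial : ℂ) * (G / (2 * Real.pi * Complex.I) * X))) := by ring
      _ = _ := by rw [hpi2]; field_simp
  rw [mul_add, mul_add, e1]
  congr 1
  rw [pow_succ]
  linear_combination (-2 * Complex.I * (-1) ^ a *
    ∫ x in {x : Mink d | warg m x < 0}, boldF (a : ℂ) (warg m x : ℝ) * φ x) * hpi2

/-! ### Jumps across the cut in odd dimension -/

/-- Taylor expansion of `𝐅_α`, locally uniform in the centre. -/
theorem exists_norm_boldF_sub_taylor_le (R : ℝ) (N : ℕ) : ∀ α : ℂ, ∃ C, 0 ≤ C ∧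
    ∀ w h : ℂ, ‖w‖ ≤ R → ‖h‖ ≤ 1 →
      ‖boldF α (w + h) - ∑ j ∈ Finset.range N, h ^ j / (j.factorial : ℂ) * boldF (α + j) w‖ ≤
        C * ‖h‖ ^ N := by
  induction N with
  | zero =>
    intro α
    obtain ⟨B, hB0, hB⟩ := exists_norm_le_closedBall (differentiable_boldF α).continuous (R + 1)
    refine ⟨B, hB0, fun w h hw hh => ?_⟩
    simpa using hB _ ((norm_add_le w h).trans (add_le_add hw hh))
  | succ N ih =>
    intro α
    obtain ⟨C, hC0, hC⟩ := ih (α + 1)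
    refine ⟨C, hC0, fun w h hw hh => ?_⟩
    -- The derivative of the remainder of order N + 1 for 𝐅_α is the remainder of order N for
    -- 𝐅_{α+1}; the mean value inequality then gains one power of |h|.
    have hder : ∀ k : ℂ, HasDerivAt (fun k : ℂ => boldF α (w + k) -
        ∑ j ∈ Finset.range (N + 1), k ^ j / (j.factorial : ℂ) * boldF (α + j) w)
        (boldF (α + 1) (w + k) -
          ∑ j ∈ Finset.range N, k ^ j / (j.factorial : ℂ) * boldF (α + 1 + j) w) k := by
      intro k
      have h1 : HasDerivAt (fun k : ℂ => boldF α (w + k)) (boldF (α + 1) (w + k)) k :=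
        (hasDerivAt_boldF α (w + k)).comp_const_add w k
      have h2 : HasDerivAt (fun k : ℂ => ∑ j ∈ Finset.range (N + 1),
          k ^ j / (j.factorial : ℂ) * boldF (α + j) w)
          (∑ j ∈ Finset.range (N + 1), (j : ℂ) * k ^ (j - 1) / (j.factorial : ℂ) *
            boldF (α + j) w) k :=
        HasDerivAt.fun_sum fun j _ => ((hasDerivAt_pow j k).div_const _).mul_const _
      refine (h1.sub h2).congr_deriv ?_
      congr 1
      rw [Finset.sum_range_succ']
      simp only [Nat.cast_zero, zero_mul, zero_div, add_zero]
      refine Finset.sum_congr rfl fun j _ => ?_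
      rw [Nat.add_sub_cancel, Nat.factorial_succ, show α + ((j + 1 : ℕ) : ℂ) = α + 1 + j by
        push_cast; ring]
      have hj : ((j + 1 : ℕ) : ℂ) ≠ 0 := Nat.cast_ne_zero.2 j.succ_ne_zero
      congr 1
      rw [Nat.cast_mul, mul_div_mul_left _ _ hj]
    have hmv := (convex_closedBall (0 : ℂ) ‖h‖).norm_image_sub_le_of_norm_hasDerivWithin_le
      (C := C * ‖h‖ ^ N) (fun k _ => (hder k).hasDerivWithinAt)
      (fun k hk => by
        have hk : ‖k‖ ≤ ‖h‖ := by simpa using hk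
        refine (hC w k hw (hk.trans hh)).trans ?_
        gcongr) (x := 0) (y := h) (by simp) (by simp)
    have h0 : boldF α (w + 0) - ∑ j ∈ Finset.range (N + 1),
        (0 : ℂ) ^ j / (j.factorial : ℂ) * boldF (α + j) w = 0 := by
      rw [Finset.sum_range_succ']
      simp
    rw [h0, sub_zero, sub_zero] at hmv
    rwa [pow_succ, ← mul_assoc]

theorem mulBoldF_apply (d : ℕ) (m : ℝ) (α : ℂ) (φ : 𝓢(Mink d, ℂ)) (hφ : HasCompactSupport φ)
    (x : Mink d) : mulBoldF d m α φ hφ x = boldF α (warg m x : ℝ) * φ x := rfl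

/-- On bounded sets, `(w + iσε)^l` grows at most like a power of `1/ε`. -/
theorem exists_norm_add_I_mul_cpow_le {σ : ℝ} (hσ : σ ^ 2 = 1) (l R : ℝ) :
    ∃ (N : ℕ) (C : ℝ), 0 ≤ C ∧ ∀ w ε : ℝ, |w| ≤ R → 0 < ε → ε < 1 →
      ‖((w : ℂ) + Complex.I * (σ * ε : ℝ)) ^ (l : ℂ)‖ * ε ^ N ≤ C := by
  obtain ⟨N, hN⟩ := exists_nat_ge (-l)
  refine ⟨N, max 1 (max (R + 1) 0 ^ l), by positivity, fun w ε hw hε hε1 => ?_⟩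
  have hz := le_norm_add_I_mul hσ w hε
  have hz2 : ‖(w : ℂ) + Complex.I * (σ * ε : ℝ)‖ ≤ R + 1 :=
    norm_add_I_mul_le hw (by
      rcases abs_eq_one_of_sq hσ with h
      rw [abs_mul, h, one_mul, abs_of_pos hε]; exact hε1.le)
  rw [Complex.norm_cpow_real]
  rcases le_total l 0 with hl | hl
  · refine le_trans ?_ (le_max_left _ _)
    calc _ ≤ ε ^ l * ε ^ N := by
          gcongr ?_ * _
          exact Real.rpow_le_rpow_of_nonpos hε hz hl
      _ = ε ^ (l + N) := by rw [Real.rpow_add hε, Real.rpow_natCast]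
      _ ≤ 1 := Real.rpow_le_one hε.le hε1.le (by linarith)
  · refine le_trans ?_ (le_max_right _ _)
    calc _ ≤ (max (R + 1) 0) ^ l * 1 := by
          gcongr
          · exact hz2.trans (le_max_left _ _)
          · exact pow_le_one₀ hε.le hε1.le
      _ = _ := mul_one _

/-- The boundary value of `(w + iσε)^l 𝐅_l(w + iσε)` is the product of the distribution
`(w + iσ0)^l` and the smooth function `𝐅_l(w)`. -/
theorem tendsto_integral_wPow_mul_boldF (d : ℕ) {m σ : ℝ} (hσ : σ ^ 2 = 1) {l : ℝ}
    (hbv : HasBoundaryValue (wPow d m σ l)) (α : ℂ) (φ : 𝓢(Mink d, ℂ)) (hφ : HasCompactSupport φ) :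
    (∀ᶠ ε in 𝓝[>] (0 : ℝ), Integrable fun x : Mink d => wPow d m σ l ε x *
      boldF α ((warg m x : ℝ) + Complex.I * (σ * ε : ℝ)) * φ x) ∧
    Tendsto (fun ε : ℝ => ∫ x, wPow d m σ l ε x *
      boldF α ((warg m x : ℝ) + Complex.I * (σ * ε : ℝ)) * φ x) (𝓝[>] 0)
      (𝓝 (boundaryValue (wPow d m σ l) (mulBoldF d m α φ hφ))) := by
  obtain ⟨R, hR⟩ := hφ.isCompact.exists_bound_of_continuousOn
    (continuous_warg (d := d) m).continuousOn
  obtain ⟨N, C, hC0, hC⟩ := exists_norm_add_I_mul_cpow_le hσ l R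
  obtain ⟨B, hB0, hB⟩ := exists_norm_boldF_sub_taylor_le R (N + 1) α
  -- P is the Taylor remainder about the real point w, of size ε^{N+1}. The power of w + iσε is at
  -- most of size ε^{-N} on the support of φ, so this part vanishes. In the Taylor polynomial each
  -- term j ≥ 1 has a factor ε^j times a convergent pairing, and only j = 0 survives.
  set P : ℝ → Mink d → ℂ := fun ε x => boldF α ((warg m x : ℝ) + Complex.I * (σ * ε : ℝ)) -
    ∑ j ∈ Finset.range (N + 1), (Complex.I * (σ * ε : ℝ)) ^ j / (j.factorial : ℂ) *
      boldF (α + j) (warg m x : ℝ) with hP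
  have hbound : ∀ ε : ℝ, 0 < ε → ε < 1 → ∀ x : Mink d,
      ‖wPow d m σ l ε x * P ε x * φ x‖ ≤ ε * (C * B) * ‖φ x‖ := by
    intro ε hε hε1 x
    by_cases hx : x ∈ tsupport φ
    swap
    · rw [image_eq_zero_of_notMem_tsupport hx, mul_zero, norm_zero, mul_zero]
    have hw : |warg m x| ≤ R := hR x hx
    have hh : ‖Complex.I * ((σ * ε : ℝ) : ℂ)‖ = ε := by
      rw [norm_mul, Complex.norm_I, one_mul, Complex.norm_real, Real.norm_eq_abs, abs_mul,
        abs_eq_one_of_sq hσ, one_mul, abs_of_pos hε]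
    have h1 := hC _ ε hw hε hε1
    have h2 := hB (warg m x : ℝ) (Complex.I * (σ * ε : ℝ))
      (by rwa [Complex.norm_real, Real.norm_eq_abs]) (by rw [hh]; exact hε1.le)
    rw [hh] at h2
    rw [norm_mul, norm_mul]
    refine mul_le_mul_of_nonneg_right ?_ (norm_nonneg _)
    calc _ ≤ ‖wPow d m σ l ε x‖ * (B * ε ^ (N + 1)) :=
          mul_le_mul_of_nonneg_left h2 (norm_nonneg _)
      _ = ε * ((‖wPow d m σ l ε x‖ * ε ^ N) * B) := by ring
      _ ≤ _ := mul_le_mul_of_nonneg_left (mul_le_mul_of_nonneg_right h1 hB0) hε.le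
  have hPint : ∀ ε : ℝ, 0 < ε → ε < 1 →
      Integrable fun x : Mink d => wPow d m σ l ε x * P ε x * φ x := by
    intro ε hε hε1
    refine Integrable.mono' (φ.integrable.norm.const_mul (ε * (C * B))) ?_
      (Eventually.of_forall (hbound ε hε hε1))
    refine Measurable.aestronglyMeasurable ?_
    have hb : ∀ β, Measurable (boldF β) := fun β => (differentiable_boldF β).continuous.measurable
    have hw := (continuous_warg (d := d) m).measurable
    have h4 := φ.continuous.measurable
    have h5 := measurable_wPow d m σ l ε
    refine (h5.mul ((by fun_prop : Measurable _).sub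
      (Finset.measurable_fun_sum _ fun j _ => ?_))).mul h4
    have := hb (α + j)
    fun_prop
  obtain ⟨T, hT⟩ := id hbv
  have hTint : ∀ ε : ℝ, 0 < ε → Integrable fun x : Mink d => ∑ j ∈ Finset.range (N + 1),
      (Complex.I * (σ * ε : ℝ)) ^ j / (j.factorial : ℂ) *
        (wPow d m σ l ε x * mulBoldF d m (α + j) φ hφ x) := fun ε hε =>
    integrable_finsetSum _ fun j _ => (hT.1 ε hε _).const_mul _
  have hsplit : ∀ (ε : ℝ) (x : Mink d), wPow d m σ l ε x *
      boldF α ((warg m x : ℝ) + Complex.I * (σ * ε : ℝ)) * φ x =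
      wPow d m σ l ε x * P ε x * φ x + ∑ j ∈ Finset.range (N + 1),
      (Complex.I * (σ * ε : ℝ)) ^ j / (j.factorial : ℂ) *
        (wPow d m σ l ε x * mulBoldF d m (α + j) φ hφ x) := by
    intro ε x
    have : ∑ j ∈ Finset.range (N + 1), (Complex.I * (σ * ε : ℝ)) ^ j / (j.factorial : ℂ) *
        (wPow d m σ l ε x * mulBoldF d m (α + j) φ hφ x) = wPow d m σ l ε x *
        (∑ j ∈ Finset.range (N + 1), (Complex.I * (σ * ε : ℝ)) ^ j / (j.factorial : ℂ) *
          boldF (α + j) (warg m x : ℝ)) * φ x := by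
      rw [Finset.mul_sum, Finset.sum_mul]
      refine Finset.sum_congr rfl fun j _ => ?_
      rw [mulBoldF_apply]; ring
    rw [this]
    simp only [hP]
    ring
  have hsmall : ∀ᶠ ε in 𝓝[>] (0 : ℝ), 0 < ε ∧ ε < 1 := by
    filter_upwards [self_mem_nhdsWithin, mem_nhdsWithin_of_mem_nhds (Iio_mem_nhds one_pos)]
      with ε hε hε1 using ⟨hε, hε1⟩
  have hid : Tendsto (fun ε : ℝ => ε) (𝓝[>] 0) (𝓝 0) := nhdsWithin_le_nhds
  constructor
  · filter_upwards [hsmall] with ε hε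
    simp only [hsplit]
    exact (hPint ε hε.1 hε.2).add (hTint ε hε.1)
  · have hrem : Tendsto (fun ε : ℝ => ∫ x : Mink d, wPow d m σ l ε x * P ε x * φ x)
        (𝓝[>] 0) (𝓝 0) := by
      have hg : Tendsto (fun ε : ℝ => ε * (C * B * ∫ x : Mink d, ‖φ x‖)) (𝓝[>] 0) (𝓝 0) := by
        simpa using hid.mul_const (C * B * ∫ x : Mink d, ‖φ x‖)
      refine squeeze_zero_norm' ?_ hg
      filter_upwards [hsmall] with ε hε
      refine (norm_integral_le_of_norm_le (φ.integrable.norm.const_mul (ε * (C * B)))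
        (Eventually.of_forall (hbound ε hε.1 hε.2))).trans (le_of_eq ?_)
      rw [integral_const_mul]
      ring
    have hmain : Tendsto (fun ε : ℝ => ∑ j ∈ Finset.range (N + 1),
        (Complex.I * (σ * ε : ℝ)) ^ j / (j.factorial : ℂ) *
          ∫ x : Mink d, wPow d m σ l ε x * mulBoldF d m (α + j) φ hφ x) (𝓝[>] 0)
        (𝓝 (∑ j ∈ Finset.range (N + 1), (0 : ℂ) ^ j / (j.factorial : ℂ) *
          boundaryValue (wPow d m σ l) (mulBoldF d m (α + j) φ hφ))) := by
      refine tendsto_finsetSum _ fun j _ => ?_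
      refine Tendsto.mul (Tendsto.div_const (Tendsto.pow ?_ j) _) (tendsto_wPow d hbv _)
      have hc : Continuous fun ε : ℝ => Complex.I * ((σ * ε : ℝ) : ℂ) := by fun_prop
      simpa [Function.comp_def] using (hc.tendsto 0).comp hid
    rw [Finset.sum_range_succ'] at hmain
    simp only [ne_eq, Nat.add_eq_zero_iff, one_ne_zero, and_false, not_false_eq_true, zero_pow,
      zero_div, zero_mul, Finset.sum_const_zero, zero_add, pow_zero, Nat.factorial_zero,
      Nat.cast_one, div_one, one_mul, Nat.cast_zero, add_zero] at hmain
    have htot := hrem.add hmain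
    rw [zero_add] at htot
    refine htot.congr' ?_
    filter_upwards [hsmall] with ε hε
    simp only [hsplit]
    rw [integral_add (hPint ε hε.1 hε.2) (hTint ε hε.1), integral_finsetSum _ fun j _ =>
      (hT.1 ε hε.1 _).const_mul _]
    simp only [integral_const_mul]

theorem tendsto_integral_boldF_warg (d : ℕ) (m : ℝ) {σ : ℝ} (hσ : σ ^ 2 = 1) (α : ℂ)
    (φ : 𝓢(Mink d, ℂ)) (hφ : HasCompactSupport φ) :
    (∀ᶠ ε in 𝓝[>] (0 : ℝ), Integrable fun x : Mink d =>
      boldF α ((warg m x : ℝ) + Complex.I * (σ * ε : ℝ)) * φ x) ∧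
    Tendsto (fun ε : ℝ => ∫ x : Mink d,
      boldF α ((warg m x : ℝ) + Complex.I * (σ * ε : ℝ)) * φ x) (𝓝[>] 0)
      (𝓝 (∫ x : Mink d, boldF α (warg m x : ℝ) * φ x)) := by
  obtain ⟨R, hR⟩ := hφ.isCompact.exists_bound_of_continuousOn
    (continuous_warg (d := d) m).continuousOn
  have hFc := (differentiable_boldF α).continuous
  obtain ⟨B, hB0, hB⟩ := exists_norm_le_closedBall hFc (R + 1)
  have hmeas : ∀ ε : ℝ, AEStronglyMeasurable (fun x : Mink d =>
      boldF α ((warg m x : ℝ) + Complex.I * (σ * ε : ℝ)) * φ x) := by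
    intro ε
    have hw := continuous_warg (d := d) m
    have h4 := φ.continuous
    exact (by fun_prop : Continuous _).aestronglyMeasurable
  have hbound : ∀ᶠ ε in 𝓝[>] (0 : ℝ), ∀ᵐ x : Mink d,
      ‖boldF α ((warg m x : ℝ) + Complex.I * (σ * ε : ℝ)) * φ x‖ ≤ B * ‖φ x‖ := by
    filter_upwards [self_mem_nhdsWithin, mem_nhdsWithin_of_mem_nhds (Iio_mem_nhds one_pos)]
      with ε hε hε1
    refine Eventually.of_forall fun x => ?_
    rw [norm_mul]
    by_cases hx : x ∈ tsupport φ
    swap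
    · rw [image_eq_zero_of_notMem_tsupport hx, norm_zero, mul_zero, mul_zero]
    refine mul_le_mul_of_nonneg_right (hB _ (norm_add_I_mul_le (hR x hx) ?_)) (norm_nonneg _)
    rw [abs_mul, abs_eq_one_of_sq hσ, one_mul, abs_of_pos hε]
    exact hε1.le
  constructor
  · filter_upwards [hbound] with ε hε
    exact Integrable.mono' (φ.integrable.norm.const_mul B) (hmeas ε) hε
  · refine tendsto_integral_filter_of_dominated_convergence _ (Eventually.of_forall hmeas) hbound
      (φ.integrable.norm.const_mul B) (Eventually.of_forall fun x => ?_)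
    exact ((hFc.tendsto _).comp (tendsto_add_I_mul _ σ)).mul_const _

/-- For d = 2k + 1 the order is k - 1/2, and the half-integer connection formula passes to the limit
term by term: a singular power times a smooth function, and a function with no jump. -/
theorem boundaryValue_deSitterU_odd (k : ℕ) {m σ : ℝ} (hm : 0 < m) (hσ : σ ^ 2 = 1)
    (φ : 𝓢(Mink (2 * k + 1), ℂ)) (hφ : HasCompactSupport φ) :
    boundaryValue (deSitterU (2 * k + 1) m σ) φ = (-1) ^ (k + 1) * (Real.sqrt Real.pi : ℝ) *
      (boundaryValue (wPow (2 * k + 1) m σ (1 - ((2 * k + 1 : ℕ) : ℂ) / 2))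
          (mulBoldF (2 * k + 1) m (1 - ((2 * k + 1 : ℕ) : ℂ) / 2) φ hφ) -
        ∫ x : Mink (2 * k + 1), boldF (k - 1 / 2) (warg m x : ℝ) * φ x) := by
  have hbv := hasBoundaryValue_wPow_of_odd (2 * k + 1) (by simp) hm hσ
  have hl : 1 - ((2 * k + 1 : ℕ) : ℂ) / 2 = ((1 / 2 - k : ℝ) : ℂ) := by push_cast; ring
  have hα : ((2 * k + 1 : ℕ) : ℂ) / 2 - 1 = (k : ℂ) - 1 / 2 := by push_cast; ring
  have hσ0 : σ ≠ 0 := fun h => by simp [h] at hσ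
  have hlim := tendsto_besselU_warg (2 * k + 1) (by omega) hm hσ φ
  rw [hl] at hbv ⊢
  rw [hα] at hlim
  obtain ⟨hA, hAlim⟩ := tendsto_integral_wPow_mul_boldF _ hσ hbv ((1 / 2 - k : ℝ) : ℂ) φ hφ
  obtain ⟨hB, hBlim⟩ := tendsto_integral_boldF_warg _ m hσ ((k : ℂ) - 1 / 2) φ hφ
  refine tendsto_nhds_unique hlim
    (((hAlim.sub hBlim).const_mul ((-1) ^ (k + 1) * ((Real.sqrt Real.pi : ℝ) : ℂ))).congr' ?_)
  filter_upwards [hA, hB, self_mem_nhdsWithin] with ε h1 h2 hε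
  rw [← integral_sub h1 h2, ← integral_const_mul]
  refine integral_congr_ae (Eventually.of_forall fun x => ?_)
  have hz := add_I_mul_mem_slitPlane (w := warg m x) (mul_ne_zero hσ0 (ne_of_gt hε))
  have e : ((1 / 2 - k : ℝ) : ℂ) = -((k : ℂ) - 1 / 2) := by push_cast; ring
  simp only [besselU_half_integer k hz, wPow, e]
  ring

theorem sin_pi_mul_half_sub (k : ℕ) :
    Complex.sin (Real.pi * (1 - ((2 * k + 1 : ℕ) : ℂ) / 2)) = (-1) ^ k := by
  have : (Real.pi : ℂ) * (1 - ((2 * k + 1 : ℕ) : ℂ) / 2) = Real.pi / 2 - (k : ℂ) * Real.pi := by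
    push_cast; ring
  rw [this, Complex.sin_pi_div_two_sub]
  exact_mod_cast Real.cos_nat_mul_pi k

/-- The integral of 𝐅_{k-1/2} is the same on both sides of the cut and cancels. The difference of
the powers is 2i sin(πλ) w₋^λ with sin(πλ) = (-1)^k, which combines with (-1)^{k+1} to the sign -1.
-/
theorem boundaryValue_deSitterU_sub_odd (k : ℕ) {m : ℝ} (hm : 0 < m)
    (φ : 𝓢(Mink (2 * k + 1), ℂ)) (hφ : HasCompactSupport φ) :
    boundaryValue (deSitterU (2 * k + 1) m 1) φ - boundaryValue (deSitterU (2 * k + 1) m (-1)) φ =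
      -(2 * Complex.I * (Real.sqrt Real.pi : ℝ) * negPowFOdd (2 * k + 1) m φ hφ) := by
  rw [boundaryValue_deSitterU_odd k hm (by norm_num) φ hφ,
    boundaryValue_deSitterU_odd k hm (by norm_num) φ hφ, negPowFOdd, wMinusPow,
    sin_pi_mul_half_sub]
  rw [smul_apply, sub_apply, smul_eq_mul]
  have h1 : ((-1 : ℂ) ^ k) ≠ 0 := pow_ne_zero _ (by norm_num)
  have h2 : ((-1 : ℂ) ^ k) * (-1) ^ k = 1 := by rw [← mul_pow]; norm_num
  have hI := Complex.I_ne_zero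
  field_simp
  rw [pow_succ]
  generalize (-1 : ℂ) ^ k = s at h2 ⊢
  linear_combination (-(boundaryValue (wPow (2 * k + 1) m 1 ((2 - ((2 * k + 1 : ℕ) : ℂ)) / 2))
    (mulBoldF (2 * k + 1) m ((2 - ((2 * k + 1 : ℕ) : ℂ)) / 2) φ hφ) -
    boundaryValue (wPow (2 * k + 1) m (-1) ((2 - ((2 * k + 1 : ℕ) : ℂ)) / 2))
      (mulBoldF (2 * k + 1) m ((2 - ((2 * k + 1 : ℕ) : ℂ)) / 2) φ hφ))) * h2

end DeSitter

end

/-! ### Assembly of the theorem from the transforms and the jumps -/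

theorem mainTheorem12 (d : ℕ) (hd : 1 ≤ d) (m : ℝ) (hm : 0 < m) :
    -- the one-sheeted hyperboloid (de Sitter space)
    (DeSitter.HasBoundaryValue (DeSitter.deSitterU d m 1) ∧
      DeSitter.HasBoundaryValue (DeSitter.deSitterU d m (-1)) ∧
      ∃ T : 𝓢'(DeSitter.Mink d, ℂ),
        DeSitter.IsFourierTransform (DeSitter.deSitterMeasure d m) T ∧
        T = (-((m : ℂ) ^ (d - 1) * (Real.pi : ℂ) ^ (((d : ℂ) - 1) / 2))) •
            (Complex.I ^ d • DeSitter.boundaryValue (DeSitter.deSitterU d m 1) +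
              (-Complex.I) ^ d • DeSitter.boundaryValue (DeSitter.deSitterU d m (-1))) ∧
        (Even d →
          (∀ k : ℕ, 1 ≤ k → k ≤ d / 2 - 1 → ∀ σ : ℝ, σ = 1 ∨ σ = -1 →
            DeSitter.HasBoundaryValue (DeSitter.wPow d m σ (-(k : ℂ)))) ∧
          ∀ σ : ℝ, σ = 1 ∨ σ = -1 →
            ∀ φ : 𝓢(DeSitter.Mink d, ℂ), HasCompactSupport φ →
              T φ = (-1 : ℂ) ^ (d / 2 + 1) * 2 * (m : ℂ) ^ (d - 1) *
                (Real.pi : ℂ) ^ (((d : ℂ) - 1) / 2) *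
                (DeSitter.boundaryValue (DeSitter.deSitterU d m σ) φ +
                  (σ : ℂ) * (Real.sqrt Real.pi : ℝ) * Complex.I * DeSitter.negPowFEven d m φ)) ∧
        (Odd d →
          (∀ σ : ℝ, σ = 1 ∨ σ = -1 →
            DeSitter.HasBoundaryValue (DeSitter.wPow d m σ (1 - (d : ℂ) / 2))) ∧
          ∀ (φ : 𝓢(DeSitter.Mink d, ℂ)) (hφ : HasCompactSupport φ),
            T φ = -2 * Complex.I ^ (d - 1) * (m : ℂ) ^ (d - 1) * (Real.pi : ℂ) ^ ((d : ℂ) / 2) *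
              DeSitter.negPowFOdd d m φ hφ)) ∧
    -- the two sheets of the two-sheeted hyperboloid
    (∀ σ : ℝ, σ = 1 ∨ σ = -1 →
      DeSitter.HasBoundaryValue (DeSitter.hyperbolicU d m σ) ∧
      DeSitter.IsFourierTransform (DeSitter.hyperbolicMeasure d m σ)
        (((m : ℂ) ^ (d - 1) * (Real.pi : ℂ) ^ (((d : ℂ) - 1) / 2)) •
          DeSitter.boundaryValue (DeSitter.hyperbolicU d m σ))) := by
  obtain ⟨h1, h2, hT⟩ := DeSitter.deSitter_fourier d hd hm
  have hsq : ∀ σ : ℝ, σ = 1 ∨ σ = -1 → σ ^ 2 = 1 := by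
    rintro σ (rfl | rfl) <;> norm_num
  refine ⟨⟨h1, h2, _, hT, rfl, fun he => ⟨fun k hk hkd σ hσ =>
    DeSitter.hasBoundaryValue_wPow_neg_natCast d he hm (hsq σ hσ) hk hkd, ?_⟩,
    fun ho => ⟨fun σ hσ => DeSitter.hasBoundaryValue_wPow_of_odd d ho hm (hsq σ hσ), ?_⟩⟩,
    fun σ hσ => DeSitter.hyperbolic_fourier d hd hm (hsq σ hσ)⟩
  · intro σ hσ φ hφ
    have hd2 : 2 ≤ d := by
      obtain ⟨r, hr⟩ := he
      omega
    have hjump := DeSitter.boundaryValue_deSitterU_sub_even d he hd2 hm hφ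
    -- For even d the weights i^d and (-i)^d coincide, so the sum of the two boundary values is
    -- twice either one plus or minus the jump. This gives the two choices of sign.
    have e1 : Complex.I ^ d = (-1) ^ (d / 2) := by
      conv_lhs => rw [← Nat.two_mul_div_two_of_even he, pow_mul, Complex.I_sq]
    have e2 : (-Complex.I) ^ d = (-1) ^ (d / 2) := by rw [he.neg_pow, e1]
    rw [smul_apply, add_apply, smul_apply, smul_apply, smul_eq_mul, smul_eq_mul, smul_eq_mul,
      e1, e2, pow_succ]
    rcases hσ with rfl | rfl
    · push_cast
      linear_combination (-((m : ℂ) ^ (d - 1) * (Real.pi : ℂ) ^ (((d : ℂ) - 1) / 2)) *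
        (-1) ^ (d / 2)) * hjump
    · push_cast
      linear_combination ((m : ℂ) ^ (d - 1) * (Real.pi : ℂ) ^ (((d : ℂ) - 1) / 2) *
        (-1) ^ (d / 2)) * hjump
  · intro φ hφ
    obtain ⟨k, rfl⟩ := ho
    have hjump := DeSitter.boundaryValue_deSitterU_sub_odd k hm φ hφ
    -- For odd d the weights are opposite and the sum is itself a jump. The factor √π in the jump
    -- raises π^{(d-1)/2} to π^{d/2}, and its factor i turns i^d into -i^{d-1}.
    have hpi : (Real.pi : ℂ) ^ (((2 * k + 1 : ℕ) : ℂ) / 2) =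
        (Real.pi : ℂ) ^ ((((2 * k + 1 : ℕ) : ℂ) - 1) / 2) * (Real.sqrt Real.pi : ℝ) := by
      have h0 : (Real.pi : ℂ) ≠ 0 := by exact_mod_cast Real.pi_ne_zero
      have hs : ((Real.sqrt Real.pi : ℝ) : ℂ) = (Real.pi : ℂ) ^ (1 / 2 : ℂ) := by
        rw [Real.sqrt_eq_rpow, Complex.ofReal_cpow Real.pi_pos.le]
        norm_num
      rw [hs, ← Complex.cpow_add _ _ h0]
      congr 1
      ring
    rw [smul_apply, add_apply, smul_apply, smul_apply, smul_eq_mul, smul_eq_mul, smul_eq_mul,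
      (odd_two_mul_add_one k).neg_pow, hpi, show (m : ℂ) ^ (2 * k + 1 - 1) = (m : ℂ) ^ (2 * k) from rfl,
      show Complex.I ^ (2 * k + 1 - 1) = Complex.I ^ (2 * k) from rfl, pow_succ]
    set S := (Real.pi : ℂ) ^ ((((2 * k + 1 : ℕ) : ℂ) - 1) / 2)
    linear_combination (-((m : ℂ) ^ (2 * k) * S) * (Complex.I ^ (2 * k) * Complex.I)) * hjump +
      (2 * (m : ℂ) ^ (2 * k) * S * Complex.I ^ (2 * k) * (Real.sqrt Real.pi : ℝ) *
        DeSitter.negPowFOdd (2 * k + 1) m φ hφ) * Complex.I_sq
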